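/- **Setting.** Let $k\ge 1$ and let $(Y(0),Y(1),X,W)$ be a population with $Y(0),Y(1)\in\mathbb R$, $X\in\mathbb R^k$, $W\in\{0,1\}$ and $0<\Pr(W=1)<1$. Put $Y=Y(W)$, $\mu(x,w)=\mathbb E[Y\mid X=x,W=w]$, $\epsilon=Y-\mu(X,W)$, $\sigma^2(x,w)=\mathrm{var}(Y\mid X=x,W=w)$ and $\tau=\mathbb E[Y(1)-Y(0)\mid W=1]$. Let $\mathbb X_w$ be the support and $f_w$ (a version of) the density of $X$ given $W=w$. For each $n$ one observes $N_1=N_1(n)$ treated and $N_0=N_0(n)$ control observations $(X_i,Y_i)$, all independent, the treated ones drawn from the law of $(X,Y)$ given $W=1$ and the controls from the law of $(X,Y)$ given $W=0$. Fix $M\ge 1$, a positive definite matrix $V$ and $c\in\mathbb R$. For a treated unit $i$ let $\mathcal J_M(i)$ be the $M$ control units $j$ with the smallest distance $[(X_j-X_i)'V(X_j-X_i)]^{1/2}$ (with replacement across $i$; ties, which have probability zero, are broken by the index), and let $\hat\tau_i=\big(Y_i-\frac1M\sum_{j\in\mathcal J_M(i)}Y_j\big)-c$ and $S=(\hat\tau_1,\dots,\hat\tau_{N_1})$.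 For $v\in\mathbb R^{N_1}$ with mean $\bar v$ let $s(v)=\big(\frac1{N_1-1}\sum_i(v_i-\bar v)^2\big)^{1/2}$, $T(v)=|\bar v|/s(v)$ and $R(v)=\sqrt{N_1}\,\bar v/s(v)$ (with the convention $0$ if $s(v)=0$). Let $\mathbf G=\{-1,1\}^{N_1}$ act by $gv=(g_1v_1,\dots,g_{N_1}v_{N_1})$, let $K=|\mathbf G|$, and let $T^{(1)}(v)\le\dots\le T^{(K)}(v)$ be the ordered values of $T(gv)$, $g\in\mathbf G$. The sign-changes test of level $\alpha$ is $\phi_\alpha(S)=1$ if $T(S)>T^{(\lceil K(1-\alpha)\rceil)}(S)$, and $\phi_\alpha(S)=0$ otherwise. Finally let $\widehat F_{T^*}(t)=K^{-1}\,|\{g\in\mathbf G: R(gS)\le t\}|$, $F_T(t)=\Pr(R(S)\le t)$, and let $\Phi$ be the standard normal distribution function. **Proposition.** Suppose that 1. $Y(0)\perp W\mid X$; 2. $X$ is absolutely continuous; $\mathbb X_1\subseteq\mathbb X_0$ are compact; $f_1$ and $f_0$ are differentiable in the interior of their supports and bounded above on $\mathbb X_1$, and $f_0$ is bounded below by a positive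 constant on $\mathbb X_1$; and there are $\varphi,\rho_0>0$ such that for all $x\in\mathbb X_1$ and $0<\rho\le\rho_0$ at least a fraction $\varphi$ of the volume of the ball of radius $\rho$ around $x$ lies in $\mathbb X_1$; 3. for $w=0,1$: $\mu(\cdot,w)$ and $\sigma^2(\cdot,w)$ (have versions that) are Lipschitz on $\mathbb X_0$; for some $\gamma>0$, $\mathbb E[|\epsilon|^{4+\gamma}\mid W=w,X=x]$ exists and is bounded uniformly in $x$; and $\sigma^2(\cdot,w)$ is bounded away from zero on $\mathbb X_w$; 4. $N_1,N_0\to\infty$ and, for some $r>\max\{k/2,2\}$, $N_1^r/N_0\to\theta$ with $0<\theta<\infty$. If the null hypothesis $H_0:\tau=c$ is true, then the sign-changes test is asymptotically valid: for every $\alpha\in(0,1)$, $$\limsup_{n\to\infty}\mathbb E[\phi_\alpha(S)]\le\alpha .$$ Moreover $\sup_{t\in\mathbb R}|\widehat F_{T^*}(t)-F_T(t)|\to0$ in probability; in fact $\sup_{t\in\mathbb R}|\widehat F_{T^*}(t)-\Phi(t)|\to0$ in probability and $\sup_{t\in\mathbb R}|F_T(t)-\Phi(t)|\to0$. No symmetry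 of the outcome or treatment-effect distributions is assumed. -/

import Mathlib

open MeasureTheory ProbabilityTheory Filter Topology

namespace NNMatching

noncomputable section

/-- The covariate space `ℝᵏ` with its Euclidean norm and Lebesgue measure. -/
abbrev Cov (k : ℕ) : Type := EuclideanSpace ℝ (Fin k)

/-! ### The population `(Y(0), Y(1), X, W)` on a probability space `(S, Q)`

`Y w` is the potential outcome under treatment status `w`, where `w = 1` means treated. -/

section Population

variable {S : Type*} [MeasurableSpace S] {k : ℕ}

/-- The population law conditional on `W = w`. -/
def givenW (Q : Measure S) (W : S → Fin 2) (w : Fin 2) : Measure S :=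
  ProbabilityTheory.cond Q (W ⁻¹' {w})

/-- The observed outcome `Y = Y(W)`. -/
def observed (Y : Fin 2 → S → ℝ) (W : S → Fin 2) (s : S) : ℝ := Y (W s) s

/-- The average treatment effect on the treated, `τ = E[Y(1) - Y(0) | W = 1]`. -/
def att (Q : Measure S) (Y : Fin 2 → S → ℝ) (W : S → Fin 2) : ℝ :=
  ∫ s, (Y 1 s - Y 0 s) ∂(givenW Q W 1)

/-- The σ-algebra generated by the covariates. -/
abbrev sigmaX (X : S → Cov k) : MeasurableSpace S := MeasurableSpace.comap X inferInstance

/-- `𝕏_w`, the (topological) support of `X` conditional on `W = w`. -/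
def suppX (Q : Measure S) (X : S → Cov k) (W : S → Fin 2) (w : Fin 2) : Set (Cov k) :=
  ((givenW Q W w).map X).support

/-- `f w` is a version of the density of `X` conditional on `W = w`. -/
def IsDensity (Q : Measure S) (X : S → Cov k) (W : S → Fin 2) (f : Fin 2 → Cov k → ℝ) : Prop :=
  ∀ w, Measurable (f w) ∧ (∀ x, 0 ≤ f w x) ∧
    (givenW Q W w).map X = volume.withDensity (fun x => ENNReal.ofReal (f w x))

/-- The assumption on the distribution of the covariates. -/
structure CovariateCondition (Q : Measure S) (X : S → Cov k) (W : S → Fin 2) : Prop where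
  absolutelyContinuous : Q.map X ≪ volume
  support_subset : suppX Q X W 1 ⊆ suppX Q X W 0
  support_compact : ∀ w, IsCompact (suppX Q X W w)
  density : ∃ f : Fin 2 → Cov k → ℝ, IsDensity Q X W f ∧
    (∀ w, ∀ x ∈ interior (suppX Q X W w), DifferentiableAt ℝ (f w) x) ∧
    (∃ C : ℝ, ∀ w, ∀ x ∈ suppX Q X W 1, f w x ≤ C) ∧
    (∃ b : ℝ, 0 < b ∧ ∀ x ∈ suppX Q X W 1, b ≤ f 0 x)
  /-- A fixed fraction `φ` of every sufficiently small ball centred in `𝕏₁` lies in `𝕏₁`. -/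
  ball_fraction : ∃ φ : ℝ, 0 < φ ∧ ∃ ρ₀ : ℝ, 0 < ρ₀ ∧
    ∀ x ∈ suppX Q X W 1, ∀ ρ : ℝ, 0 < ρ → ρ ≤ ρ₀ →
      ENNReal.ofReal φ * volume (Metric.closedBall x ρ) ≤
        volume (Metric.closedBall x ρ ∩ suppX Q X W 1)

/-- The error `ε = Y - μ(X, W)`. -/
def errorTerm (Y : Fin 2 → S → ℝ) (X : S → Cov k) (W : S → Fin 2) (μ : Fin 2 → Cov k → ℝ)
    (s : S) : ℝ :=
  observed Y W s - μ (W s) (X s)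

/-- `μ w x` is a version of the conditional mean `E[Y | X = x, W = w]` of the observed outcome. -/
def IsCondMean (Q : Measure S) (Y : Fin 2 → S → ℝ) (X : S → Cov k) (W : S → Fin 2)
    (μ : Fin 2 → Cov k → ℝ) : Prop :=
  ∀ w, Integrable (observed Y W) (givenW Q W w) ∧
    (givenW Q W w)[observed Y W | sigmaX X] =ᵐ[givenW Q W w] fun s => μ w (X s)

/-- `v w x` is a version of the conditional variance `σ²(x, w)` of `Y` given `X = x, W = w`. -/
def IsCondVar (Q : Measure S) (Y : Fin 2 → S → ℝ) (X : S → Cov k) (W : S → Fin 2)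
    (v : Fin 2 → Cov k → ℝ) : Prop :=
  ∀ w, condVar (sigmaX X) (observed Y W) (givenW Q W w) =ᵐ[givenW Q W w] fun s => v w (X s)

/-- The assumption on the conditional distribution of the outcomes. -/
def OutcomeCondition (Q : Measure S) (Y : Fin 2 → S → ℝ) (X : S → Cov k) (W : S → Fin 2) :
    Prop :=
  ∃ μ v : Fin 2 → Cov k → ℝ, IsCondMean Q Y X W μ ∧ IsCondVar Q Y X W v ∧
    (∀ w, (∃ K, LipschitzOnWith K (μ w) (suppX Q X W 0)) ∧
      ∃ K, LipschitzOnWith K (v w) (suppX Q X W 0)) ∧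
    (∃ γ : ℝ, 0 < γ ∧ ∃ C : ℝ, ∀ w,
      Integrable (fun s => |errorTerm Y X W μ s| ^ (4 + γ)) (givenW Q W w) ∧
      ∀ᵐ s ∂(givenW Q W w),
        ((givenW Q W w)[fun s => |errorTerm Y X W μ s| ^ (4 + γ) | sigmaX X]) s ≤ C) ∧
    ∃ b : ℝ, 0 < b ∧ ∀ w, ∀ x ∈ suppX Q X W w, b ≤ v w x

/-- The sampling assumption for `n₁` treated observations `Z₁ i = (X_i, Y_i)` and `n₀` control
observations `Z₀ j = (X_j, Y_j)` on a probability space `(Ω, P)`: both are random samples from the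
respective conditional populations, and all observations are independent. -/
structure IsTwoSample {Ω : Type*} [MeasurableSpace Ω] (P : Measure Ω)
    (Q : Measure S) (Y : Fin 2 → S → ℝ) (X : S → Cov k) (W : S → Fin 2) {n₁ n₀ : ℕ}
    (Z₁ : Fin n₁ → Ω → Cov k × ℝ) (Z₀ : Fin n₀ → Ω → Cov k × ℝ) : Prop where
  indep : iIndepFun (Sum.elim Z₁ Z₀) P
  treated : ∀ i, IdentDistrib (Z₁ i) (fun s => (X s, observed Y W s)) P (givenW Q W 1)
  control : ∀ j, IdentDistrib (Z₀ j) (fun s => (X s, observed Y W s)) P (givenW Q W 0)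

end Population

/-! ### Nearest-neighbour matching -/

/-- The distance `d(a,b) = [(a-b)' V (a-b)]^{1/2}`. -/
def matchDist {k : ℕ} (V : Matrix (Fin k) (Fin k) ℝ) (a b : Cov k) : ℝ :=
  Real.sqrt (dotProduct (a - b).ofLp (V.mulVec (a - b).ofLp))

/-- The indices of the `M` nearest neighbours of `x` among the points `x₀ j`. Ties in the distance
(which have probability zero under a density) are broken by the index, so that the set has exactly
`M` elements whenever `M ≤ n₀`. -/
def neighbors {k n₀ : ℕ} (V : Matrix (Fin k) (Fin k) ℝ) (M : ℕ) (x₀ : Fin n₀ → Cov k)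
    (x : Cov k) : Finset (Fin n₀) :=
  {j | Finset.card {l : Fin n₀ | matchDist V (x₀ l) x < matchDist V (x₀ j) x ∨
      (matchDist V (x₀ l) x = matchDist V (x₀ j) x ∧ l < j)} < M}

/-- The vector `S = (τ̂_1, …, τ̂_{n₁})` with `τ̂_i = (Y_i - M⁻¹ ∑_{j ∈ J_M(i)} Y_j) - c`, as a
function of the treated data `z₁` and the control data `z₀`. -/
def effects {k n₁ n₀ : ℕ} (V : Matrix (Fin k) (Fin k) ℝ) (M : ℕ) (c : ℝ)
    (z₁ : Fin n₁ → Cov k × ℝ) (z₀ : Fin n₀ → Cov k × ℝ) (i : Fin n₁) : ℝ :=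
  ((z₁ i).2 - (1 / (M : ℝ)) * ∑ j ∈ neighbors V M (fun j => (z₀ j).1) (z₁ i).1, (z₀ j).2) - c

/-! ### The sign-changes test -/

/-- The sample mean. -/
def mean {n : ℕ} (v : Fin n → ℝ) : ℝ := (1 / (n : ℝ)) * ∑ i, v i

/-- The sample standard deviation. -/
def sampleSD {n : ℕ} (v : Fin n → ℝ) : ℝ :=
  Real.sqrt ((1 / ((n : ℝ) - 1)) * ∑ i, (v i - mean v) ^ 2)

/-- The test statistic `T`. -/
def testStat {n : ℕ} (v : Fin n → ℝ) : ℝ := |mean v| / sampleSD v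

/-- The signed studentized statistic `√n · T̂`. -/
def studentized {n : ℕ} (v : Fin n → ℝ) : ℝ := Real.sqrt n * (mean v / sampleSD v)

/-- The group `𝐆 = {-1, 1}ⁿ` of sign changes. -/
abbrev Signs (n : ℕ) : Type := Fin n → ℤˣ

/-- The action of the sign changes, `g v = (g_1 v_1, …, g_n v_n)`. -/
def signChange {n : ℕ} (g : Signs n) (v : Fin n → ℝ) (i : Fin n) : ℝ := ((g i : ℤ) : ℝ) * v i

/-- `T^{(1)}(v) ≤ … ≤ T^{(K)}(v)`, the ordered values of `T(gv)`, `g ∈ 𝐆`, with multiplicity. -/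
def orderedStats {n : ℕ} (v : Fin n → ℝ) : List ℝ :=
  (Multiset.map (fun g : Signs n => testStat (signChange g v)) Finset.univ.val).sort (· ≤ ·)

/-- The critical value `T^{(m)}(v)` with `m = ⌈K (1 - α)⌉` and `K = |𝐆|`. (The list is indexed
from `0`; the default value `0` is never used for `0 < α < 1`.) -/
def criticalValue {n : ℕ} (α : ℝ) (v : Fin n → ℝ) : ℝ :=
  (orderedStats v).getD (⌈(Fintype.card (Signs n) : ℝ) * (1 - α)⌉₊ - 1) 0

/-- The sign-changes test of level `α`: `1` (reject) if `T(v) > T^{(m)}(v)`, and `0` otherwise. -/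
def signTest {n : ℕ} (α : ℝ) (v : Fin n → ℝ) : ℝ :=
  if criticalValue α v < testStat v then 1 else 0

/-- The sign-change randomization distribution function of the studentized statistic: the
proportion of `g ∈ 𝐆` whose studentized statistic at `gv` is at most `t`. -/
def randomizationCDF {n : ℕ} (v : Fin n → ℝ) (t : ℝ) : ℝ :=
  (Finset.card {g : Signs n | studentized (signChange g v) ≤ t} : ℝ) / Fintype.card (Signs n)

/-- The sampling distribution function of the studentized statistic of a random vector `v`. -/
def samplingCDF {Ω : Type*} [MeasurableSpace Ω] (P : Measure Ω) {n : ℕ} (v : Ω → Fin n → ℝ)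
    (t : ℝ) : ℝ :=
  P.real {ω | studentized (v ω) ≤ t}

/-- The standard normal distribution function. -/
def stdNormalCDF (t : ℝ) : ℝ := cdf (gaussianReal 0 1) t

end

end NNMatching

/-!
Conditionally on the covariates, the matched differences `τ̂_i` are sums of independent errors,
and with high probability they are sums over disjoint blocks. Put `ρ = N₁ ^ (-β)` with
`max (k / 2) 2 < β k < r`. A ball of radius `ρ` around a treated covariate has control mass of
order at least `ρ ^ k` and `N₀ ρ ^ k → ∞` at a polynomial rate, so by a Chernoff bound every
treated unit has `M` controls within `ρ`; since `N₁ ^ 2 ρ ^ k → 0`, the treated covariates are so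
far apart that no control is matched twice (`GoodConfig`, `measureReal_not_goodConfig_le`). The
Lipschitz condition makes the matching bias `O(ρ) = o(N₁ ^ (-1/2))`. On this event the blocks have
independent errors with bounded fourth moments (`CenteredErrors`), so the conditional
characteristic function of `N₁ ^ (-1/2) ∑ τ̂_i` is close to a product over the treated units of a
function of their own covariates; integrating over these i.i.d. covariates gives the limit
`exp (-s² t² / 2)`, where `s²` is `limitVar` (`MatchingModel.tendsto_charFun`). The null
hypothesis centres the sum. In the same way `N₁⁻¹ ∑ τ̂_i ^ 2 → s²` and `N₁⁻² ∑ τ̂_i ^ 4 → 0` in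
probability (`MatchingModel.tendsto_average_sq`, `MatchingModel.tendsto_four`).

These three limits suffice. The first two and Slutsky's lemma give the normal limit of the
studentized statistic, uniformly by Pólya's theorem (`tendsto_iSup_samplingCDF`). For the
randomization distribution no symmetry is needed: with the data fixed, the sign-changed sum is a
Rademacher sum, which is close to normal as soon as `∑ τ̂_i ^ 4` is small compared with
`(∑ τ̂_i ^ 2) ^ 2` (`exists_iSup_randomizationCDF_lt`). A rejection means that the observed
statistic exceeds at least a fraction `1 - α` of those under sign changes; by the normal
approximation of the randomization distribution `|R(S)|` then exceeds a number close to the normal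
quantile at `1 - α / 2`, an event whose probability has a limit close to `α`
(`limsup_signTest_le`).

To work with fixed probability spaces, the conditional laws of the outcomes given the covariates
are written as images of the uniform law on the unit interval, so that a sample is a function of
independent covariates and independent uniform variables (`MatchingModel`,
`Describes.map_effects`). Conditional independence of `Y(0)` and `W` identifies the conditional
law of `Y(0)` among the treated with that of the controls
(`map_givenW_eq_compProd_of_condIndepFun`), so that the null hypothesis becomes a statement about
the two regression functions (`MatchingModel.integral_gap_eq_zero`).
-/

namespace NNMatching

/-! ### The standard normal distribution function and convergence of distribution functions -/

lemma stdNormalCDF_eq (t : ℝ) : stdNormalCDF t = (gaussianReal 0 1).real (Set.Iic t) :=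
  cdf_eq_real _ _

lemma stdNormalCDF_mono : Monotone stdNormalCDF := fun _ _ h => monotone_cdf _ h

lemma stdNormalCDF_nonneg (t : ℝ) : 0 ≤ stdNormalCDF t := cdf_nonneg _ _

lemma stdNormalCDF_le_one (t : ℝ) : stdNormalCDF t ≤ 1 := cdf_le_one _ _

lemma continuous_stdNormalCDF : Continuous stdNormalCDF := by
  have : NullSingletonClass (gaussianReal 0 1) := nullSingletonClass_gaussianReal (by simp)
  rw [continuous_iff_continuousAt]
  intro a
  have hr : ContinuousWithinAt stdNormalCDF (Set.Ici a) a :=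
    (cdf (gaussianReal 0 1)).right_continuous a
  have hl : ContinuousWithinAt stdNormalCDF (Set.Iio a) a := by
    have h0 : (cdf (gaussianReal 0 1)).measure {a} = 0 := by
      rw [measure_cdf]; exact measure_singleton a
    rw [StieltjesFunction.measure_singleton, ENNReal.ofReal_eq_zero, sub_nonpos] at h0
    have h1 : Function.leftLim (cdf (gaussianReal 0 1)) a = cdf (gaussianReal 0 1) a :=
      le_antisymm ((cdf (gaussianReal 0 1)).mono.leftLim_le le_rfl) h0
    have := (cdf (gaussianReal 0 1)).mono.tendsto_leftLim a
    rw [h1] at this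
    exact this
  exact continuousAt_iff_continuous_left_right.2 ⟨continuousWithinAt_Iio_iff_Iic.1 hl, hr⟩

lemma stdNormalCDF_neg (t : ℝ) : stdNormalCDF (-t) = 1 - stdNormalCDF t := by
  have : NullSingletonClass (gaussianReal 0 1) := nullSingletonClass_gaussianReal (by simp)
  have h := gaussianReal_map_neg (μ := 0) (v := 1)
  rw [neg_zero] at h
  rw [stdNormalCDF_eq, stdNormalCDF_eq, ← h, map_measureReal_apply (by fun_prop) measurableSet_Iic,
    map_measureReal_apply (by fun_prop) measurableSet_Iic]
  have h1 : (fun x : ℝ => -x) ⁻¹' Set.Iic (-t) = Set.Ici t := by ext; simp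
  have h2 : (fun x : ℝ => -x) ⁻¹' Set.Iic t = Set.Ici (-t) := by
    ext; simp
  rw [h1, h2]
  have h3 : (gaussianReal 0 1).real (Set.Ici (-t)) = (gaussianReal 0 1).real (Set.Iic t) := by
    conv_lhs => rw [← h]
    rw [map_measureReal_apply (by fun_prop) measurableSet_Ici]
    congr 1; ext; simp
  have h4 : (gaussianReal 0 1).real (Set.Ici t) = (gaussianReal 0 1).real (Set.Ioi t) := by
    rw [measureReal_def, measureReal_def, measure_congr Ioi_ae_eq_Ici]
  rw [h3, h4, ← Set.compl_Iic, probReal_compl_eq_one_sub measurableSet_Iic]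

lemma exists_stdNormalCDF_eq {y : ℝ} (h0 : 0 < y) (h1 : y < 1) : ∃ t, stdNormalCDF t = y := by
  have ha : ∃ a, stdNormalCDF a ≤ y :=
    ((tendsto_cdf_atBot (gaussianReal 0 1)).eventually (eventually_le_nhds h0)).exists
  have hb : ∃ b, y ≤ stdNormalCDF b :=
    ((tendsto_cdf_atTop (gaussianReal 0 1)).eventually (eventually_ge_nhds h1)).exists
  exact mem_range_of_exists_le_of_exists_ge continuous_stdNormalCDF ha hb

lemma abs_sub_stdNormalCDF_le_one {x : ℝ} (h0 : 0 ≤ x) (h1 : x ≤ 1) (t : ℝ) :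
    |x - stdNormalCDF t| ≤ 1 := by
  have := stdNormalCDF_nonneg t
  have := stdNormalCDF_le_one t
  rw [abs_le]; constructor <;> linarith

/-- Pólya's theorem for the normal limit: distribution functions that converge pointwise to the
continuous function `stdNormalCDF` converge uniformly. The points `u i` with
`stdNormalCDF (u i) = i / K` control all others by monotonicity. -/
lemma tendsto_iSup_abs_sub_stdNormalCDF {F : ℕ → ℝ → ℝ} (hmono : ∀ l, Monotone (F l))
    (h0 : ∀ l t, 0 ≤ F l t) (h1 : ∀ l t, F l t ≤ 1)
    (hF : ∀ t, Tendsto (fun l => F l t) atTop (𝓝 (stdNormalCDF t))) :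
    Tendsto (fun l => ⨆ t : ℝ, |F l t - stdNormalCDF t|) atTop (𝓝 0) := by
  rw [Metric.tendsto_atTop']
  intro ε hε
  obtain ⟨K, hK⟩ := exists_nat_gt (2 / (ε / 4))
  have hK0 : (0 : ℝ) < K := lt_trans (by positivity) hK
  have hKε : 2 / (K : ℝ) < ε / 4 := by
    rw [div_lt_iff₀ (by positivity)] at hK
    rw [div_lt_iff₀ hK0]; linarith
  have hu : ∀ i : ℕ, ∃ u : ℝ, 0 < i → i < K → stdNormalCDF u = i / K := by
    intro i
    by_cases h : 0 < i ∧ i < K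
    · have hi : (0 : ℝ) < i := by exact_mod_cast h.1
      have hi' : (i : ℝ) < K := by exact_mod_cast h.2
      obtain ⟨u, hu⟩ := exists_stdNormalCDF_eq (y := i / K) (by positivity)
        (by rw [div_lt_one hK0]; exact hi')
      exact ⟨u, fun _ _ => hu⟩
    · exact ⟨0, fun a b => absurd ⟨a, b⟩ h⟩
  choose u hu using hu
  have hev : ∀ᶠ l in atTop, ∀ i ∈ Finset.range K, |F l (u i) - stdNormalCDF (u i)| < ε / 4 := by
    rw [Filter.eventually_all_finset]
    intro i _
    have := Metric.tendsto_nhds.1 (hF (u i)) (ε / 4) (by positivity)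
    simpa [Real.dist_eq] using this
  obtain ⟨L, hL⟩ := eventually_atTop.1 hev
  refine ⟨L, fun l hl => ?_⟩
  have hb : ∀ t, |F l t - stdNormalCDF t| ≤ ε / 2 := by
    intro t
    -- `t` lies between the quantiles at `i / K` and `(i + 1) / K`.
    set i := ⌊stdNormalCDF t * K⌋₊ with hi
    have hpos : 0 ≤ stdNormalCDF t * K := mul_nonneg (stdNormalCDF_nonneg t) hK0.le
    have hi1 : (i : ℝ) ≤ stdNormalCDF t * K := Nat.floor_le hpos
    have hi2 : stdNormalCDF t * K < i + 1 := Nat.lt_floor_add_one _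
    have e2 : 2 / (K : ℝ) * K = 2 := by field_simp
    rw [abs_le]
    constructor
    · by_cases h : 1 < i
      · have hiK : i - 1 < K := by
          have : (i : ℝ) ≤ K := hi1.trans (by nlinarith [stdNormalCDF_le_one t])
          have : i ≤ K := by exact_mod_cast this
          omega
        have h2 := hu (i - 1) (by omega) hiK
        rw [Nat.cast_sub (by omega), Nat.cast_one] at h2
        have hlt : u (i - 1) < t := by
          by_contra hc
          have h3 := stdNormalCDF_mono (not_lt.1 hc)
          rw [h2, le_div_iff₀ hK0] at h3
          linarith
        have h4 := hL l (le_of_lt hl) (i - 1) (Finset.mem_range.2 hiK)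
        rw [abs_lt, h2] at h4
        have h5 := hmono l hlt.le
        have h6 : stdNormalCDF t - 2 / K ≤ (i - 1) / K := by
          rw [le_div_iff₀ hK0, sub_mul, e2]; linarith
        linarith [h4.1]
      · have hi3 : (i : ℝ) ≤ 1 := by exact_mod_cast not_lt.1 h
        have : stdNormalCDF t ≤ 2 / K := by rw [le_div_iff₀ hK0]; linarith
        linarith [h0 l t]
    · by_cases h : i + 1 < K
      · have h2 := hu (i + 1) (by omega) h
        push_cast at h2
        have hlt : t < u (i + 1) := by
          by_contra hc
          have h3 := stdNormalCDF_mono (not_lt.1 hc)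
          rw [h2, div_le_iff₀ hK0] at h3
          linarith
        have h4 := hL l (le_of_lt hl) (i + 1) (Finset.mem_range.2 h)
        rw [abs_lt, h2] at h4
        have h5 := hmono l hlt.le
        have h6 : (i + 1) / K ≤ stdNormalCDF t + 2 / K := by
          rw [div_le_iff₀ hK0, add_mul, e2]; linarith
        linarith [h4.2]
      · have hi3 : (K : ℝ) ≤ i + 1 := by exact_mod_cast not_lt.1 h
        have : 1 ≤ stdNormalCDF t + 2 / K := by
          have : 1 * (K : ℝ) ≤ (stdNormalCDF t + 2 / K) * K := by
            rw [add_mul, e2]; linarith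
          exact le_of_mul_le_mul_right this hK0
        linarith [h1 l t]
  have hs : ⨆ t : ℝ, |F l t - stdNormalCDF t| ≤ ε / 2 := ciSup_le hb
  have hs0 : 0 ≤ ⨆ t : ℝ, |F l t - stdNormalCDF t| := Real.iSup_nonneg fun t => abs_nonneg _
  rw [Real.dist_eq, sub_zero, abs_of_nonneg hs0]
  linarith

lemma bddAbove_abs_sub_stdNormalCDF {F : ℝ → ℝ} (h0 : ∀ t, 0 ≤ F t) (h1 : ∀ t, F t ≤ 1) :
    BddAbove (Set.range fun t => |F t - stdNormalCDF t|) :=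
  ⟨1, by rintro _ ⟨t, rfl⟩; exact abs_sub_stdNormalCDF_le_one (h0 t) (h1 t) t⟩

section Slutsky

variable {α : ℕ → Type*} [∀ l, MeasurableSpace (α l)] {ν : ∀ l, Measure (α l)}
  [∀ l, IsProbabilityMeasure (ν l)]

/-- Lévy's theorem, for a standard normal limit and on varying probability spaces. -/
lemma tendsto_cdf_of_tendsto_charFun {A : ∀ l, α l → ℝ} (hA : ∀ l, Measurable (A l))
    (hchar : ∀ t : ℝ, Tendsto (fun l => ∫ ω, Complex.exp (t * A l ω * Complex.I) ∂(ν l)) atTop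
      (𝓝 (Complex.exp (-(t : ℂ) ^ 2 / 2)))) (t : ℝ) :
    Tendsto (fun l => (ν l).real {ω | A l ω ≤ t}) atTop (𝓝 (stdNormalCDF t)) := by
  have : NullSingletonClass (gaussianReal 0 1) := nullSingletonClass_gaussianReal (by simp)
  let μ : ℕ → ProbabilityMeasure ℝ := fun l =>
    ⟨(ν l).map (A l), Measure.isProbabilityMeasure_map (hA l).aemeasurable⟩
  let μ₀ : ProbabilityMeasure ℝ := ⟨gaussianReal 0 1, inferInstance⟩
  have hμ : Tendsto μ atTop (𝓝 μ₀) := by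
    refine ProbabilityMeasure.tendsto_of_tendsto_charFun fun t => ?_
    have h2 : charFun (μ₀ : Measure ℝ) t = Complex.exp (-(t : ℂ) ^ 2 / 2) := by
      change charFun (gaussianReal 0 1) t = _
      rw [charFun_gaussianReal]; simp [neg_div]
    rw [h2]
    refine (hchar t).congr fun l => ?_
    change _ = charFun ((ν l).map (A l)) t
    rw [charFun_apply_real, integral_map (hA l).aemeasurable]
    exact (by fun_prop :
      Measurable fun x : ℝ => Complex.exp (t * x * Complex.I)).aestronglyMeasurable
  have h3 := ProbabilityMeasure.tendsto_measure_of_null_frontier_of_tendsto' hμ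
    (E := Set.Iic t) (by rw [frontier_Iic]; exact measure_singleton (μ := gaussianReal 0 1) t)
  have h4 := (ENNReal.tendsto_toReal (measure_ne_top (μ₀ : Measure ℝ) _)).comp h3
  rw [stdNormalCDF_eq]
  refine h4.congr fun l => ?_
  change ((ν l).map (A l) (Set.Iic t)).toReal = _
  rw [Measure.map_apply (hA l) measurableSet_Iic]
  rfl

lemma norm_exp_mul_I_sub_le (a b : ℝ) :
    ‖Complex.exp (a * Complex.I) - Complex.exp (b * Complex.I)‖ ≤ |a - b| := by
  have h : Complex.exp (a * Complex.I) - Complex.exp (b * Complex.I)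
      = Complex.exp (b * Complex.I) * (Complex.exp (Complex.I * ((a - b : ℝ) : ℂ)) - 1) := by
    rw [mul_sub, ← Complex.exp_add, mul_one]; congr 2; push_cast; ring
  rw [h, norm_mul, Complex.norm_exp_ofReal_mul_I, one_mul]
  exact Real.norm_exp_I_mul_ofReal_sub_one_le

/-- Perturbing a sequence of random variables by a term that vanishes in probability does not
change its limiting characteristic function. -/
lemma tendsto_charFun_of_tendsto_measure {A R : ∀ l, α l → ℝ} (hA : ∀ l, Measurable (A l))
    (hR : ∀ l, Measurable (R l)) {t : ℝ} {z : ℂ}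
    (hchar : Tendsto (fun l => ∫ ω, Complex.exp (t * A l ω * Complex.I) ∂(ν l)) atTop (𝓝 z))
    (hAR : ∀ ε : ℝ, 0 < ε → Tendsto (fun l => (ν l).real {ω | ε ≤ |R l ω - A l ω|}) atTop (𝓝 0)) :
    Tendsto (fun l => ∫ ω, Complex.exp (t * R l ω * Complex.I) ∂(ν l)) atTop (𝓝 z) := by
  have hint : ∀ (l : ℕ) (B : α l → ℝ), Measurable B →
      Integrable (fun ω => Complex.exp (t * B ω * Complex.I)) (ν l) := by
    intro l B hB
    refine Integrable.of_bound (C := 1) (by fun_prop) (Eventually.of_forall fun ω => ?_)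
    rw [← Complex.ofReal_mul, Complex.norm_exp_ofReal_mul_I]
  have hbound : ∀ (ε : ℝ), 0 < ε → ∀ l, ‖(∫ ω, Complex.exp (t * R l ω * Complex.I) ∂(ν l)) -
      ∫ ω, Complex.exp (t * A l ω * Complex.I) ∂(ν l)‖ ≤
      |t| * ε + 2 * (ν l).real {ω | ε ≤ |R l ω - A l ω|} := by
    intro ε hε l
    have hms : MeasurableSet {ω | ε ≤ |R l ω - A l ω|} :=
      measurableSet_le measurable_const (by
        have := hR l; have := hA l; fun_prop)
    rw [← integral_sub (hint l _ (hR l)) (hint l _ (hA l))]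
    calc _ ≤ ∫ ω, (|t| * ε
        + Set.indicator {ω | ε ≤ |R l ω - A l ω|} (fun _ => (2 : ℝ)) ω) ∂(ν l) := by
            refine norm_integral_le_of_norm_le ?_ (Eventually.of_forall fun ω => ?_)
            · exact (integrable_const _).add ((integrable_const _).indicator hms)
            · by_cases h : ε ≤ |R l ω - A l ω|
              · rw [Set.indicator_of_mem (by exact h)]
                have h1 := norm_sub_le (Complex.exp (t * R l ω * Complex.I))
                  (Complex.exp (t * A l ω * Complex.I))
                rw [← Complex.ofReal_mul, ← Complex.ofReal_mul, Complex.norm_exp_ofReal_mul_I,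
                  Complex.norm_exp_ofReal_mul_I] at h1
                rw [← Complex.ofReal_mul, ← Complex.ofReal_mul]
                have : 0 ≤ |t| * ε := by positivity
                linarith
              · rw [Set.indicator_of_notMem (by exact h), add_zero,
                  ← Complex.ofReal_mul, ← Complex.ofReal_mul]
                refine (norm_exp_mul_I_sub_le _ _).trans ?_
                rw [← mul_sub, abs_mul]
                exact mul_le_mul_of_nonneg_left (not_le.1 h).le (abs_nonneg t)
      _ = _ := by
            rw [integral_add (integrable_const _) ((integrable_const _).indicator hms),
              integral_indicator_const _ hms]
            simp [mul_comm]
  have hd : Tendsto (fun l => (∫ ω, Complex.exp (t * R l ω * Complex.I) ∂(ν l)) -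
      ∫ ω, Complex.exp (t * A l ω * Complex.I) ∂(ν l)) atTop (𝓝 0) := by
    rw [tendsto_zero_iff_norm_tendsto_zero, Metric.tendsto_atTop']
    intro δ hδ
    have hε : 0 < δ / (2 * (|t| + 1)) := by positivity
    obtain ⟨L, hL⟩ := Metric.tendsto_atTop'.1 (hAR _ hε) (δ / 4) (by positivity)
    refine ⟨L, fun l hl => ?_⟩
    have h1 := hL l hl
    rw [Real.dist_eq, sub_zero] at h1 ⊢
    rw [abs_of_nonneg measureReal_nonneg] at h1
    rw [abs_of_nonneg (norm_nonneg _)]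
    have h2 := hbound _ hε l
    have h3 : |t| * (δ / (2 * (|t| + 1))) < δ / 2 := by
      rw [mul_div_assoc', div_lt_div_iff₀ (by positivity) (by positivity)]
      nlinarith [abs_nonneg t]
    linarith
  have := hd.add hchar
  simpa using this

/-- A sequence with a standard normal limit is bounded in probability. -/
lemma exists_tight_of_tendsto_charFun {A : ∀ l, α l → ℝ} (hA : ∀ l, Measurable (A l))
    (hchar : ∀ t : ℝ, Tendsto (fun l => ∫ ω, Complex.exp (t * A l ω * Complex.I) ∂(ν l)) atTop
      (𝓝 (Complex.exp (-(t : ℂ) ^ 2 / 2)))) {ε : ℝ} (hε : 0 < ε) :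
    ∃ K : ℝ, 0 < K ∧ ∀ᶠ l in atTop, (ν l).real {ω | K < |A l ω|} < ε := by
  obtain ⟨K, hK, hK0⟩ := (((tendsto_cdf_atTop (gaussianReal 0 1)).eventually
    (eventually_gt_nhds (show 1 - ε / 4 < 1 by linarith))).and (eventually_gt_atTop 0)).exists
  change 1 - ε / 4 < stdNormalCDF K at hK
  refine ⟨K, hK0, ?_⟩
  have h1 := tendsto_cdf_of_tendsto_charFun hA hchar K
  have h2 := tendsto_cdf_of_tendsto_charFun hA hchar (-K)
  rw [stdNormalCDF_neg] at h2
  filter_upwards [h1.eventually (eventually_gt_nhds (show 1 - ε / 4 < _ from hK)),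
    h2.eventually (eventually_lt_nhds (show 1 - stdNormalCDF K < ε / 4 by linarith))] with l hl1 hl2
  have hm : MeasurableSet {ω | A l ω ≤ K} := measurableSet_le (hA l) measurable_const
  have hsub : {ω | K < |A l ω|} ⊆ {ω | A l ω ≤ -K} ∪ {ω | A l ω ≤ K}ᶜ := by
    intro ω hω
    simp only [Set.mem_ofPred_eq, Set.mem_union, Set.mem_compl_iff, not_le] at *
    rcases lt_abs.1 hω with h | h
    · exact Or.inr h
    · left; linarith
  calc _ ≤ _ := measureReal_mono hsub
    _ ≤ _ := measureReal_union_le _ _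
    _ < ε := by rw [probReal_compl_eq_one_sub hm]; linarith

end Slutsky

/-! ### Self-normalized sums -/

lemma measurable_mean {n : ℕ} : Measurable (mean : (Fin n → ℝ) → ℝ) := by
  unfold mean; fun_prop

lemma measurable_sampleSD {n : ℕ} : Measurable (sampleSD : (Fin n → ℝ) → ℝ) := by
  have := measurable_mean (n := n)
  unfold sampleSD
  fun_prop

lemma measurable_studentized {n : ℕ} : Measurable (studentized : (Fin n → ℝ) → ℝ) := by
  have := measurable_mean (n := n)
  have := measurable_sampleSD (n := n)
  unfold studentized
  fun_prop

lemma sum_sub_mean_sq {n : ℕ} (hn : 0 < n) (v : Fin n → ℝ) :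
    ∑ i, (v i - mean v) ^ 2 = ∑ i, v i ^ 2 - ((√n)⁻¹ * ∑ i, v i) ^ 2 := by
  have hn' : (n : ℝ) ≠ 0 := by positivity
  have h1 : ∑ i, (v i - mean v) ^ 2
      = ∑ i, v i ^ 2 - 2 * mean v * ∑ i, v i + n * mean v ^ 2 := by
    simp_rw [sub_sq, Finset.sum_add_distrib, Finset.sum_sub_distrib, Finset.mul_sum]
    simp only [Finset.sum_const, Finset.card_univ, Fintype.card_fin, nsmul_eq_mul]
    congr 2
    exact Finset.sum_congr rfl fun i _ => by ring
  rw [h1, mul_pow, inv_pow, Real.sq_sqrt (by positivity), mean]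
  field_simp
  ring

lemma studentized_eq {n : ℕ} (hn : 0 < n) (v : Fin n → ℝ) :
    studentized v = ((√n)⁻¹ * ∑ i, v i) / sampleSD v := by
  have hn' : (0 : ℝ) < n := by positivity
  have hs : √(n : ℝ) ≠ 0 := by positivity
  have h2 : √(n : ℝ) * (1 / n) = (√n)⁻¹ := by
    field_simp
    rw [Real.sq_sqrt hn'.le]
  rw [studentized, mean, ← mul_div_assoc, ← mul_assoc, h2]

lemma mean_const_mul {n : ℕ} (a : ℝ) (v : Fin n → ℝ) : mean (fun i => a * v i) = a * mean v := by
  rw [mean, mean, ← Finset.mul_sum]; ring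

lemma sampleSD_const_mul {n : ℕ} {a : ℝ} (ha : 0 < a) (v : Fin n → ℝ) :
    sampleSD (fun i => a * v i) = a * sampleSD v := by
  have : ∑ i, (a * v i - mean fun i => a * v i) ^ 2 = a ^ 2 * ∑ i, (v i - mean v) ^ 2 := by
    rw [mean_const_mul, Finset.mul_sum]
    exact Finset.sum_congr rfl fun i _ => by ring
  rw [sampleSD, sampleSD, this, mul_left_comm, Real.sqrt_mul (by positivity), Real.sqrt_sq ha.le]

lemma studentized_const_mul {n : ℕ} {a : ℝ} (ha : 0 < a) (v : Fin n → ℝ) :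
    studentized (fun i => a * v i) = studentized v := by
  rw [studentized, studentized, mean_const_mul, sampleSD_const_mul ha,
    mul_div_mul_left _ _ ha.ne']

/-- If the second sample moment is close to `1`, the studentized statistic is close to the
normalized sum. -/
lemma abs_studentized_sub_le {n : ℕ} (hn : 2 ≤ n) (v : Fin n → ℝ) {K η : ℝ}
    (hK : |(√n)⁻¹ * ∑ i, v i| ≤ K) (hη : |1 / (n : ℝ) * ∑ i, v i ^ 2 - 1| ≤ η)
    (hsmall : 2 * η + (1 + K ^ 2) / (n - 1) ≤ 1 / 2) :
    |studentized v - (√n)⁻¹ * ∑ i, v i| ≤ 2 * K * (2 * η + (1 + K ^ 2) / (n - 1)) := by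
  have hn2 : (2 : ℝ) ≤ n := by exact_mod_cast hn
  have hn1 : (0 : ℝ) < n - 1 := by linarith
  rw [studentized_eq (by omega)]
  set A := (√n)⁻¹ * ∑ i, v i with hA
  set q := 1 / (n : ℝ) * ∑ i, v i ^ 2 with hq
  have hsum : ∑ i, v i ^ 2 = n * q := by rw [hq]; field_simp
  have hsd : sampleSD v = √((n * q - A ^ 2) / (n - 1)) := by
    rw [sampleSD, sum_sub_mean_sq (by omega), hsum, ← hA]
    congr 1; ring
  rw [hsd]
  set y := (n * q - A ^ 2) / ((n : ℝ) - 1) with hy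
  have hA2 : A ^ 2 ≤ K ^ 2 := sq_le_sq' (by linarith [(abs_le.1 hK).1]) (abs_le.1 hK).2
  have hy1 : |y - 1| ≤ 2 * η + (1 + K ^ 2) / (n - 1) := by
    have e : y - 1 = n / (n - 1) * (q - 1) + (1 - A ^ 2) / (n - 1) := by
      rw [hy]; field_simp; ring
    rw [e]
    refine (abs_add_le _ _).trans (add_le_add ?_ ?_)
    · rw [abs_mul, abs_of_nonneg (by positivity)]
      refine mul_le_mul ?_ hη (abs_nonneg _) (by norm_num)
      rw [div_le_iff₀ hn1]; linarith
    · rw [abs_div, abs_of_pos hn1]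
      gcongr
      rw [abs_le]; constructor <;> nlinarith [sq_nonneg A]
  have hy2 : 1 / 4 ≤ y := by have := (abs_le.1 (hy1.trans hsmall)).1; linarith
  have hs2 : 1 / 2 ≤ √y := Real.le_sqrt_of_sq_le (by linarith)
  have hs0 : 0 < √y := by linarith
  have hinv : |1 / √y - 1| ≤ 2 * |y - 1| := by
    have e : 1 / √y - 1 = -(y - 1) * (1 / (√y * (1 + √y))) := by
      have := Real.sq_sqrt (show 0 ≤ y by linarith)
      field_simp
      nlinarith
    rw [e, abs_mul, abs_neg, mul_comm]
    refine mul_le_mul_of_nonneg_right ?_ (abs_nonneg _)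
    rw [abs_of_pos (by positivity), div_le_iff₀ (by positivity)]
    nlinarith
  have e : A / √y - A = A * (1 / √y - 1) := by ring
  rw [e, abs_mul]
  calc _ ≤ K * (2 * |y - 1|) := mul_le_mul hK hinv (abs_nonneg _) ((abs_nonneg _).trans hK)
    _ ≤ K * (2 * (2 * η + (1 + K ^ 2) / (n - 1))) := by
        have := (abs_nonneg _).trans hK
        gcongr
    _ = _ := by ring

/-- A self-normalized central limit theorem: if the normalized sums have a standard normal limit
and the second sample moments converge to `1` in probability, then the distribution functions of
the studentized statistics converge uniformly to the normal one. -/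
theorem tendsto_iSup_cdf_studentized {α : ℕ → Type*} [∀ l, MeasurableSpace (α l)]
    {ν : ∀ l, Measure (α l)} [∀ l, IsProbabilityMeasure (ν l)] {N : ℕ → ℕ}
    (hN : Tendsto N atTop atTop) {v : ∀ l, α l → Fin (N l) → ℝ} (hv : ∀ l, Measurable (v l))
    (hchar : ∀ t : ℝ, Tendsto (fun l => ∫ ω, Complex.exp
        (t * ((√(N l))⁻¹ * ∑ i, v l ω i : ℝ) * Complex.I) ∂(ν l)) atTop
      (𝓝 (Complex.exp (-(t : ℂ) ^ 2 / 2))))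
    (hsq : ∀ η : ℝ, 0 < η → Tendsto (fun l =>
        (ν l).real {ω | η ≤ |1 / (N l : ℝ) * ∑ i, v l ω i ^ 2 - 1|}) atTop (𝓝 0)) :
    Tendsto (fun l => ⨆ t : ℝ, |(ν l).real {ω | studentized (v l ω) ≤ t} - stdNormalCDF t|)
      atTop (𝓝 0) := by
  have hA : ∀ l, Measurable fun ω => (√(N l))⁻¹ * ∑ i, v l ω i := fun l => by
    have := hv l; fun_prop
  have hR : ∀ l, Measurable fun ω => studentized (v l ω) := fun l =>
    measurable_studentized.comp (hv l)
  have hdiff : ∀ ε : ℝ, 0 < ε → Tendsto (fun l => (ν l).real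
      {ω | ε ≤ |studentized (v l ω) - (√(N l))⁻¹ * ∑ i, v l ω i|}) atTop (𝓝 0) := by
    intro ε hε
    rw [Metric.tendsto_nhds]
    intro δ hδ
    obtain ⟨K, hK0, hK⟩ := exists_tight_of_tendsto_charFun hA hchar (half_pos hδ)
    obtain ⟨η, hη0, hη⟩ : ∃ η : ℝ, 0 < η ∧ 4 * η < min (1 / 2) (ε / (2 * K)) :=
      ⟨min (1 / 2) (ε / (2 * K)) / 8, by positivity, by
        have : 0 < min (1 / 2) (ε / (2 * K)) := by positivity
        linarith⟩
    have hlim : Tendsto (fun l => 2 * η + (1 + K ^ 2) / ((N l : ℝ) - 1)) atTop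
        (𝓝 (2 * η + 0)) := by
      refine tendsto_const_nhds.add (tendsto_const_nhds.div_atTop ?_)
      exact tendsto_atTop_add_const_right _ _ (tendsto_natCast_atTop_atTop.comp hN)
    have h3 := (hsq η hη0).eventually (eventually_lt_nhds (half_pos hδ))
    filter_upwards [hK, h3, hN.eventually_ge_atTop 2,
      hlim.eventually (eventually_lt_nhds (show 2 * η + 0 < min (1 / 2) (ε / (2 * K)) by linarith))]
      with l h1 h2 h4 h5
    rw [Real.dist_eq, sub_zero, abs_of_nonneg measureReal_nonneg]
    refine lt_of_le_of_lt ((measureReal_mono (fun ω hω => ?_)).trans (measureReal_union_le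
      {ω | K < |(√(N l))⁻¹ * ∑ i, v l ω i|} {ω | η ≤ |1 / (N l : ℝ) * ∑ i, v l ω i ^ 2 - 1|}))
      (show _ < δ by linarith)
    by_contra hc
    simp only [Set.mem_union, Set.mem_ofPred_eq, not_or, not_lt, not_le] at hc
    have h6 := abs_studentized_sub_le h4 (v l ω) hc.1 hc.2.le (h5.le.trans (min_le_left _ _))
    have h7 := h5.trans_le (min_le_right _ _)
    rw [lt_div_iff₀ (by positivity)] at h7
    have h8 : ε ≤ |studentized (v l ω) - (√(N l))⁻¹ * ∑ i, v l ω i| := hω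
    linarith
  have hcharR : ∀ t : ℝ, Tendsto (fun l => ∫ ω, Complex.exp
      (t * (studentized (v l ω) : ℝ) * Complex.I) ∂(ν l)) atTop
      (𝓝 (Complex.exp (-(t : ℂ) ^ 2 / 2))) := fun t =>
    tendsto_charFun_of_tendsto_measure hA hR (hchar t) hdiff
  refine tendsto_iSup_abs_sub_stdNormalCDF (F := fun l t =>
    (ν l).real {ω | studentized (v l ω) ≤ t}) ?_ (fun _ _ => measureReal_nonneg)
    (fun _ _ => measureReal_le_one) (tendsto_cdf_of_tendsto_charFun hR hcharR)
  intro l s t hst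
  exact measureReal_mono fun ω hω => le_trans (show studentized (v l ω) ≤ s from hω) hst


/-! ### The randomization distribution -/

lemma norm_prod_sub_prod_le {ι : Type*} (s : Finset ι) {a b : ι → ℂ}
    (ha : ∀ i ∈ s, ‖a i‖ ≤ 1) (hb : ∀ i ∈ s, ‖b i‖ ≤ 1) :
    ‖∏ i ∈ s, a i - ∏ i ∈ s, b i‖ ≤ ∑ i ∈ s, ‖a i - b i‖ := by
  classical
  induction s using Finset.induction_on with
  | empty => simp
  | insert j s hj ih =>
    rw [Finset.prod_insert hj, Finset.prod_insert hj, Finset.sum_insert hj]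
    have e : a j * ∏ i ∈ s, a i - b j * ∏ i ∈ s, b i
        = (a j - b j) * ∏ i ∈ s, a i + b j * (∏ i ∈ s, a i - ∏ i ∈ s, b i) := by ring
    rw [e]
    refine (norm_add_le _ _).trans (add_le_add ?_ ?_)
    · rw [norm_mul]
      refine mul_le_of_le_one_right (norm_nonneg _) ?_
      rw [norm_prod]
      exact Finset.prod_le_one (fun _ _ => norm_nonneg _)
        fun i hi => ha i (Finset.mem_insert_of_mem hi)
    · rw [norm_mul]
      refine (mul_le_of_le_one_left (norm_nonneg _) (hb j (Finset.mem_insert_self j s))).trans ?_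
      exact ih (fun i hi => ha i (Finset.mem_insert_of_mem hi))
        fun i hi => hb i (Finset.mem_insert_of_mem hi)

lemma abs_cos_sub_exp_le (x : ℝ) : |Real.cos x - Real.exp (-(x ^ 2 / 2))| ≤ 2 * x ^ 4 := by
  have he : Real.exp (-(x ^ 2 / 2)) ≤ 1 := Real.exp_le_one_iff.2 (by nlinarith [sq_nonneg x])
  have he0 := Real.exp_pos (-(x ^ 2 / 2))
  by_cases hx : |x| ≤ 1
  · have h1 := Real.cos_bound hx
    have hx2 : x ^ 2 ≤ 1 := by rw [← sq_abs]; exact pow_le_one₀ (abs_nonneg x) hx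
    have h2 := Real.abs_exp_sub_one_sub_id_le (x := -(x ^ 2 / 2))
      (by rw [abs_neg, abs_of_nonneg (by positivity)]; linarith)
    have e4 : |x| ^ 4 = x ^ 4 := by rw [show (4 : ℕ) = 2 * 2 from rfl, pow_mul, sq_abs, ← pow_mul]
    rw [e4] at h1
    have e : (-(x ^ 2 / 2)) ^ 2 = x ^ 4 / 4 := by ring
    rw [e] at h2
    have h3 : (0 : ℝ) ≤ x ^ 4 := by positivity
    rw [abs_le] at *
    constructor <;> linarith [h1.1, h1.2, h2.1, h2.2]
  · have h4 : 1 ≤ x ^ 4 := by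
      rw [show (4 : ℕ) = 2 * 2 from rfl, pow_mul, ← sq_abs x, ← pow_mul]
      exact one_le_pow₀ (not_le.1 hx).le
    have h5 := Real.cos_le_one x
    have h6 := Real.neg_one_le_cos x
    rw [abs_le]
    constructor <;> linarith

lemma signs_sq (e : ℤˣ) : (((e : ℤ) : ℝ)) ^ 2 = 1 := by
  rcases Int.units_eq_one_or e with rfl | rfl <;> simp

lemma sum_signChange_sq {n : ℕ} (g : Signs n) (v : Fin n → ℝ) :
    ∑ i, signChange g v i ^ 2 = ∑ i, v i ^ 2 := by
  refine Finset.sum_congr rfl fun i _ => ?_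
  rw [signChange, mul_pow, signs_sq, one_mul]

lemma card_signs (n : ℕ) : (Fintype.card (Signs n) : ℝ) = 2 ^ n := by
  rw [Fintype.card_fun, Fintype.card_units_int, Fintype.card_fin]; norm_num

/-- The characteristic function of a Rademacher sum. -/
lemma sum_signs_exp {n : ℕ} (x : Fin n → ℝ) :
    (∑ g : Signs n, Complex.exp ((∑ i, signChange g x i : ℝ) * Complex.I)) / 2 ^ n
      = ∏ i, (Real.cos (x i) : ℂ) := by
  have h1 : ∀ g : Signs n, Complex.exp ((∑ i, signChange g x i : ℝ) * Complex.I)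
      = ∏ i, Complex.exp ((((g i : ℤ) : ℝ) * x i : ℝ) * Complex.I) := by
    intro g
    rw [← Complex.exp_sum]
    congr 1
    push_cast [signChange]
    rw [Finset.sum_mul]
  simp_rw [h1]
  have h2 := Finset.prod_univ_sum (fun _ : Fin n => (Finset.univ : Finset ℤˣ))
    (fun i e => Complex.exp ((((e : ℤ) : ℝ) * x i : ℝ) * Complex.I))
  rw [Fintype.piFinset_univ] at h2
  rw [← h2, div_eq_iff (pow_ne_zero _ two_ne_zero)]
  have h3 : ∏ _i : Fin n, (2 : ℂ) = 2 ^ n := by simp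
  rw [← h3, ← Finset.prod_mul_distrib]
  refine Finset.prod_congr rfl fun i _ => ?_
  rw [show (Finset.univ : Finset ℤˣ) = {1, -1} from rfl, Finset.sum_pair (by decide),
    Complex.ofReal_cos, Complex.cos]
  push_cast
  ring_nf

/-- A conditional central limit theorem for Rademacher sums: the randomization distribution of
the studentized statistic is close to the normal one as soon as no single coordinate carries a
sizable share of the sum of squares. The bound does not depend on the dimension, which the
hypothesis forces to be large. -/
theorem exists_iSup_randomizationCDF_lt {δ : ℝ} (hδ : 0 < δ) :
    ∃ η : ℝ, 0 < η ∧ ∀ (n : ℕ) (v : Fin n → ℝ), 0 < ∑ i, v i ^ 2 →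
      ∑ i, v i ^ 4 ≤ η * (∑ i, v i ^ 2) ^ 2 →
      ⨆ t : ℝ, |randomizationCDF v t - stdNormalCDF t| < δ := by
  by_contra! hcon
  choose n v hpos hle hge using fun l : ℕ => hcon (1 / ((l : ℝ) + 1)) (by positivity)
  -- By Cauchy-Schwarz `(∑ v_i ^ 2) ^ 2 ≤ n ∑ v_i ^ 4`: a small fourth moment forces a large `n`.
  have hn : ∀ l : ℕ, (l : ℝ) + 1 ≤ n l := by
    intro l
    have h1 := sq_sum_le_card_mul_sum_sq (s := Finset.univ) (f := fun i => v l i ^ 2)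
    rw [Finset.card_univ, Fintype.card_fin] at h1
    simp_rw [← pow_mul] at h1
    norm_num at h1
    have h2 := h1.trans (mul_le_mul_of_nonneg_left (hle l) (Nat.cast_nonneg _))
    rw [one_div, inv_mul_eq_div, mul_div_assoc', le_div_iff₀ (by positivity), mul_comm] at h2
    exact le_of_mul_le_mul_right h2 (by have := hpos l; positivity)
  have hN : Tendsto n atTop atTop := by
    refine tendsto_atTop_mono (fun l => ?_) tendsto_id
    have := hn l
    have h3 : ((l : ℝ)) ≤ n l := by linarith
    exact_mod_cast h3
  have hn0 : ∀ l, (0 : ℝ) < n l := fun l => lt_of_lt_of_le (by positivity) (hn l)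
  let _ : ∀ l, MeasurableSpace (Signs (n l)) := fun l => ⊤
  have hms : ∀ l, MeasurableSingletonClass (Signs (n l)) := fun l => ⟨fun _ => trivial⟩
  let ν : ∀ l, Measure (Signs (n l)) := fun l => uniformOn Set.univ
  have hν : ∀ l, IsProbabilityMeasure (ν l) := fun l =>
    isProbabilityMeasure_uniformOn Set.finite_univ Set.univ_nonempty
  -- Rescaling to unit second moment leaves the studentized statistic unchanged, and sign changes
  -- preserve the second moment.
  set a : ℕ → ℝ := fun l => √(n l) / √(∑ i, v l i ^ 2) with ha
  have ha0 : ∀ l, 0 < a l := fun l => div_pos (Real.sqrt_pos.2 (hn0 l)) (Real.sqrt_pos.2 (hpos l))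
  have hmeas : ∀ l, Measurable fun (g : Signs (n l)) i => a l * signChange g (v l) i :=
    fun l => measurable_from_top
  have hreal : ∀ l (p : Signs (n l) → Prop) [DecidablePred p],
      (ν l).real {g | p g} = (Finset.card {g | p g} : ℝ) / Fintype.card (Signs (n l)) := by
    intro l p _
    rw [measureReal_def]
    change (uniformOn Set.univ {g | p g}).toReal = _
    rw [uniformOn_univ, ENNReal.toReal_div, Measure.count_apply (Set.toFinite _).measurableSet]
    have : ({g | p g} : Set (Signs (n l))) = ((Finset.univ.filter p : Finset _) : Set _) := by
      ext; simp
    rw [this, Set.encard_coe_eq_coe_finsetCard]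
    simp
  have hlim := tendsto_iSup_cdf_studentized (ν := ν) hN hmeas ?_ ?_
  · have hlt := hlim.eventually (eventually_lt_nhds hδ)
    obtain ⟨l, hl⟩ := hlt.exists
    refine absurd hl (not_lt.2 ((hge l).trans (le_of_eq ?_)))
    congr 1
    ext t
    congr 2
    rw [randomizationCDF]
    simp_rw [studentized_const_mul (ha0 l)]
    rw [hreal]
  · intro t
    have hint : ∀ l, ∫ g, Complex.exp
        (t * ((√(n l))⁻¹ * ∑ i, a l * signChange g (v l) i : ℝ) * Complex.I) ∂(ν l)
        = ∏ i, (Real.cos (t / √(∑ i, v l i ^ 2) * v l i) : ℂ) := by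
      intro l
      rw [← sum_signs_exp, integral_fintype (.of_finite)]
      have hsing : ∀ g : Signs (n l), (ν l).real {g} = 1 / 2 ^ n l := by
        intro g
        have := hreal l (fun g' => g' = g)
        rw [card_signs, Finset.filter_eq' , if_pos (Finset.mem_univ _), Finset.card_singleton,
          Nat.cast_one] at this
        exact this
      simp_rw [hsing]
      rw [Finset.sum_div]
      refine Finset.sum_congr rfl fun g _ => ?_
      rw [Complex.real_smul, mul_comm]
      push_cast
      rw [mul_one_div]
      congr 2
      rw [Finset.mul_sum, Finset.mul_sum, Finset.sum_mul]
      rw [Finset.sum_mul]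
      refine Finset.sum_congr rfl fun i _ => ?_
      have h1 : ((√(n l) : ℝ) : ℂ) ≠ 0 := by
        exact_mod_cast (Real.sqrt_pos.2 (hn0 l)).ne'
      simp only [ha, signChange]
      push_cast
      field_simp
    -- The squared coefficients sum to one, so that the normal factors multiply to the standard
    -- normal characteristic function.
    have hexp : ∀ l, ∏ i, ((Real.exp (-((t / √(∑ i, v l i ^ 2) * v l i) ^ 2 / 2)) : ℝ) : ℂ)
        = Complex.exp (-(t : ℂ) ^ 2 / 2) := by
      intro l
      have hS := hpos l
      set T := ∑ i, v l i ^ 2 with hT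
      have : ∑ i, -((t / √T * v l i) ^ 2 / 2) = -t ^ 2 / 2 := by
        simp_rw [mul_pow, div_pow, Real.sq_sqrt hS.le]
        rw [Finset.sum_neg_distrib, ← Finset.sum_div, ← Finset.mul_sum, ← hT]
        field_simp
      rw [← Complex.ofReal_prod, ← Real.exp_sum, this]
      push_cast
      rfl
    rw [tendsto_iff_norm_sub_tendsto_zero]
    have hb : ∀ l : ℕ, ‖(∫ g, Complex.exp
        (t * ((√(n l))⁻¹ * ∑ i, a l * signChange g (v l) i : ℝ) * Complex.I) ∂(ν l))
        - Complex.exp (-(t : ℂ) ^ 2 / 2)‖ ≤ 2 * t ^ 4 * (1 / ((l : ℝ) + 1)) := by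
      intro l
      rw [hint, ← hexp l]
      refine (norm_prod_sub_prod_le _ (fun i _ => ?_) fun i _ => ?_).trans ?_
      · rw [Complex.norm_real]; exact Real.abs_cos_le_one _
      · rw [Complex.norm_real, Real.norm_of_nonneg (Real.exp_pos _).le]
        exact Real.exp_le_one_iff.2 (by
          have := sq_nonneg (t / √(∑ i, v l i ^ 2) * v l i); linarith)
      have hS := hpos l
      have hl4 := hle l
      set T := ∑ i, v l i ^ 2 with hT
      calc _ ≤ ∑ i, 2 * (t / √T * v l i) ^ 4 := by
              refine Finset.sum_le_sum fun i _ => ?_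
              rw [← Complex.ofReal_sub, Complex.norm_real]
              exact abs_cos_sub_exp_le _
        _ = 2 * t ^ 4 * ((∑ i, v l i ^ 4) / T ^ 2) := by
              rw [← Finset.mul_sum]
              have : √T ^ 4 = T ^ 2 := by
                rw [show (4 : ℕ) = 2 * 2 from rfl, pow_mul, Real.sq_sqrt hS.le]
              simp_rw [mul_pow, div_pow, this]
              rw [← Finset.mul_sum]; ring
        _ ≤ _ := by
              refine mul_le_mul_of_nonneg_left ?_ (by positivity)
              rw [div_le_iff₀ (by positivity)]; exact hl4
    refine squeeze_zero (fun _ => norm_nonneg _) hb ?_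
    have := (tendsto_one_div_add_atTop_nhds_zero_nat (𝕜 := ℝ)).const_mul (2 * t ^ 4)
    simpa using this
  · intro η hη
    have h0 : ∀ l (g : Signs (n l)),
        1 / (n l : ℝ) * ∑ i, (a l * signChange g (v l) i) ^ 2 - 1 = 0 := by
      intro l g
      simp_rw [mul_pow]
      rw [← Finset.mul_sum, sum_signChange_sq, ha, div_pow, Real.sq_sqrt (hn0 l).le,
        Real.sq_sqrt (hpos l).le]
      have := (hn0 l).ne'
      have := (hpos l).ne'
      field_simp
      simp
    simp_rw [h0, abs_zero]
    have : ∀ l, {_g : Signs (n l) | η ≤ 0} = ∅ := fun l => by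
      ext; simp [hη]
    simp [this]


/-! ### Validity of the sign-changes test from three limits -/

lemma abs_studentized {n : ℕ} (v : Fin n → ℝ) : |studentized v| = √n * testStat v := by
  rw [studentized, testStat, abs_mul, abs_div, abs_of_nonneg (Real.sqrt_nonneg _),
    abs_of_nonneg (show 0 ≤ sampleSD v from Real.sqrt_nonneg _)]

/-- If the test rejects, then the observed statistic exceeds at least a fraction `1 - α` of the
statistics under sign changes. -/
lemma le_card_of_criticalValue_lt {n : ℕ} {α : ℝ} (h0 : 0 < α) (h1 : α < 1) {v : Fin n → ℝ}
    (h : criticalValue α v < testStat v) :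
    (Fintype.card (Signs n) : ℝ) * (1 - α) ≤
      Finset.card {g : Signs n | testStat (signChange g v) < testStat v} := by
  set K := Fintype.card (Signs n) with hK
  have hKpos : (0 : ℝ) < K := by exact_mod_cast Fintype.card_pos
  set m := ⌈(K : ℝ) * (1 - α)⌉₊ with hm
  have hm1 : 1 ≤ m := Nat.one_le_ceil_iff.2 (mul_pos hKpos (by linarith))
  have hmK : m ≤ K := Nat.ceil_le.2 (by nlinarith)
  set s : Multiset ℝ :=
    Multiset.map (fun g : Signs n => testStat (signChange g v)) Finset.univ.val with hs
  have hL : orderedStats v = s.sort (· ≤ ·) := rfl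
  have hlen : (orderedStats v).length = K := by
    rw [hL, Multiset.length_sort, hs, Multiset.card_map]; rfl
  have hsorted : (orderedStats v).Pairwise (· ≤ ·) := by
    rw [hL]; exact Multiset.pairwise_sort _ _
  have hcount : Finset.card {g : Signs n | testStat (signChange g v) < testStat v}
      = (orderedStats v).countP (· < testStat v) := by
    rw [← Multiset.coe_countP, hL, Multiset.sort_eq, hs, Multiset.countP_map]
    rfl
  have hcrit : criticalValue α v = (orderedStats v)[m - 1]'(by omega) := by
    rw [criticalValue, List.getD_eq_getElem _ _ (by rw [← hK, ← hm]; omega)]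
  have hle : m ≤ (orderedStats v).countP (· < testStat v) := by
    have h2 : ((orderedStats v).take m).countP (· < testStat v) = m := by
      rw [List.countP_eq_length.2, List.length_take, hlen, min_eq_left hmK]
      intro x hx
      obtain ⟨i, hi, rfl⟩ := List.mem_iff_getElem.1 hx
      rw [List.length_take, hlen, min_eq_left hmK] at hi
      rw [List.getElem_take]
      refine decide_eq_true (lt_of_le_of_lt ?_ h)
      rw [hcrit]
      rcases Nat.lt_or_ge i (m - 1) with h3 | h3
      · exact List.pairwise_iff_getElem.1 hsorted i (m - 1) (by omega) (by omega) h3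
      · have : i = m - 1 := by omega
        subst this; exact le_rfl
    calc m = _ := h2.symm
      _ ≤ _ := (List.take_sublist m _).countP_le
  rw [hcount]
  exact (Nat.le_ceil _).trans (by exact_mod_cast hle)

lemma randomizationCDF_nonneg {n : ℕ} (v : Fin n → ℝ) (t : ℝ) : 0 ≤ randomizationCDF v t := by
  unfold randomizationCDF; positivity

lemma randomizationCDF_le_one {n : ℕ} (v : Fin n → ℝ) (t : ℝ) : randomizationCDF v t ≤ 1 := by
  unfold randomizationCDF
  refine div_le_one_of_le₀ ?_ (Nat.cast_nonneg _)
  exact_mod_cast Finset.card_le_univ _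

/-- If the test rejects, the randomization distribution gives mass at least `1 - α` to
`(-|R(S)|, |R(S)|]`. -/
lemma one_sub_le_of_criticalValue_lt {n : ℕ} (hn : 0 < n) {α : ℝ} (h0 : 0 < α) (h1 : α < 1)
    {v : Fin n → ℝ} (h : criticalValue α v < testStat v) :
    1 - α ≤ randomizationCDF v |studentized v| - randomizationCDF v (-|studentized v|) := by
  have h2 := le_card_of_criticalValue_lt h0 h1 h
  have hK : (0 : ℝ) < Fintype.card (Signs n) := by exact_mod_cast Fintype.card_pos
  rw [randomizationCDF, randomizationCDF, ← sub_div, le_div_iff₀ hK, mul_comm]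
  refine h2.trans ?_
  rw [le_sub_iff_add_le, ← Nat.cast_add, Nat.cast_le, ← Finset.card_union_of_disjoint]
  · refine Finset.card_le_card fun g hg => ?_
    simp only [Finset.mem_union, Finset.mem_filter, Finset.mem_univ, true_and] at hg ⊢
    rcases hg with hg | hg
    · refine (le_abs_self _).trans ?_
      rw [abs_studentized, abs_studentized]
      exact mul_le_mul_of_nonneg_left hg.le (Real.sqrt_nonneg _)
    · exact hg.trans (by have := abs_nonneg (studentized v); linarith)
  · rw [Finset.disjoint_filter]
    intro g _ hg hg'
    have h3 : |studentized (signChange g v)| < |studentized v| := by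
      rw [abs_studentized, abs_studentized]
      exact mul_lt_mul_of_pos_left hg (Real.sqrt_pos.2 (by exact_mod_cast hn))
    have := (abs_lt.1 h3).1
    linarith

section Limits

variable {α : ℕ → Type*} [∀ l, MeasurableSpace (α l)] {ν : ∀ l, Measure (α l)}
  [∀ l, IsProbabilityMeasure (ν l)] {N : ℕ → ℕ} {v : ∀ l, α l → Fin (N l) → ℝ}

lemma tendsto_measure_of_tendsto_measureReal {p : ∀ l, α l → Prop}
    (h : Tendsto (fun l => (ν l).real {ω | p l ω}) atTop (𝓝 0)) :
    Tendsto (fun l => ν l {ω | p l ω}) atTop (𝓝 0) := by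
  rw [← ENNReal.tendsto_toReal_iff (fun l => measure_ne_top _ _) ENNReal.zero_ne_top]
  exact h

lemma tendsto_measureReal_of_subset {p q₁ q₂ : ∀ l, α l → Prop}
    (h₁ : Tendsto (fun l => (ν l).real {ω | q₁ l ω}) atTop (𝓝 0))
    (h₂ : Tendsto (fun l => (ν l).real {ω | q₂ l ω}) atTop (𝓝 0))
    (h : ∀ᶠ l in atTop, ∀ ω, p l ω → q₁ l ω ∨ q₂ l ω) :
    Tendsto (fun l => (ν l).real {ω | p l ω}) atTop (𝓝 0) := by
  have h3 := h₁.add h₂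
  rw [add_zero] at h3
  refine squeeze_zero' (Eventually.of_forall fun _ => measureReal_nonneg) ?_ h3
  filter_upwards [h] with l hl
  exact (measureReal_mono (s₂ := {ω | q₁ l ω} ∪ {ω | q₂ l ω}) fun ω hω => hl ω hω).trans
    (measureReal_union_le _ _)

/-- The condition on fourth moments says that no single effect dominates the sum of squares, so the
Rademacher central limit theorem applies to the sign changes of most data sets. -/
lemma tendsto_iSup_randomizationCDF (hN : Tendsto N atTop atTop) {s2 : ℝ} (hs2 : 0 < s2)
    (hsq : ∀ η : ℝ, 0 < η → Tendsto (fun l =>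
        (ν l).real {ω | η ≤ |1 / (N l : ℝ) * ∑ i, v l ω i ^ 2 - s2|}) atTop (𝓝 0))
    (hfour : ∀ η : ℝ, 0 < η → Tendsto (fun l =>
        (ν l).real {ω | η ≤ 1 / (N l : ℝ) ^ 2 * ∑ i, v l ω i ^ 4}) atTop (𝓝 0))
    {δ : ℝ} (hδ : 0 < δ) :
    Tendsto (fun l => (ν l).real {ω | δ ≤ ⨆ t : ℝ, |randomizationCDF (v l ω) t - stdNormalCDF t|})
      atTop (𝓝 0) := by
  obtain ⟨η, hη0, hη⟩ := exists_iSup_randomizationCDF_lt hδ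
  refine tendsto_measureReal_of_subset (hsq (s2 / 2) (half_pos hs2))
    (hfour (η * (s2 / 2) ^ 2) (by positivity)) ?_
  filter_upwards [hN.eventually_ge_atTop 1] with l hl ω hω
  by_contra! hc
  obtain ⟨hc1, hc2⟩ := hc
  have hn : (0 : ℝ) < N l := by exact_mod_cast hl
  have h1 := (abs_lt.1 hc1).1
  rw [one_div, inv_mul_eq_div] at h1 hc2
  have h2 : s2 / 2 * N l < ∑ i, v l ω i ^ 2 := by
    rw [← lt_div_iff₀ hn]; linarith
  have h0 : 0 < s2 / 2 * N l := by positivity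
  rw [div_lt_iff₀ (by positivity)] at hc2
  refine absurd hω (not_le.2 (hη _ _ (h0.trans h2) (hc2.le.trans ?_)))
  rw [mul_assoc, ← mul_pow]
  gcongr

lemma tendsto_iSup_samplingCDF (hN : Tendsto N atTop atTop) (hv : ∀ l, AEMeasurable (v l) (ν l))
    {s2 : ℝ} (hs2 : 0 < s2)
    (hchar : ∀ t : ℝ, Tendsto (fun l => ∫ ω, Complex.exp
        (t * ((√(N l))⁻¹ * ∑ i, v l ω i : ℝ) * Complex.I) ∂(ν l)) atTop
      (𝓝 (Complex.exp (-((s2 : ℂ) * (t : ℂ) ^ 2) / 2))))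
    (hsq : ∀ η : ℝ, 0 < η → Tendsto (fun l =>
        (ν l).real {ω | η ≤ |1 / (N l : ℝ) * ∑ i, v l ω i ^ 2 - s2|}) atTop (𝓝 0)) :
    Tendsto (fun l => ⨆ t : ℝ, |samplingCDF (ν l) (v l) t - stdNormalCDF t|) atTop (𝓝 0) := by
  set a : ℝ := (√s2)⁻¹ with ha
  have ha0 : 0 < a := inv_pos.2 (Real.sqrt_pos.2 hs2)
  have ha2 : a ^ 2 = s2⁻¹ := by rw [ha, inv_pow, Real.sq_sqrt hs2.le]
  let law : ∀ l, Measure (Fin (N l) → ℝ) := fun l => (ν l).map (v l)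
  have hlaw : ∀ l, IsProbabilityMeasure (law l) := fun l => Measure.isProbabilityMeasure_map (hv l)
  have hmeas : ∀ l, Measurable fun (w : Fin (N l) → ℝ) i => a * w i := fun l => by fun_prop
  have h := tendsto_iSup_cdf_studentized (ν := law) hN hmeas ?_ ?_
  · refine h.congr fun l => ?_
    congr 1
    ext t
    congr 2
    simp_rw [studentized_const_mul ha0]
    rw [map_measureReal_apply_of_aemeasurable (hv l)
      (measurableSet_le measurable_studentized measurable_const)]
    rfl
  · intro t
    have h2 := hchar (t * a)
    have e : Complex.exp (-((s2 : ℂ) * ((t * a : ℝ) : ℂ) ^ 2) / 2)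
        = Complex.exp (-(t : ℂ) ^ 2 / 2) := by
      have : s2 * (t * a) ^ 2 = t ^ 2 := by
        rw [mul_pow, ha2]; field_simp
      rw [← Complex.ofReal_pow, ← Complex.ofReal_mul, this]
      push_cast
      rfl
    rw [e] at h2
    refine h2.congr fun l => ?_
    rw [integral_map (hv l) (by
      exact (by fun_prop : Measurable _).aestronglyMeasurable)]
    congr 1
    ext ω
    congr 2
    rw [← Finset.mul_sum]
    push_cast
    ring
  · intro η hη
    refine (hsq (η * s2) (by positivity)).congr fun l => ?_
    rw [map_measureReal_apply_of_aemeasurable (hv l)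
      (measurableSet_le measurable_const (by fun_prop))]
    congr 1
    ext ω
    simp only [Set.mem_ofPred_eq, Set.preimage_ofPred_eq]
    have : 1 / (N l : ℝ) * ∑ i, (a * v l ω i) ^ 2 - 1
        = (1 / (N l : ℝ) * ∑ i, v l ω i ^ 2 - s2) / s2 := by
      simp_rw [mul_pow]
      rw [← Finset.mul_sum, ha2]
      field_simp
    rw [this, abs_div, abs_of_pos hs2, le_div_iff₀ hs2]

/-- Asymptotic validity from the two normal limits: the randomization distribution controls the
critical value, the sampling distribution the probability of exceeding it. -/
lemma limsup_signTest_le (hN : Tendsto N atTop atTop) (hv : ∀ l, AEMeasurable (v l) (ν l))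
    (hrand : ∀ δ : ℝ, 0 < δ → Tendsto (fun l => (ν l).real
      {ω | δ ≤ ⨆ t : ℝ, |randomizationCDF (v l ω) t - stdNormalCDF t|}) atTop (𝓝 0))
    (hsamp : Tendsto (fun l => ⨆ t : ℝ, |samplingCDF (ν l) (v l) t - stdNormalCDF t|)
      atTop (𝓝 0)) {lev : ℝ} (h0 : 0 < lev) (h1 : lev < 1) :
    limsup (fun l => ∫ ω, signTest lev (v l ω) ∂(ν l)) atTop ≤ lev := by
  have hnn : ∀ l ω, 0 ≤ signTest lev (v l ω) := fun l ω => by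
    unfold signTest; split_ifs <;> norm_num
  refine le_of_forall_pos_le_add fun ε hε => ?_
  -- The slack in the critical point and in the two approximations: the rejection probability is at
  -- most `η` (bad data) plus `lev + 6η` (the tails beyond `±a`).
  set η := min (ε / 12) ((1 - lev) / 8) with hη
  have hη0 : 0 < η := lt_min (by positivity) (by linarith)
  have hη1 : η ≤ ε / 12 := min_le_left _ _
  have hη2 : η ≤ (1 - lev) / 8 := min_le_right _ _
  obtain ⟨a, ha⟩ := exists_stdNormalCDF_eq (y := 1 - lev / 2 - 2 * η) (by linarith) (by linarith)
  have hS := hsamp.eventually (eventually_lt_nhds hη0)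
  have hR := (hrand η hη0).eventually (eventually_lt_nhds hη0)
  refine limsup_le_of_le ?_ ?_
  · exact (isBoundedUnder_of ⟨0, fun l => integral_nonneg (hnn l)⟩ :
      IsBoundedUnder (· ≥ ·) atTop _).isCoboundedUnder_le
  filter_upwards [hS, hR, hN.eventually_ge_atTop 1] with l hl1 hl2 hl3
  set B := {ω | η ≤ ⨆ t : ℝ, |randomizationCDF (v l ω) t - stdNormalCDF t|} with hB
  set Rj := {ω | ¬ studentized (v l ω) ≤ a} with hRj
  set Rm := {ω | studentized (v l ω) ≤ -a} with hRm
  have hsub : {ω | signTest lev (v l ω) ≠ 0} ⊆ toMeasurable (ν l) (B ∪ (Rj ∪ Rm)) := by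
    refine Set.Subset.trans (fun ω hω => ?_) (subset_toMeasurable _ _)
    by_cases hω' : ω ∈ B
    · exact Or.inl hω'
    right
    have hc : criticalValue lev (v l ω) < testStat (v l ω) := by
      by_contra hc; exact hω (if_neg hc)
    have h2 := one_sub_le_of_criticalValue_lt (by omega) h0 h1 hc
    have h3 : ⨆ t : ℝ, |randomizationCDF (v l ω) t - stdNormalCDF t| < η := not_le.1 hω'
    have hb := bddAbove_abs_sub_stdNormalCDF (randomizationCDF_nonneg (v l ω))
      (randomizationCDF_le_one (v l ω))
    have h4 := abs_lt.1 ((le_ciSup hb |studentized (v l ω)|).trans_lt h3)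
    have h5 := abs_lt.1 ((le_ciSup hb (-|studentized (v l ω)|)).trans_lt h3)
    rw [stdNormalCDF_neg] at h5
    have h6 : stdNormalCDF a < stdNormalCDF |studentized (v l ω)| := by
      rw [ha]; linarith [h4.2, h5.1]
    have h7 : a < |studentized (v l ω)| := by
      by_contra hc'
      exact absurd (stdNormalCDF_mono (not_lt.1 hc')) (not_le.2 h6)
    rcases lt_abs.1 h7 with h8 | h8
    · exact Or.inl (not_le.2 h8)
    · exact Or.inr (show studentized (v l ω) ≤ -a by linarith)
  have hbs := bddAbove_abs_sub_stdNormalCDF (F := samplingCDF (ν l) (v l))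
    (fun _ => measureReal_nonneg) (fun _ => measureReal_le_one)
  have h4 := abs_lt.1 ((le_ciSup hbs a).trans_lt hl1)
  have h5 := abs_lt.1 ((le_ciSup hbs (-a)).trans_lt hl1)
  rw [stdNormalCDF_neg] at h5
  have hRj' : (ν l).real Rj = 1 - samplingCDF (ν l) (v l) a := by
    have hnm : NullMeasurableSet {ω | studentized (v l ω) ≤ a} (ν l) :=
      nullMeasurableSet_le (measurable_studentized.comp_aemeasurable (hv l)) aemeasurable_const
    have : Rj = {ω | studentized (v l ω) ≤ a}ᶜ := rfl
    rw [this, measureReal_def, prob_compl_eq_one_sub₀ hnm,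
      ENNReal.toReal_sub_of_le prob_le_one ENNReal.one_ne_top, ENNReal.toReal_one]
    rfl
  calc ∫ ω, signTest lev (v l ω) ∂(ν l)
      ≤ ∫ ω, (toMeasurable (ν l) (B ∪ (Rj ∪ Rm))).indicator (fun _ => (1 : ℝ)) ω ∂(ν l) := by
        refine integral_mono_of_nonneg (Eventually.of_forall (hnn l))
          ((integrable_const _).indicator (measurableSet_toMeasurable _ _))
          (Eventually.of_forall fun ω => ?_)
        by_cases hω : signTest lev (v l ω) = 0
        · simp only [hω]
          exact Set.indicator_nonneg (fun _ _ => zero_le_one) _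
        · simp only
          rw [Set.indicator_of_mem (hsub hω)]
          unfold signTest; split_ifs <;> norm_num
    _ = (ν l).real (B ∪ (Rj ∪ Rm)) := by
        rw [integral_indicator_const _ (measurableSet_toMeasurable _ _), smul_eq_mul, mul_one,
          measureReal_def, measure_toMeasurable, measureReal_def]
    _ ≤ (ν l).real B + ((ν l).real Rj + (ν l).real Rm) :=
        (measureReal_union_le _ _).trans (by gcongr; exact measureReal_union_le _ _)
    _ ≤ lev + ε := by
        have : (ν l).real Rm = samplingCDF (ν l) (v l) (-a) := rfl
        rw [hRj', this]
        rw [ha] at h4 h5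
        linarith [h4.1, h5.2]

lemma tendsto_iSup_randomizationCDF_sub_samplingCDF
    (hrand : ∀ δ : ℝ, 0 < δ → Tendsto (fun l => (ν l).real
      {ω | δ ≤ ⨆ t : ℝ, |randomizationCDF (v l ω) t - stdNormalCDF t|}) atTop (𝓝 0))
    (hsamp : Tendsto (fun l => ⨆ t : ℝ, |samplingCDF (ν l) (v l) t - stdNormalCDF t|)
      atTop (𝓝 0)) {δ : ℝ} (hδ : 0 < δ) :
    Tendsto (fun l => (ν l).real {ω | δ ≤ ⨆ t : ℝ,
      |randomizationCDF (v l ω) t - samplingCDF (ν l) (v l) t|}) atTop (𝓝 0) := by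
  refine tendsto_measureReal_of_subset (hrand (δ / 2) (half_pos hδ))
    (hrand (δ / 2) (half_pos hδ)) ?_
  filter_upwards [hsamp.eventually (eventually_lt_nhds (half_pos hδ))] with l hl ω hω
  left
  by_contra! hc
  refine absurd hω (not_le.2 (lt_of_le_of_lt (ciSup_le fun t => ?_) (show
    (⨆ t : ℝ, |randomizationCDF (v l ω) t - stdNormalCDF t|) +
    (⨆ t : ℝ, |samplingCDF (ν l) (v l) t - stdNormalCDF t|) < δ by linarith)))
  have h1 := le_ciSup (bddAbove_abs_sub_stdNormalCDF (randomizationCDF_nonneg (v l ω))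
      (randomizationCDF_le_one (v l ω))) t
  have h2 := le_ciSup (bddAbove_abs_sub_stdNormalCDF (F := samplingCDF (ν l) (v l))
    (fun _ => measureReal_nonneg) (fun _ => measureReal_le_one)) t
  have h3 := abs_sub_le (randomizationCDF (v l ω) t) (stdNormalCDF t) (samplingCDF (ν l) (v l) t)
  rw [abs_sub_comm (stdNormalCDF t)] at h3
  linarith

end Limits

/-! ### Weighted blocks of independent errors -/

section Averages

variable {Ω : Type*} [MeasurableSpace Ω] {P : Measure Ω} [IsProbabilityMeasure P]

lemma integral_abs_le_sqrt {Z : Ω → ℝ} (hZ : MemLp Z 2 P) :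
    ∫ ω, |Z ω| ∂P ≤ √(∫ ω, Z ω ^ 2 ∂P) := by
  refine Real.le_sqrt_of_sq_le ?_
  have h := variance_nonneg (fun ω => |Z ω|) P
  rw [variance_eq_sub (X := fun ω => |Z ω|) hZ.abs] at h
  simp only [Pi.pow_apply, sq_abs] at h
  linarith

/-- The mean absolute error in the weak law of large numbers. -/
lemma integral_abs_average_sub_le {n : ℕ} {Z : Fin n → Ω → ℝ} (hZ : ∀ i, MemLp (Z i) 2 P)
    (hind : Pairwise fun i j => IndepFun (Z i) (Z j) P) {D : ℝ}
    (hD : ∀ i, ∫ ω, Z i ω ^ 2 ∂P ≤ D) :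
    ∫ ω, |1 / (n : ℝ) * ∑ i, (Z i ω - ∫ ω', Z i ω' ∂P)| ∂P ≤ √(D / n) := by
  have hmem : MemLp (fun ω => 1 / (n : ℝ) * ∑ i, Z i ω) 2 P :=
    (memLp_finsetSum _ fun i _ => hZ i).const_mul _
  have hint : ∀ i, Integrable (Z i) P := fun i => (hZ i).integrable (by norm_num)
  have he : ∀ ω, 1 / (n : ℝ) * ∑ i, (Z i ω - ∫ ω', Z i ω' ∂P)
      = 1 / (n : ℝ) * ∑ i, Z i ω - ∫ ω', 1 / (n : ℝ) * ∑ i, Z i ω' ∂P := by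
    intro ω
    rw [integral_const_mul, integral_finsetSum _ fun i _ => hint i, Finset.sum_sub_distrib, mul_sub]
  simp_rw [he]
  refine (integral_abs_le_sqrt (Z := fun ω => 1 / (n : ℝ) * ∑ i, Z i ω -
    ∫ ω', 1 / (n : ℝ) * ∑ i, Z i ω' ∂P) (hmem.sub (memLp_const _))).trans (Real.sqrt_le_sqrt ?_)
  rw [← variance_eq_integral hmem.aestronglyMeasurable.aemeasurable, variance_const_mul]
  have hsum : Var[fun ω => ∑ i, Z i ω; P] ≤ n * D := by
    have e : (fun ω => ∑ i, Z i ω) = ∑ i, Z i := by ext; simp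
    rw [e, IndepFun.variance_sum (fun i _ => hZ i) fun i _ j _ hij => hind hij]
    calc _ ≤ ∑ _i : Fin n, D := Finset.sum_le_sum fun i _ =>
          (variance_le_expectation_sq (hZ i).aestronglyMeasurable).trans (hD i)
      _ = _ := by simp
  rcases Nat.eq_zero_or_pos n with rfl | hn
  · simp
  calc (1 / (n : ℝ)) ^ 2 * Var[fun ω => ∑ i, Z i ω; P] ≤ (1 / (n : ℝ)) ^ 2 * (n * D) := by gcongr
    _ = D / n := by field_simp

end Averages

lemma norm_exp_mul_I_sub_taylor_le (x : ℝ) :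
    ‖Complex.exp (x * Complex.I) - (1 + x * Complex.I - (x : ℂ) ^ 2 / 2)‖ ≤ 4 * |x| ^ 3 := by
  have hx3 : 0 ≤ |x| ^ 3 := by positivity
  by_cases hx : |x| ≤ 1
  · have h := Complex.exp_bound (x := x * Complex.I) (by simpa using hx) (n := 3) (by norm_num)
    have e : ∑ m ∈ Finset.range 3, ((x : ℂ) * Complex.I) ^ m / (m.factorial : ℂ)
        = 1 + x * Complex.I - (x : ℂ) ^ 2 / 2 := by
      simp [Finset.sum_range_succ, mul_pow]
      ring
    rw [e] at h
    refine h.trans ?_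
    simp only [norm_mul, Complex.norm_real, Complex.norm_I, mul_one, Real.norm_eq_abs]
    norm_num [Nat.factorial]
    linarith
  · have hx1 := (not_le.1 hx).le
    have h1 : |x| ≤ |x| ^ 3 := le_self_pow₀ hx1 (by norm_num)
    have h2 : |x| ^ 2 ≤ |x| ^ 3 := pow_le_pow_right₀ hx1 (by norm_num)
    have h3 : 1 ≤ |x| ^ 3 := one_le_pow₀ hx1
    calc _ ≤ ‖Complex.exp (x * Complex.I)‖ + (‖(1 : ℂ)‖ + ‖x * Complex.I‖ + ‖(x : ℂ) ^ 2 / 2‖) :=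
          (norm_sub_le _ _).trans (by
            gcongr; exact (norm_sub_le _ _).trans (by gcongr; exact norm_add_le _ _))
      _ = 1 + (1 + |x| + |x| ^ 2 / 2) := by
          rw [Complex.norm_exp_ofReal_mul_I]; simp
      _ ≤ _ := by linarith

lemma abs_exp_neg_sub_le {y : ℝ} (hy : 0 ≤ y) : |Real.exp (-y) - (1 - y)| ≤ y ^ 2 := by
  by_cases h : y ≤ 1
  · have := Real.abs_exp_sub_one_sub_id_le (x := -y) (by rwa [abs_neg, abs_of_nonneg hy])
    rw [neg_sq] at this
    convert this using 2; ring
  · have h1 : Real.exp (-y) ≤ 1 := Real.exp_le_one_iff.2 (by linarith)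
    have h2 := Real.exp_pos (-y)
    rw [abs_le]; constructor <;> nlinarith

/-- Independent centered errors with variances `v s` and fourth moments at most `C`. -/
structure CenteredErrors {σ Ω : Type*} [MeasurableSpace Ω] (P : Measure Ω) (e : σ → Ω → ℝ)
    (v : σ → ℝ) (C : ℝ) : Prop where
  indep : iIndepFun e P
  meas : ∀ s, Measurable (e s)
  integrable_four : ∀ s, Integrable (fun ω => e s ω ^ 4) P
  mean : ∀ s, ∫ ω, e s ω ∂P = 0
  var : ∀ s, ∫ ω, e s ω ^ 2 ∂P = v s
  four : ∀ s, ∫ ω, e s ω ^ 4 ∂P ≤ C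

namespace CenteredErrors

variable {σ Ω : Type*} [MeasurableSpace Ω] {P : Measure Ω}
  {e : σ → Ω → ℝ} {v : σ → ℝ} {C : ℝ}

lemma memLp_four (h : CenteredErrors P e v C) (s : σ) : MemLp (e s) 4 P := by
  rw [← integrable_norm_rpow_iff (h.meas s).aestronglyMeasurable (by norm_num) (by norm_num)]
  refine (h.integrable_four s).congr (Eventually.of_forall fun ω => ?_)
  have : (4 : ENNReal).toReal = ((4 : ℕ) : ℝ) := by norm_num
  simp only [this, Real.rpow_natCast, Real.norm_eq_abs]
  rw [show (4 : ℕ) = 2 * 2 from rfl, pow_mul, pow_mul, sq_abs]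

lemma nonneg (h : CenteredErrors P e v C) (s : σ) : 0 ≤ C :=
  (integral_nonneg fun ω => by positivity).trans (h.four s)

lemma var_nonneg (h : CenteredErrors P e v C) (s : σ) : 0 ≤ v s := by
  rw [← h.var s]; exact integral_nonneg fun _ => sq_nonneg _

lemma memLp_two_sq {Z : Ω → ℝ} (hZ : MemLp Z 4 P) : MemLp (fun ω => Z ω ^ 2) 2 P := by
  rw [memLp_two_iff_integrable_sq (f := fun ω => Z ω ^ 2) (hZ.aestronglyMeasurable.pow 2)]
  have h1 := hZ.integrable_norm_rpow (by norm_num) (by norm_num)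
  refine h1.congr (Eventually.of_forall fun ω => ?_)
  have : (4 : ENNReal).toReal = ((4 : ℕ) : ℝ) := by norm_num
  simp only [this, Real.rpow_natCast, Real.norm_eq_abs]
  rw [show (4 : ℕ) = 2 * 2 from rfl, pow_mul, sq_abs, ← pow_mul]

variable [IsProbabilityMeasure P]

lemma memLp_two (h : CenteredErrors P e v C) (s : σ) : MemLp (e s) 2 P :=
  (h.memLp_four s).mono_exponent (by norm_num)

lemma integrable (h : CenteredErrors P e v C) (s : σ) : Integrable (e s) P :=
  (h.memLp_two s).integrable (by norm_num)

lemma var_le (h : CenteredErrors P e v C) (s : σ) : v s ≤ 1 + C := by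
  rw [← h.var s]
  calc ∫ ω, e s ω ^ 2 ∂P ≤ ∫ ω, (1 + e s ω ^ 4) ∂P := by
        refine integral_mono (h.memLp_two s).integrable_sq
          ((integrable_const _).add (h.integrable_four s)) fun ω => ?_
        simp only
        nlinarith [sq_nonneg (e s ω ^ 2 - 1), sq_nonneg (e s ω)]
    _ ≤ 1 + C := by
        rw [integral_add (integrable_const _) (h.integrable_four s)]
        simpa using h.four s

/-- The characteristic function of a centered error is close to the one of a normal variable
with the same variance. -/
lemma norm_charFun_sub_le (h : CenteredErrors P e v C) (s : σ) {θ : ℝ} (hθ : |θ| ≤ 1) :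
    ‖∫ ω, Complex.exp ((θ * e s ω : ℝ) * Complex.I) ∂P - (Real.exp (-(θ ^ 2 * v s / 2)) : ℂ)‖
      ≤ 5 * (1 + C) ^ 2 * |θ| ^ 3 := by
  have hC := h.nonneg s
  have hθ3 : 0 ≤ |θ| ^ 3 := by positivity
  have hi1 : Integrable (fun ω => Complex.exp ((θ * e s ω : ℝ) * Complex.I)) P := by
    have := h.meas s
    refine Integrable.of_bound (C := 1) (by fun_prop) (Eventually.of_forall fun ω => ?_)
    rw [Complex.norm_exp_ofReal_mul_I]
  have hi2 : Integrable (fun ω => ((1 - (θ * e s ω) ^ 2 / 2 : ℝ) : ℂ) +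
      ((θ * e s ω : ℝ) : ℂ) * Complex.I) P := by
    refine Integrable.add ?_ ?_
    · refine Integrable.ofReal ((integrable_const _).sub ?_)
      simp_rw [mul_pow]
      exact ((h.memLp_two s).integrable_sq.const_mul _).div_const _
    · exact ((h.integrable s).const_mul θ).ofReal.mul_const _
  have he2 : ∫ ω, (((1 - (θ * e s ω) ^ 2 / 2 : ℝ) : ℂ) +
      ((θ * e s ω : ℝ) : ℂ) * Complex.I) ∂P = ((1 - θ ^ 2 * v s / 2 : ℝ) : ℂ) := by
    have hsq : Integrable (fun ω => (θ * e s ω) ^ 2 / 2) P := by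
      simp_rw [mul_pow]
      exact ((h.memLp_two s).integrable_sq.const_mul _).div_const _
    rw [integral_add ((integrable_const _).sub hsq).ofReal
      (((h.integrable s).const_mul θ).ofReal.mul_const _), integral_mul_const,
      integral_complex_ofReal, integral_complex_ofReal, integral_const_mul, h.mean,
      integral_sub (integrable_const _) hsq,
      integral_div]
    simp_rw [mul_pow]
    rw [integral_const_mul, h.var]
    simp
  have h3 : ‖∫ ω, Complex.exp ((θ * e s ω : ℝ) * Complex.I) ∂P -
      ((1 - θ ^ 2 * v s / 2 : ℝ) : ℂ)‖ ≤ 4 * |θ| ^ 3 * (1 + C) := by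
    rw [← he2, ← integral_sub hi1 hi2]
    calc _ ≤ ∫ ω, 4 * |θ| ^ 3 * (1 + e s ω ^ 4) ∂P := by
          refine norm_integral_le_of_norm_le
            (((integrable_const _).add (h.integrable_four s)).const_mul _)
            (Eventually.of_forall fun ω => ?_)
          have h4 := norm_exp_mul_I_sub_taylor_le (θ * e s ω)
          have h5 : |e s ω| ^ 3 ≤ 1 + e s ω ^ 4 := by
            have e4 : e s ω ^ 4 = |e s ω| ^ 4 := by
              rw [show (4 : ℕ) = 2 * 2 from rfl, pow_mul, pow_mul, sq_abs]
            rw [e4]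
            rcases le_total (|e s ω|) 1 with h6 | h6
            · have := pow_le_one₀ (n := 3) (abs_nonneg (e s ω)) h6
              have : 0 ≤ |e s ω| ^ 4 := by positivity
              linarith
            · have := pow_le_pow_right₀ h6 (show 3 ≤ 4 by norm_num)
              linarith
          rw [abs_mul, mul_pow] at h4
          calc _ ≤ 4 * (|θ| ^ 3 * |e s ω| ^ 3) := by
                refine le_trans (le_of_eq ?_) h4
                congr 2
                push_cast; ring
            _ ≤ _ := by rw [mul_assoc]; gcongr
      _ ≤ _ := by
          rw [integral_const_mul, integral_add (integrable_const _) (h.integrable_four s)]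
          have := h.four s
          simp only [integral_const, probReal_univ, one_smul]
          gcongr
  have h6 : ‖((1 - θ ^ 2 * v s / 2 : ℝ) : ℂ) - (Real.exp (-(θ ^ 2 * v s / 2)) : ℂ)‖
      ≤ (1 + C) ^ 2 * |θ| ^ 3 := by
    have hv0 := h.var_nonneg s
    have hv1 := h.var_le s
    rw [← Complex.ofReal_sub, Complex.norm_real, Real.norm_eq_abs, abs_sub_comm]
    refine (abs_exp_neg_sub_le (by positivity)).trans ?_
    have e4 : (θ ^ 2 * v s / 2) ^ 2 = v s ^ 2 / 4 * |θ| ^ 4 := by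
      rw [show (4 : ℕ) = 2 * 2 from rfl, pow_mul, sq_abs]; ring
    rw [e4]
    have h7 : |θ| ^ 4 ≤ |θ| ^ 3 := pow_le_pow_of_le_one (abs_nonneg _) hθ (by norm_num)
    have h8 : v s ^ 2 / 4 ≤ (1 + C) ^ 2 := by nlinarith
    exact mul_le_mul h8 h7 (by positivity) (by positivity)
  calc _ ≤ _ := norm_sub_le_norm_sub_add_norm_sub _ ((1 - θ ^ 2 * v s / 2 : ℝ) : ℂ) _
    _ ≤ 4 * |θ| ^ 3 * (1 + C) + (1 + C) ^ 2 * |θ| ^ 3 := add_le_add h3 h6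
    _ ≤ _ := by
      have : |θ| ^ 3 * (1 + C) ≤ |θ| ^ 3 * (1 + C) ^ 2 := by
        refine mul_le_mul_of_nonneg_left ?_ hθ3; nlinarith
      nlinarith

variable {n : ℕ} {S : Fin n → Finset σ} {c : σ → ℝ} {a : Fin n → ℝ} {A : ℝ} {B : ℕ}

lemma memLp_four_block (h : CenteredErrors P e v C) (T : Finset σ) (x : ℝ) :
    MemLp (fun ω => x + ∑ s ∈ T, c s * e s ω) 4 P :=
  (memLp_const x).add (memLp_finsetSum _ fun s _ => (h.memLp_four s).const_mul _)

lemma integral_block_four_le (h : CenteredErrors P e v C) (T : Finset σ) (hc : ∀ s, |c s| ≤ 1)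
    (hT : T.card ≤ B) {x : ℝ} (hx : |x| ≤ A) (hC : 0 ≤ C) :
    ∫ ω, (x + ∑ s ∈ T, c s * e s ω) ^ 4 ∂P ≤ 8 * (A ^ 4 + B ^ 4 * C) := by
  have hpt : ∀ ω, (x + ∑ s ∈ T, c s * e s ω) ^ 4
      ≤ 8 * (A ^ 4 + B ^ 3 * ∑ s ∈ T, e s ω ^ 4) := by
    intro ω
    have even4 : ∀ y : ℝ, |y| ^ 4 = y ^ 4 := fun y => by
      rw [show (4 : ℕ) = 2 * 2 from rfl, pow_mul, pow_mul, sq_abs]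
    have h1 : (∑ s ∈ T, c s * e s ω) ^ 4 ≤ B ^ 3 * ∑ s ∈ T, e s ω ^ 4 := by
      rcases T.eq_empty_or_nonempty with rfl | hne
      · simp
      have h2 := pow_sum_div_card_le_sum_pow (s := T) (f := fun s => |c s * e s ω|)
        (fun _ _ => abs_nonneg _) 3
      have hcard : (0 : ℝ) < T.card := by exact_mod_cast hne.card_pos
      rw [div_le_iff₀ (by positivity)] at h2
      have h3 : (∑ s ∈ T, c s * e s ω) ^ 4 ≤ (∑ s ∈ T, |c s * e s ω|) ^ 4 := by
        rw [← even4]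
        exact pow_le_pow_left₀ (abs_nonneg _) (Finset.abs_sum_le_sum_abs _ _) 4
      refine h3.trans (h2.trans ?_)
      rw [mul_comm]
      have hB : (T.card : ℝ) ^ 3 ≤ (B : ℝ) ^ 3 := by
        have : (T.card : ℝ) ≤ B := by exact_mod_cast hT
        gcongr
      refine mul_le_mul hB (Finset.sum_le_sum fun s _ => ?_)
        (Finset.sum_nonneg fun _ _ => by positivity) (by positivity)
      rw [show 3 + 1 = 4 from rfl, abs_mul, mul_pow, even4 (e s ω)]
      refine mul_le_of_le_one_left (by positivity) (pow_le_one₀ (abs_nonneg _) (hc s))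
    have h4 : x ^ 4 ≤ A ^ 4 := by
      rw [← even4]; exact pow_le_pow_left₀ (abs_nonneg _) hx 4
    have h5 := (show Even 4 by decide).add_pow_le (a := x) (b := ∑ s ∈ T, c s * e s ω)
    norm_num at h5
    linarith
  have hi : Integrable (fun ω => ∑ s ∈ T, e s ω ^ 4) P :=
    integrable_finsetSum _ fun s _ => h.integrable_four s
  calc _ ≤ ∫ ω, 8 * (A ^ 4 + B ^ 3 * ∑ s ∈ T, e s ω ^ 4) ∂P :=
        integral_mono_of_nonneg (Eventually.of_forall fun ω => by positivity)
          (((integrable_const _).add (hi.const_mul _)).const_mul _) (Eventually.of_forall hpt)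
    _ = 8 * (A ^ 4 + B ^ 3 * ∑ s ∈ T, ∫ ω, e s ω ^ 4 ∂P) := by
        rw [integral_const_mul, integral_add (integrable_const _) (hi.const_mul _),
          integral_const_mul, integral_finsetSum _ fun s _ => h.integrable_four s]
        simp
    _ ≤ _ := by
        have h1 : ∑ s ∈ T, ∫ ω, e s ω ^ 4 ∂P ≤ B * C :=
          calc _ ≤ ∑ _s ∈ T, C := Finset.sum_le_sum fun s _ => h.four s
            _ = T.card * C := by simp
            _ ≤ _ := by gcongr
        have h2 : (B : ℝ) ^ 3 * ∑ s ∈ T, ∫ ω, e s ω ^ 4 ∂P ≤ B ^ 3 * (B * C) := by gcongr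
        nlinarith

lemma integral_block_sq (h : CenteredErrors P e v C) (T : Finset σ) (x : ℝ) :
    ∫ ω, (x + ∑ s ∈ T, c s * e s ω) ^ 2 ∂P = x ^ 2 + ∑ s ∈ T, c s ^ 2 * v s := by
  have hX : MemLp (fun ω => ∑ s ∈ T, c s * e s ω) 2 P :=
    memLp_finsetSum _ fun s _ => (h.memLp_two s).const_mul _
  have hX0 : ∫ ω, ∑ s ∈ T, c s * e s ω ∂P = 0 := by
    rw [integral_finsetSum _ fun s _ => (h.integrable s).const_mul _]
    refine Finset.sum_eq_zero fun s _ => ?_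
    rw [integral_const_mul, h.mean, mul_zero]
  have hX2 : ∫ ω, (∑ s ∈ T, c s * e s ω) ^ 2 ∂P = ∑ s ∈ T, c s ^ 2 * v s := by
    rw [← variance_of_integral_eq_zero (X := fun ω => ∑ s ∈ T, c s * e s ω)
      hX.aestronglyMeasurable.aemeasurable hX0]
    have e1 : (fun ω => ∑ s ∈ T, c s * e s ω) = ∑ s ∈ T, fun ω => c s * e s ω := by ext; simp
    rw [e1, IndepFun.variance_sum (fun s _ => (h.memLp_two s).const_mul _)]
    · refine Finset.sum_congr rfl fun s _ => ?_
      rw [variance_const_mul, variance_of_integral_eq_zero (h.meas s).aemeasurable (h.mean s),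
        h.var]
    · intro s _ s' _ hss
      exact (h.indep.indepFun hss).comp (measurable_const_mul (c s)) (measurable_const_mul (c s'))
  have hi := hX.integrable (by norm_num)
  have e2 : ∀ ω, (x + ∑ s ∈ T, c s * e s ω) ^ 2
      = x ^ 2 + 2 * x * ∑ s ∈ T, c s * e s ω + (∑ s ∈ T, c s * e s ω) ^ 2 := fun ω => by ring
  simp_rw [e2]
  rw [integral_add (f := fun ω => x ^ 2 + 2 * x * ∑ s ∈ T, c s * e s ω)
      ((integrable_const _).add (hi.const_mul _)) hX.integrable_sq,
    integral_add (integrable_const _) (hi.const_mul _), integral_const_mul, hX0, hX2]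
  simp

/-- Law of large numbers for the squares of sums over disjoint blocks of errors. -/
lemma integral_abs_average_block_sq_le (h : CenteredErrors P e v C)
    (hS : Pairwise fun i j => Disjoint (S i) (S j)) (hc : ∀ s, |c s| ≤ 1)
    (hB : ∀ i, (S i).card ≤ B) (ha : ∀ i, |a i| ≤ A) (hC : 0 ≤ C) :
    ∫ ω, |1 / (n : ℝ) * ∑ i, ((a i + ∑ s ∈ S i, c s * e s ω) ^ 2
      - (a i ^ 2 + ∑ s ∈ S i, c s ^ 2 * v s))| ∂P ≤ √(8 * (A ^ 4 + B ^ 4 * C) / n) := by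
  simp_rw [← h.integral_block_sq]
  refine integral_abs_average_sub_le
    (Z := fun i ω => (a i + ∑ s ∈ S i, c s * e s ω) ^ 2)
    (fun i => memLp_two_sq (h.memLp_four_block (S i) (a i))) (fun i j hij => ?_) fun i => ?_
  · have h1 := h.indep.indepFun_finset (S i) (S j) (hS hij) h.meas
    have h2 := h1.comp (φ := fun y : S i → ℝ => (a i + ∑ s : S i, c s * y s) ^ 2)
      (ψ := fun y : S j → ℝ => (a j + ∑ s : S j, c s * y s) ^ 2) (by fun_prop) (by fun_prop)
    have e1 : ∀ k, (fun ω => (a k + ∑ s ∈ S k, c s * e s ω) ^ 2)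
        = (fun y : S k → ℝ => (a k + ∑ s : S k, c s * y s) ^ 2) ∘ fun ω (s : S k) => e s ω := by
      intro k
      ext ω
      simp only [Function.comp]
      rw [Finset.sum_coe_sort (S k) fun s => c s * e s ω]
    simp only [e1]
    exact h2
  · simp_rw [← pow_mul]
    exact h.integral_block_four_le (S i) hc (hB i) (ha i) hC

/-- The characteristic function of a normalized sum over disjoint blocks of errors is close to
the one of a normal variable with the same mean and variance. -/
lemma norm_charFun_sum_block_sub_le (h : CenteredErrors P e v C)
    (hS : Pairwise fun i j => Disjoint (S i) (S j)) (hc : ∀ s, |c s| ≤ 1)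
    (hB : ∀ i, (S i).card ≤ B) (hn : 0 < n) {t : ℝ} (ht : |t| ≤ √n) :
    ‖∫ ω, Complex.exp ((t * ((√n)⁻¹ * ∑ i, (a i + ∑ s ∈ S i, c s * e s ω)) : ℝ) * Complex.I) ∂P -
      Complex.exp ((t * ((√n)⁻¹ * ∑ i, a i) : ℝ) * Complex.I
        - (t ^ 2 / (2 * n) * ∑ i, ∑ s ∈ S i, c s ^ 2 * v s : ℝ))‖
      ≤ 5 * (1 + C) ^ 2 * |t| ^ 3 * B / √n := by
  classical
  have hn' : (0 : ℝ) < n := by exact_mod_cast hn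
  have hs : 0 < √(n : ℝ) := Real.sqrt_pos.2 hn'
  -- Disjointness of the blocks turns the double sum into a sum over distinct, independent errors.
  set U : Finset σ := Finset.univ.biUnion S with hU
  have hdisj : (↑(Finset.univ : Finset (Fin n)) : Set (Fin n)).PairwiseDisjoint S :=
    fun i _ j _ hij => hS hij
  have hsum : ∀ f : σ → ℝ, ∑ i, ∑ s ∈ S i, f s = ∑ s ∈ U, f s := fun f => by
    rw [hU, Finset.sum_biUnion hdisj]
  have hcard : (U.card : ℝ) ≤ n * B := by
    have h1 : U.card ≤ n * B := by
      have := Finset.card_biUnion_le_card_mul Finset.univ S B fun i _ => hB i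
      simpa using this
    exact_mod_cast h1
  set θ : σ → ℝ := fun s => t * (√n)⁻¹ * c s with hθ
  have hθ1 : ∀ s, |θ s| ≤ |t| / √n := by
    intro s
    rw [hθ]
    simp only
    rw [abs_mul, abs_mul, abs_inv, abs_of_pos hs, ← div_eq_mul_inv]
    exact mul_le_of_le_one_right (by positivity) (hc s)
  have hθ2 : ∀ s, |θ s| ≤ 1 := fun s => (hθ1 s).trans ((div_le_one hs).2 ht)
  have h1 : ∫ ω, Complex.exp ((t * ((√n)⁻¹ * ∑ i, (a i + ∑ s ∈ S i, c s * e s ω)) : ℝ)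
        * Complex.I) ∂P
      = Complex.exp ((t * ((√n)⁻¹ * ∑ i, a i) : ℝ) * Complex.I)
        * ∏ s ∈ U, ∫ ω, Complex.exp ((θ s * e s ω : ℝ) * Complex.I) ∂P := by
    have hind : iIndepFun (fun (s : U) => e s) P := h.indep.precomp Subtype.val_injective
    have h2 := hind.integral_fun_prod_comp (f := fun (s : U) (y : ℝ) =>
      Complex.exp ((θ s * y : ℝ) * Complex.I)) (fun s => (h.meas s).aemeasurable)
      (fun s => (by fun_prop : Measurable fun y : ℝ =>
        Complex.exp ((θ s * y : ℝ) * Complex.I)).aestronglyMeasurable)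
    rw [← Finset.prod_coe_sort U, ← h2, ← integral_const_mul]
    congr 1
    ext ω
    rw [Finset.prod_coe_sort U fun s => Complex.exp ((θ s * e s ω : ℝ) * Complex.I),
      ← Complex.exp_sum, ← Complex.exp_add, ← Finset.sum_mul, ← add_mul]
    congr 2
    rw [Finset.sum_add_distrib, hsum, ← Complex.ofReal_sum, ← Complex.ofReal_add]
    congr 1
    rw [mul_add, mul_add, hθ, Finset.mul_sum, Finset.mul_sum]
    congr 1
    rw [Finset.mul_sum, Finset.mul_sum]
    exact Finset.sum_congr rfl fun s _ => by ring
  have h2 : Complex.exp ((t * ((√n)⁻¹ * ∑ i, a i) : ℝ) * Complex.I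
        - (t ^ 2 / (2 * n) * ∑ i, ∑ s ∈ S i, c s ^ 2 * v s : ℝ))
      = Complex.exp ((t * ((√n)⁻¹ * ∑ i, a i) : ℝ) * Complex.I)
        * ∏ s ∈ U, (Real.exp (-(θ s ^ 2 * v s / 2)) : ℂ) := by
    rw [sub_eq_add_neg, Complex.exp_add, ← Complex.ofReal_prod, ← Real.exp_sum,
      ← Complex.ofReal_neg, ← Complex.ofReal_exp]
    congr 3
    rw [hsum, Finset.mul_sum, ← Finset.sum_neg_distrib]
    refine Finset.sum_congr rfl fun s _ => ?_
    rw [hθ]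
    simp only
    rw [mul_pow, mul_pow, inv_pow, Real.sq_sqrt hn'.le]
    field_simp
  rw [h1, h2, ← mul_sub, norm_mul, Complex.norm_exp_ofReal_mul_I, one_mul]
  have hone : ∀ s, ‖∫ ω, Complex.exp ((θ s * e s ω : ℝ) * Complex.I) ∂P‖ ≤ 1 := by
    intro s
    refine (norm_integral_le_of_norm_le_const (C := 1) (Eventually.of_forall fun ω => ?_)).trans ?_
    · rw [Complex.norm_exp_ofReal_mul_I]
    · simp
  refine (norm_prod_sub_prod_le U (fun s _ => hone s) fun s _ => ?_).trans ?_
  · rw [Complex.norm_real, Real.norm_of_nonneg (Real.exp_pos _).le]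
    have := h.var_nonneg s
    exact Real.exp_le_one_iff.2 (by have : 0 ≤ θ s ^ 2 * v s / 2 := by positivity
                                    linarith)
  calc _ ≤ ∑ _s ∈ U, 5 * (1 + C) ^ 2 * (|t| / √n) ^ 3 := by
        refine Finset.sum_le_sum fun s _ => (h.norm_charFun_sub_le s (hθ2 s)).trans ?_
        have := hθ1 s
        gcongr
    _ = U.card * (5 * (1 + C) ^ 2 * (|t| / √n) ^ 3) := by simp
    _ ≤ n * B * (5 * (1 + C) ^ 2 * (|t| / √n) ^ 3) := by gcongr
    _ = _ := by
        have h3 : √(n : ℝ) ^ 3 = n * √n := by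
          rw [pow_succ, Real.sq_sqrt hn'.le]
        rw [div_pow, h3]
        field_simp

end CenteredErrors

/-! ### Laws of the covariate sample -/

section IidLimits

variable {𝓧 : Type*} [MeasurableSpace 𝓧]

/-- Second-order expansion of `exp (iθd - θ²w/2)`, with an error uniform over bounded `d`, `w`. -/
lemma norm_exp_sub_quadratic_le {D W θ d w : ℝ} (hd : |d| ≤ D) (hw0 : 0 ≤ w) (hw : w ≤ W)
    (hθ : |θ| * (D + W) ≤ 1) (hθ1 : |θ| ≤ 1) :
    ‖Complex.exp ((θ * d : ℝ) * Complex.I - (θ ^ 2 * w / 2 : ℝ)) - 1 - (θ * d : ℝ) * Complex.I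
        + (θ ^ 2 * (d ^ 2 + w) / 2 : ℝ)‖ ≤ ((D + W) ^ 3 + D * W + W ^ 2) * |θ| ^ 3 := by
  have hD : 0 ≤ D := (abs_nonneg _).trans hd
  have hW : 0 ≤ W := hw0.trans hw
  set z : ℂ := (θ * d : ℝ) * Complex.I - (θ ^ 2 * w / 2 : ℝ) with hz
  have hzn : ‖z‖ ≤ |θ| * (D + W) := by
    refine (norm_sub_le _ _).trans ?_
    rw [norm_mul, Complex.norm_real, Complex.norm_real, Complex.norm_I, mul_one, Real.norm_eq_abs,
      Real.norm_eq_abs, abs_mul, abs_of_nonneg (show 0 ≤ θ ^ 2 * w / 2 by positivity), ← sq_abs θ]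
    have h1 : |θ| ^ 2 * w ≤ |θ| * W := by
      rw [sq, mul_assoc]
      refine mul_le_mul_of_nonneg_left ?_ (abs_nonneg _)
      exact (mul_le_of_le_one_left hw0 hθ1).trans hw
    have h2 : |θ| * |d| ≤ |θ| * D := by gcongr
    have h3 : 0 ≤ |θ| * W := by positivity
    linarith
  have h1 := Complex.exp_bound (hzn.trans hθ) (n := 3) (by norm_num)
  have e1 : ∑ m ∈ Finset.range 3, z ^ m / (m.factorial : ℂ) = 1 + z + z ^ 2 / 2 := by
    simp [Finset.sum_range_succ]
  rw [e1] at h1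
  have h1' : ‖Complex.exp z - (1 + z + z ^ 2 / 2)‖ ≤ (D + W) ^ 3 * |θ| ^ 3 := by
    refine h1.trans ?_
    have h2 : ‖z‖ ^ 3 ≤ (|θ| * (D + W)) ^ 3 := by gcongr
    have h3 : 0 ≤ ‖z‖ ^ 3 := by positivity
    rw [mul_pow, mul_comm] at h2
    norm_num [Nat.factorial]
    linarith
  have e2 : Complex.exp z - 1 - (θ * d : ℝ) * Complex.I + (θ ^ 2 * (d ^ 2 + w) / 2 : ℝ)
      = (Complex.exp z - (1 + z + z ^ 2 / 2))
        + ((θ ^ 4 * w ^ 2 / 8 : ℝ) - (θ ^ 3 * d * w / 2 : ℝ) * Complex.I) := by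
    have hI := Complex.I_sq
    rw [hz]
    push_cast
    linear_combination ((θ : ℂ) ^ 2 * d ^ 2 / 2) * hI
  rw [e2]
  have h4 : ‖((θ ^ 4 * w ^ 2 / 8 : ℝ) : ℂ) - (θ ^ 3 * d * w / 2 : ℝ) * Complex.I‖
      ≤ (D * W + W ^ 2) * |θ| ^ 3 := by
    refine (norm_sub_le _ _).trans ?_
    rw [norm_mul, Complex.norm_real, Complex.norm_real, Complex.norm_I, mul_one, Real.norm_eq_abs,
      Real.norm_eq_abs, abs_div, abs_div, abs_mul, abs_mul, abs_mul, abs_pow, abs_pow, abs_pow,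
      abs_of_nonneg hw0]
    have h5 : |θ| ^ 4 ≤ |θ| ^ 3 := pow_le_pow_of_le_one (abs_nonneg _) hθ1 (by norm_num)
    have h6 : |θ| ^ 4 * w ^ 2 ≤ |θ| ^ 3 * W ^ 2 := by gcongr
    have h7 : |θ| ^ 3 * |d| * w ≤ |θ| ^ 3 * D * W := by gcongr
    have h8 : 0 ≤ |θ| ^ 3 * W ^ 2 := by positivity
    have h9 : 0 ≤ |θ| ^ 3 * D * W := by positivity
    norm_num
    linarith
  calc _ ≤ _ := norm_add_le _ _
    _ ≤ _ := add_le_add h1' h4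
    _ = _ := by ring

/-- The central limit theorem for bounded mean-zero variables `d`, mixed with independent normal
variables of variance `w`. -/
lemma tendsto_integral_exp_pow {μ : Measure 𝓧} [IsProbabilityMeasure μ] {d w : 𝓧 → ℝ}
    (hdm : Measurable d) (hwm : Measurable w) {D W : ℝ} (hd : ∀ x, |d x| ≤ D)
    (hw0 : ∀ x, 0 ≤ w x) (hw : ∀ x, w x ≤ W) (hd0 : ∫ x, d x ∂μ = 0) (t : ℝ) :
    Tendsto (fun n : ℕ => (∫ x, Complex.exp ((t * ((√n)⁻¹ * d x) : ℝ) * Complex.I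
        - (t ^ 2 / (2 * n) * w x : ℝ)) ∂μ) ^ n) atTop
      (𝓝 (Complex.exp (-(((∫ x, (d x ^ 2 + w x) ∂μ : ℝ) : ℂ) * (t : ℂ) ^ 2) / 2))) := by
  set s2 := ∫ x, (d x ^ 2 + w x) ∂μ with hs2
  set g : ℕ → ℂ := fun n => (∫ x, Complex.exp ((t * ((√n)⁻¹ * d x) : ℝ) * Complex.I
        - (t ^ 2 / (2 * n) * w x : ℝ)) ∂μ) - 1 with hg
  suffices hlim : Tendsto (fun n : ℕ => (n : ℂ) * g n) atTop (𝓝 (-((s2 : ℂ) * (t : ℂ) ^ 2) / 2)) by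
    refine (Complex.tendsto_one_add_pow_exp_of_tendsto hlim).congr fun n => ?_
    rw [hg]; simp
  have hx : Nonempty 𝓧 := nonempty_of_isProbabilityMeasure μ
  have hD : 0 ≤ D := (abs_nonneg _).trans (hd hx.some)
  have hW : 0 ≤ W := (hw0 hx.some).trans (hw hx.some)
  set K := (D + W) ^ 3 + D * W + W ^ 2 with hK
  have hdi : Integrable d μ := Integrable.of_bound (C := D) hdm.aestronglyMeasurable
    (Eventually.of_forall hd)
  have hqi : Integrable (fun x => d x ^ 2 + w x) μ := by
    refine Integrable.of_bound (C := D ^ 2 + W) (by fun_prop) (Eventually.of_forall fun x => ?_)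
    rw [Real.norm_of_nonneg (by have := hw0 x; positivity)]
    exact add_le_add (sq_le_sq' (abs_le.1 (hd x)).1 (abs_le.1 (hd x)).2) (hw x)
  have hsq : Tendsto (fun n : ℕ => (√(n : ℝ))⁻¹) atTop (𝓝 0) :=
    tendsto_inv_atTop_zero.comp (Real.tendsto_sqrt_atTop.comp tendsto_natCast_atTop_atTop)
  have hθ0 : Tendsto (fun n : ℕ => |t| * (√(n : ℝ))⁻¹ * (D + W + 1)) atTop (𝓝 0) := by
    have := (hsq.const_mul |t|).mul_const (D + W + 1)
    simpa using this
  have hmain : ∀ᶠ n : ℕ in atTop, ‖(n : ℂ) * g n - -((s2 : ℂ) * (t : ℂ) ^ 2) / 2‖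
      ≤ K * |t| ^ 3 * (√(n : ℝ))⁻¹ := by
    filter_upwards [hθ0.eventually (eventually_le_nhds zero_lt_one), eventually_gt_atTop 0]
      with n hn1 hn
    have hn' : (0 : ℝ) < n := by exact_mod_cast hn
    have hs : 0 < √(n : ℝ) := Real.sqrt_pos.2 hn'
    set θ := t * (√(n : ℝ))⁻¹ with hθ
    have hθa : |θ| = |t| * (√(n : ℝ))⁻¹ := by rw [hθ, abs_mul, abs_inv, abs_of_pos hs]
    rw [← hθa] at hn1
    have hθ1 : |θ| ≤ 1 := by nlinarith [abs_nonneg θ]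
    have hθ2 : |θ| * (D + W) ≤ 1 := by nlinarith [abs_nonneg θ]
    have hθsq : θ ^ 2 = t ^ 2 / n := by
      rw [hθ, mul_pow, inv_pow, Real.sq_sqrt hn'.le]; rfl
    have hb := fun x => norm_exp_sub_quadratic_le (hd x) (hw0 x) (hw x) hθ2 hθ1
    have hfun : ∀ x, Complex.exp ((t * ((√n)⁻¹ * d x) : ℝ) * Complex.I
        - (t ^ 2 / (2 * n) * w x : ℝ))
        = Complex.exp ((θ * d x : ℝ) * Complex.I - (θ ^ 2 * w x / 2 : ℝ)) := by
      intro x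
      have a1 : t * ((√(n : ℝ))⁻¹ * d x) = θ * d x := by rw [hθ]; ring
      have a2 : t ^ 2 / (2 * n) * w x = θ ^ 2 * w x / 2 := by rw [hθsq]; field_simp
      rw [a1, a2]
    have hei : Integrable (fun x => Complex.exp ((θ * d x : ℝ) * Complex.I
        - (θ ^ 2 * w x / 2 : ℝ))) μ := by
      refine Integrable.of_bound (C := 1) (by fun_prop) (Eventually.of_forall fun x => ?_)
      rw [Complex.norm_exp]
      refine Real.exp_le_one_iff.2 ?_
      rw [Complex.sub_re, Complex.ofReal_re, Complex.re_ofReal_mul, Complex.I_re, mul_zero,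
        zero_sub, neg_nonpos]
      have := hw0 x
      positivity
    have hint : ∫ x, (Complex.exp ((θ * d x : ℝ) * Complex.I - (θ ^ 2 * w x / 2 : ℝ)) - 1
        - (θ * d x : ℝ) * Complex.I + (θ ^ 2 * (d x ^ 2 + w x) / 2 : ℝ)) ∂μ
        = g n + (θ ^ 2 * s2 / 2 : ℝ) := by
      have hlin : Integrable (fun x => ((θ * d x : ℝ) : ℂ) * Complex.I) μ :=
        (hdi.const_mul θ).ofReal.mul_const _
      have hquad : Integrable (fun x => ((θ ^ 2 * (d x ^ 2 + w x) / 2 : ℝ) : ℂ)) μ :=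
        ((hqi.const_mul (θ ^ 2)).div_const 2).ofReal
      have i1 : Integrable (fun x => Complex.exp ((θ * d x : ℝ) * Complex.I
        - (θ ^ 2 * w x / 2 : ℝ)) - 1) μ := hei.sub (integrable_const _)
      have i2 : Integrable (fun x => Complex.exp ((θ * d x : ℝ) * Complex.I
        - (θ ^ 2 * w x / 2 : ℝ)) - 1 - (θ * d x : ℝ) * Complex.I) μ := i1.sub hlin
      rw [integral_add i2 hquad, integral_sub i1 hlin, integral_sub hei (integrable_const _),
        integral_mul_const, integral_complex_ofReal, integral_complex_ofReal, integral_const_mul,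
        hd0, integral_div, integral_const_mul, ← hs2, hg]
      simp_rw [hfun]
      simp
    have hnorm : ‖g n + (θ ^ 2 * s2 / 2 : ℝ)‖ ≤ K * |θ| ^ 3 := by
      rw [← hint]
      refine (norm_integral_le_of_norm_le_const (Eventually.of_forall hb)).trans ?_
      rw [probReal_univ, mul_one]
    have e : (n : ℂ) * g n - -((s2 : ℂ) * (t : ℂ) ^ 2) / 2
        = n * (g n + (θ ^ 2 * s2 / 2 : ℝ)) := by
      rw [hθsq]
      have : (n : ℂ) ≠ 0 := by exact_mod_cast hn'.ne'
      push_cast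
      field_simp
      ring
    rw [e, norm_mul, Complex.norm_natCast]
    calc (n : ℝ) * ‖g n + (θ ^ 2 * s2 / 2 : ℝ)‖ ≤ n * (K * |θ| ^ 3) := by gcongr
      _ = _ := by
        rw [hθa, mul_pow, inv_pow, pow_succ (√(n : ℝ)) 2, Real.sq_sqrt hn'.le]
        field_simp
  rw [tendsto_iff_norm_sub_tendsto_zero]
  refine squeeze_zero' (Eventually.of_forall fun _ => norm_nonneg _) hmain ?_
  simpa using hsq.const_mul (K * |t| ^ 3)

end IidLimits

/-- The treatment arm of a unit of the sample: `1` for the treated and `0` for the controls. -/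
def arm {n m : ℕ} : Fin n ⊕ Fin m → Fin 2 := Sum.elim (fun _ => 1) (fun _ => 0)

section Sample

variable {𝓧 : Type*} [MeasurableSpace 𝓧] (μ : Fin 2 → Measure 𝓧)
  [∀ w, IsProbabilityMeasure (μ w)] (n m : ℕ)

/-- The joint law of independent covariates, with law `μ 1` for the `n` treated units and `μ 0`
for the `m` controls. -/
noncomputable abbrev sampleLaw : Measure (Fin n ⊕ Fin m → 𝓧) := Measure.pi fun s => μ (arm s)

/-- Only the covariates of treated units enter, and these are independent with law `μ 1`. -/
lemma integral_prod_treated (h : 𝓧 → ℂ) :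
    ∫ x, ∏ i : Fin n, h (x (Sum.inl i)) ∂(sampleLaw μ n m) = (∫ x, h x ∂(μ 1)) ^ n := by
  have h1 := integral_fintype_prod_eq_prod (μ := fun s : Fin n ⊕ Fin m => μ (arm s)) (𝕜 := ℂ)
    (fun s x => Sum.elim (fun _ => h x) (fun _ => 1) s)
  simp only [Fintype.prod_sum_type, Sum.elim_inl, Sum.elim_inr, Finset.prod_const_one,
    mul_one] at h1
  rw [h1]
  simp [arm]

lemma integral_abs_average_treated_le {q : 𝓧 → ℝ} (hq : Measurable q) {D : ℝ}
    (hD : ∀ x, |q x| ≤ D) :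
    ∫ x, |1 / (n : ℝ) * ∑ i : Fin n, (q (x (Sum.inl i)) - ∫ y, q y ∂(μ 1))| ∂(sampleLaw μ n m)
      ≤ √(D ^ 2 / n) := by
  have hind : iIndepFun (fun (s : Fin n ⊕ Fin m) (x : Fin n ⊕ Fin m → 𝓧) => q (x s))
      (sampleLaw μ n m) := iIndepFun_pi fun _ => hq.aemeasurable
  have hint : ∀ i : Fin n, ∫ x, q (x (Sum.inl i)) ∂(sampleLaw μ n m) = ∫ y, q y ∂(μ 1) := by
    intro i
    have h1 := (measurePreserving_eval (fun s : Fin n ⊕ Fin m => μ (arm s)) (Sum.inl i))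
    have h2 := integral_map (μ := sampleLaw μ n m) h1.measurable.aemeasurable
      (f := q) (by rw [h1.map_eq]; exact hq.aestronglyMeasurable)
    rw [h1.map_eq] at h2
    exact h2.symm
  have hmem : ∀ i : Fin n, MemLp (fun x : Fin n ⊕ Fin m → 𝓧 => q (x (Sum.inl i))) 2
      (sampleLaw μ n m) := fun i =>
    MemLp.of_bound (hq.comp (measurable_pi_apply _)).aestronglyMeasurable D
      (Eventually.of_forall fun x => hD _)
  have h3 := integral_abs_average_sub_le (P := sampleLaw μ n m)
    (Z := fun (i : Fin n) x => q (x (Sum.inl i))) (D := D ^ 2) hmem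
    (fun i j hij => hind.indepFun (by simpa using hij)) fun i => ?_
  · simpa only [hint] using h3
  · calc _ ≤ ∫ _x, D ^ 2 ∂(sampleLaw μ n m) := by
          refine integral_mono (hmem i).integrable_sq (integrable_const _) fun x => ?_
          exact sq_le_sq' (abs_le.1 (hD _)).1 (abs_le.1 (hD _)).2
      _ = _ := by simp

/-- Chernoff's bound for the probability that fewer than `M` of `m` independent points fall into
a given set. -/
lemma measureReal_card_lt_le (ν : Measure 𝓧) [IsProbabilityMeasure ν] {q : 𝓧 → Prop}
    [DecidablePred q] (hA : MeasurableSet {y | q y}) (M : ℕ) {p : ℝ} (hp : p ≤ ν.real {y | q y}) :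
    (Measure.pi fun _ : Fin m => ν).real
      {z | Finset.card {j | q (z j)} < M} ≤ 2 ^ M * Real.exp (-(m * p / 2)) := by
  -- Markov's inequality for `∏ g (z_j) = 2 ^ (-#{j | q (z_j)})`.
  set g : 𝓧 → ℝ := fun y => if q y then 1 / 2 else 1 with hg
  have hgm : Measurable g := Measurable.ite hA measurable_const measurable_const
  have hg0 : ∀ y, 0 ≤ g y := fun y => by rw [hg]; simp only; split_ifs <;> norm_num
  have hg1 : ∀ y, g y ≤ 1 := fun y => by rw [hg]; simp only; split_ifs <;> norm_num
  have hprod : ∀ z : Fin m → 𝓧, ∏ j, g (z j) = (1 / 2) ^ (Finset.card {j | q (z j)}) := by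
    intro z
    rw [hg]
    simp only
    rw [Finset.prod_ite]
    simp
  have hint : ∫ y, g y ∂ν = 1 - ν.real {y | q y} / 2 := by
    have e : g = fun y => 1 - Set.indicator {y | q y} (fun _ => (1 / 2 : ℝ)) y := by
      ext y
      by_cases h : q y
      · simp [hg, h]; norm_num
      · simp [hg, h]
    rw [e, integral_sub (integrable_const _) ((integrable_const _).indicator hA),
      integral_indicator_const _ hA]
    simp; ring
  have hpm : Measurable fun z : Fin m → 𝓧 => ∏ j, g (z j) :=
    Finset.measurable_fun_prod _ fun j _ => hgm.comp (measurable_pi_apply j)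
  have hi : Integrable (fun z : Fin m → 𝓧 => 2 ^ M * ∏ j, g (z j))
      (Measure.pi fun _ : Fin m => ν) := by
    refine Integrable.const_mul (Integrable.of_bound (C := 1) hpm.aestronglyMeasurable
      (Eventually.of_forall fun z => ?_)) _
    rw [Real.norm_of_nonneg (Finset.prod_nonneg fun _ _ => hg0 _)]
    exact Finset.prod_le_one (fun _ _ => hg0 _) fun _ _ => hg1 _
  have hms : MeasurableSet {z : Fin m → 𝓧 | Finset.card {j | q (z j)} < M} := by
    have : {z : Fin m → 𝓧 | Finset.card {j | q (z j)} < M}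
        = {z | ((1 / 2 : ℝ)) ^ M < ∏ j, g (z j)} := by
      ext z
      simp only [Set.mem_ofPred_eq]
      rw [hprod, pow_lt_pow_iff_right_of_lt_one₀ (by norm_num) (by norm_num)]
    rw [this]
    exact measurableSet_lt measurable_const hpm
  calc (Measure.pi fun _ : Fin m => ν).real {z | Finset.card {j | q (z j)} < M}
      = ∫ z, {z : Fin m → 𝓧 | Finset.card {j | q (z j)} < M}.indicator (fun _ => (1 : ℝ)) z
          ∂(Measure.pi fun _ : Fin m => ν) := by
        rw [integral_indicator_const _ hms]; simp
    _ ≤ ∫ z, 2 ^ M * ∏ j, g (z j) ∂(Measure.pi fun _ : Fin m => ν) := by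
        refine integral_mono ((integrable_const _).indicator hms) hi fun z => ?_
        by_cases hz : z ∈ {z : Fin m → 𝓧 | Finset.card {j | q (z j)} < M}
        · rw [Set.indicator_of_mem hz]
          simp only
          rw [hprod, one_div, inv_pow, ← div_eq_mul_inv, one_le_div (by positivity)]
          exact pow_le_pow_right₀ (by norm_num) (le_of_lt hz)
        · rw [Set.indicator_of_notMem hz]
          exact mul_nonneg (by positivity) (Finset.prod_nonneg fun _ _ => hg0 _)
    _ = 2 ^ M * (1 - ν.real {y | q y} / 2) ^ m := by
        rw [integral_const_mul, integral_fintype_prod_eq_prod (fun _ => g)]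
        simp [hint]
    _ ≤ 2 ^ M * Real.exp (-(m * p / 2)) := by
        gcongr
        have h1 : 1 - ν.real {y | q y} / 2 ≤ Real.exp (-(p / 2)) := by
          have := Real.add_one_le_exp (-(p / 2)); linarith
        have h0 : 0 ≤ 1 - ν.real {y | q y} / 2 := by
          have : ν.real {y | q y} ≤ 1 := measureReal_le_one
          linarith
        calc _ ≤ Real.exp (-(p / 2)) ^ m := pow_le_pow_left₀ h0 h1 m
          _ = _ := by rw [← Real.exp_nat_mul]; congr 1; ring

end Sample

section Configurations

variable {k : ℕ} (μ : Fin 2 → Measure (Cov k)) [∀ w, IsProbabilityMeasure (μ w)] (n m : ℕ)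

lemma ae_sampleLaw {p : Fin 2 → Cov k → Prop} (h : ∀ w, ∀ᵐ x ∂(μ w), p w x) :
    ∀ᵐ x ∂(sampleLaw μ n m), ∀ s, p (arm s) (x s) := by
  rw [ae_all_iff]
  intro s
  exact (Measure.quasiMeasurePreserving_eval (fun s => μ (arm s)) s).ae (h (arm s))

lemma measureReal_few_controls_le (i : Fin n) (M : ℕ) {ρ p : ℝ}
    (hp : ∀ᵐ x ∂(μ 1), p ≤ (μ 0).real (Metric.closedBall x ρ)) :
    (sampleLaw μ n m).real {x | Finset.card {j | dist (x (Sum.inr j)) (x (Sum.inl i)) ≤ ρ} < M}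
      ≤ 2 ^ M * Real.exp (-(m * p / 2)) := by
  have hmp := measurePreserving_sumPiEquivProdPi (fun s : Fin n ⊕ Fin m => μ (arm s))
  set T : Set ((Fin n → Cov k) × (Fin m → Cov k)) :=
    {yz | Finset.card {j | dist (yz.2 j) (yz.1 i) ≤ ρ} < M} with hT
  have hTm : MeasurableSet T := by
    have h1 : Measurable fun yz : (Fin n → Cov k) × (Fin m → Cov k) =>
        Finset.card {j | dist (yz.2 j) (yz.1 i) ≤ ρ} := by
      simp_rw [Finset.card_filter]
      refine Finset.measurable_fun_sum _ fun j _ => Measurable.ite ?_ measurable_const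
        measurable_const
      exact measurableSet_le (f := fun yz : (Fin n → Cov k) × (Fin m → Cov k) =>
        dist (yz.2 j) (yz.1 i)) (by fun_prop) measurable_const
    exact measurableSet_lt h1 measurable_const
  have hB : 0 ≤ 2 ^ M * Real.exp (-(m * p / 2)) := by positivity
  have h1 : sampleLaw μ n m {x | Finset.card {j | dist (x (Sum.inr j)) (x (Sum.inl i)) ≤ ρ} < M}
      = ((Measure.pi fun _ : Fin n => μ 1).prod (Measure.pi fun _ : Fin m => μ 0)) T :=
    hmp.measure_preimage hTm.nullMeasurableSet
  refine ENNReal.toReal_le_of_le_ofReal hB ?_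
  rw [h1, Measure.prod_apply hTm]
  have hae : ∀ᵐ y ∂(Measure.pi fun _ : Fin n => μ 1),
      (Measure.pi fun _ : Fin m => μ 0) (Prod.mk y ⁻¹' T)
        ≤ ENNReal.ofReal (2 ^ M * Real.exp (-(m * p / 2))) := by
    filter_upwards [(Measure.quasiMeasurePreserving_eval (fun _ : Fin n => μ 1) i).ae hp]
      with y hy
    rw [← ENNReal.ofReal_toReal (measure_ne_top (Measure.pi fun _ : Fin m => μ 0) _)]
    exact ENNReal.ofReal_le_ofReal (measureReal_card_lt_le m (μ 0) (q := fun z => dist z (y i) ≤ ρ)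
      Metric.isClosed_closedBall.measurableSet M hy)
  refine (lintegral_mono_ae hae).trans ?_
  simp

lemma measureReal_close_treated_le {i i' : Fin n} (hi : i ≠ i') {R u : ℝ} (hu0 : 0 ≤ u)
    (hu : ∀ᵐ x ∂(μ 1), (μ 1).real (Metric.closedBall x R) ≤ u) :
    (sampleLaw μ n m).real {x | dist (x (Sum.inl i)) (x (Sum.inl i')) ≤ R} ≤ u := by
  have hind : iIndepFun (fun (s : Fin n ⊕ Fin m) (x : Fin n ⊕ Fin m → Cov k) => x s)
      (sampleLaw μ n m) := iIndepFun_pi (X := fun _ => id) fun _ => aemeasurable_id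
  have h1 := hind.indepFun (i := Sum.inl i) (j := Sum.inl i') (by simpa using hi)
  rw [indepFun_iff_map_prod_eq_prod_map_map (measurable_pi_apply _).aemeasurable
    (measurable_pi_apply _).aemeasurable] at h1
  have hev : ∀ j : Fin n, (sampleLaw μ n m).map (fun x => x (Sum.inl j)) = μ 1 := fun j =>
    (measurePreserving_eval (fun s : Fin n ⊕ Fin m => μ (arm s)) (Sum.inl j)).map_eq
  rw [hev, hev] at h1
  have hTm : MeasurableSet {z : Cov k × Cov k | dist z.1 z.2 ≤ R} :=
    measurableSet_le (by fun_prop) measurable_const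
  refine ENNReal.toReal_le_of_le_ofReal hu0 ?_
  have h2 : sampleLaw μ n m {x | dist (x (Sum.inl i)) (x (Sum.inl i')) ≤ R}
      = ((μ 1).prod (μ 1)) {z : Cov k × Cov k | dist z.1 z.2 ≤ R} := by
    rw [← h1, Measure.map_apply (by fun_prop) hTm]; rfl
  rw [h2, Measure.prod_apply hTm]
  have hae : ∀ᵐ y ∂(μ 1), μ 1 (Prod.mk y ⁻¹' {z : Cov k × Cov k | dist z.1 z.2 ≤ R})
      ≤ ENNReal.ofReal u := by
    filter_upwards [hu] with y hy
    rw [← ENNReal.ofReal_toReal (measure_ne_top (μ 1) _)]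
    refine ENNReal.ofReal_le_ofReal (le_trans (le_of_eq ?_) hy)
    rw [measureReal_def]
    congr 2
    ext z
    simp [dist_comm]
  refine (lintegral_mono_ae hae).trans ?_
  simp

/-- Configurations of covariates in which every treated unit has at least `M` controls within
distance `ρ`, while distinct treated units are more than `R` apart. -/
def GoodConfig {n m : ℕ} (M : ℕ) (ρ R : ℝ) (x : Fin n ⊕ Fin m → Cov k) : Prop :=
  (∀ i, M ≤ Finset.card {j | dist (x (Sum.inr j)) (x (Sum.inl i)) ≤ ρ}) ∧
    ∀ i i', i ≠ i' → R < dist (x (Sum.inl i)) (x (Sum.inl i'))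

/-- The union bound over treated units without matches nearby and over close pairs of treated
units. -/
lemma measureReal_not_goodConfig_le (M : ℕ) {ρ R p u : ℝ} (hu0 : 0 ≤ u)
    (hp : ∀ᵐ x ∂(μ 1), p ≤ (μ 0).real (Metric.closedBall x ρ))
    (hu : ∀ᵐ x ∂(μ 1), (μ 1).real (Metric.closedBall x R) ≤ u) :
    (sampleLaw μ n m).real {x | ¬ GoodConfig M ρ R x} ≤
      n * (2 ^ M * Real.exp (-(m * p / 2))) + n ^ 2 * u := by
  have hsub : {x : Fin n ⊕ Fin m → Cov k | ¬ GoodConfig M ρ R x} ⊆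
      (⋃ i, {x | Finset.card {j | dist (x (Sum.inr j)) (x (Sum.inl i)) ≤ ρ} < M}) ∪
      ⋃ i, ⋃ i', {x | i ≠ i' ∧ dist (x (Sum.inl i)) (x (Sum.inl i')) ≤ R} := by
    intro x hx
    have hx' : ¬ GoodConfig M ρ R x := hx
    rw [GoodConfig, not_and_or] at hx'
    push Not at hx'
    rcases hx' with ⟨i, hi⟩ | ⟨i, i', hii, hd⟩
    · exact Or.inl (Set.mem_iUnion.2 ⟨i, hi⟩)
    · exact Or.inr (Set.mem_iUnion.2 ⟨i, Set.mem_iUnion.2 ⟨i', hii, hd⟩⟩)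
  refine (measureReal_mono hsub).trans ((measureReal_union_le _ _).trans (add_le_add ?_ ?_))
  · refine (measureReal_iUnion_fintype_le _).trans ?_
    refine (Finset.sum_le_sum fun i _ => measureReal_few_controls_le μ n m i M hp).trans ?_
    simp
  · refine (measureReal_iUnion_fintype_le _).trans ?_
    refine (Finset.sum_le_sum fun i _ => (measureReal_iUnion_fintype_le _).trans
      (Finset.sum_le_sum (g := fun _ => u) fun i' _ => ?_)).trans ?_
    · by_cases hii : i = i'
      · simp [hii, hu0]
      · simpa [hii] using measureReal_close_treated_le μ n m hii hu0 hu
    · simp only [Finset.sum_const, Finset.card_univ, Fintype.card_fin, nsmul_eq_mul]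
      exact le_of_eq (by ring)

end Configurations

/-! ### Rates -/

section Rates

variable {N₁ N₀ : ℕ → ℕ} {r θ : ℝ}

lemma tendsto_natCast_rpow_neg (hN₁ : Tendsto N₁ atTop atTop) {q : ℝ} (hq : 0 < q) :
    Tendsto (fun l => (N₁ l : ℝ) ^ (-q)) atTop (𝓝 0) :=
  (tendsto_rpow_neg_atTop hq).comp (tendsto_natCast_atTop_atTop.comp hN₁)

/-- The radius `N₁ ^ (-β)` with `2 < β k < r` is so small that the probability of two close treated
units vanishes (second term), yet so large that every treated unit finds its matches within that
radius (first term). -/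
lemma tendsto_bad_bound (hN₁ : Tendsto N₁ atTop atTop) (hN₀ : Tendsto N₀ atTop atTop) (hθ : 0 < θ)
    (hrate : Tendsto (fun l => (N₁ l : ℝ) ^ r / (N₀ l : ℝ)) atTop (𝓝 θ)) {k : ℕ}
    {β : ℝ} (hβ2 : 2 < β * k) (hβr : β * k < r) {b U κ : ℝ} (hb : 0 < b) (M : ℕ) :
    Tendsto (fun l => (N₁ l : ℝ) * (2 ^ M * Real.exp (-((N₀ l : ℝ) *
        (b * ((N₁ l : ℝ) ^ (-β)) ^ k) / 2)))
      + (N₁ l : ℝ) ^ 2 * (U * (κ * (N₁ l : ℝ) ^ (-β)) ^ k)) atTop (𝓝 0) := by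
  set a := r - β * k with ha
  have ha0 : 0 < a := by linarith
  have hcast : Tendsto (fun l => (N₁ l : ℝ)) atTop atTop := tendsto_natCast_atTop_atTop.comp hN₁
  have hpow : ∀ l, 1 ≤ N₁ l → ((N₁ l : ℝ) ^ (-β)) ^ k = (N₁ l : ℝ) ^ (-(β * k)) := by
    intro l hl
    rw [← Real.rpow_natCast, ← Real.rpow_mul (Nat.cast_nonneg _), neg_mul]
  have h1 : Tendsto (fun l => (N₁ l : ℝ) * (2 ^ M * Real.exp (-((N₀ l : ℝ) *
      (b * ((N₁ l : ℝ) ^ (-β)) ^ k) / 2)))) atTop (𝓝 0) := by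
    -- Eventually `N₁ ^ r ≤ 2 θ N₀`, so with `a = r - β k` the exponent is at most `-c N₁ ^ a`.
    set c := b / (4 * θ) with hc
    have hc0 : 0 < c := by positivity
    have hlim : Tendsto (fun l => 2 ^ M * (((N₁ l : ℝ) ^ a) ^ (1 / a) *
        Real.exp (-c * (N₁ l : ℝ) ^ a))) atTop (𝓝 0) := by
      have := ((tendsto_rpow_mul_exp_neg_mul_atTop_nhds_zero (1 / a) c hc0).comp
        ((tendsto_rpow_atTop ha0).comp hcast)).const_mul (2 ^ M)
      simpa using this
    refine squeeze_zero' (Eventually.of_forall fun l => by positivity) ?_ hlim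
    filter_upwards [hN₁.eventually_ge_atTop 1, hN₀.eventually_ge_atTop 1,
      hrate.eventually (eventually_le_nhds (show θ < 2 * θ by linarith))] with l hl hl0 hlr
    have hn : (0 : ℝ) < N₁ l := by exact_mod_cast hl
    have hm : (0 : ℝ) < N₀ l := by exact_mod_cast hl0
    rw [div_le_iff₀ hm] at hlr
    rw [← Real.rpow_mul hn.le, mul_one_div_cancel ha0.ne', Real.rpow_one, hpow l hl, mul_left_comm]
    gcongr
    have e1 : (N₁ l : ℝ) ^ a = (N₁ l : ℝ) ^ r * (N₁ l : ℝ) ^ (-(β * k)) := by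
      rw [← Real.rpow_add hn, ha, sub_eq_add_neg]
    rw [e1, hc]
    have h2 : (N₁ l : ℝ) ^ r * (N₁ l : ℝ) ^ (-(β * k)) ≤
        2 * θ * N₀ l * (N₁ l : ℝ) ^ (-(β * k)) := by gcongr
    have h3 : b / (4 * θ) * ((N₁ l : ℝ) ^ r * (N₁ l : ℝ) ^ (-(β * k)))
        ≤ b / (4 * θ) * (2 * θ * N₀ l * (N₁ l : ℝ) ^ (-(β * k))) := by gcongr
    have e2 : b / (4 * θ) * (2 * θ * N₀ l * (N₁ l : ℝ) ^ (-(β * k)))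
        = N₀ l * (b * (N₁ l : ℝ) ^ (-(β * k))) / 2 := by field_simp; ring
    linarith
  have h2 : Tendsto (fun l => (N₁ l : ℝ) ^ 2 * (U * (κ * (N₁ l : ℝ) ^ (-β)) ^ k)) atTop (𝓝 0) := by
    have h3 := (tendsto_natCast_rpow_neg hN₁ (q := β * k - 2) (by linarith)).const_mul (U * κ ^ k)
    rw [mul_zero] at h3
    refine h3.congr' ?_
    filter_upwards [hN₁.eventually_ge_atTop 1] with l hl
    have hn : (0 : ℝ) < N₁ l := by exact_mod_cast hl
    rw [mul_pow, hpow l hl, neg_sub, Real.rpow_sub hn, Real.rpow_neg hn.le, Real.rpow_two]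
    field_simp
  simpa using h1.add h2

lemma tendsto_sqrt_mul_rpow_neg (hN₁ : Tendsto N₁ atTop atTop) {β : ℝ} (hβ : 1 / 2 < β) :
    Tendsto (fun l => √(N₁ l : ℝ) * (N₁ l : ℝ) ^ (-β)) atTop (𝓝 0) := by
  refine (tendsto_natCast_rpow_neg hN₁ (q := β - 1 / 2) (by linarith)).congr' ?_
  filter_upwards [hN₁.eventually_ge_atTop 1] with l hl
  have hn : (0 : ℝ) < N₁ l := by exact_mod_cast hl
  rw [Real.sqrt_eq_rpow, ← Real.rpow_add hn]
  congr 1; ring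

end Rates

/-! ### Nearest neighbours -/

/-- The quadratic form of a positive definite matrix is comparable to the squared norm, so the
order of matching distances controls Euclidean distances up to a constant factor. -/
lemma exists_norm_le_of_matchDist_le {k : ℕ} {V : Matrix (Fin k) (Fin k) ℝ} (hV : V.PosDef) :
    ∃ κ : ℝ, 1 ≤ κ ∧ ∀ a b a' b' : Cov k, matchDist V a b ≤ matchDist V a' b' →
      dist a b ≤ κ * dist a' b' := by
  set q : Cov k → ℝ := fun z => dotProduct z.ofLp (V.mulVec z.ofLp) with hq
  have hqc : Continuous q := by
    have : Continuous fun z : Cov k => z.ofLp := PiLp.continuous_ofLp 2 _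
    rw [hq]
    simp only [dotProduct, Matrix.mulVec]
    fun_prop
  have hpos : ∀ z : Cov k, z ≠ 0 → 0 < q z := by
    intro z hz
    have := hV.dotProduct_mulVec_pos (x := z.ofLp) (by
      intro h; exact hz (by ext i; exact congrFun h i))
    simpa using this
  have hhom : ∀ (t : ℝ) (z : Cov k), q (t • z) = t ^ 2 * q z := by
    intro t z
    simp only [hq, WithLp.ofLp_smul, Matrix.mulVec_smul, smul_dotProduct, dotProduct_smul,
      smul_eq_mul]
    ring
  by_cases hne : (Metric.sphere (0 : Cov k) 1).Nonempty
  · obtain ⟨z0, hz0, hmin⟩ := (isCompact_sphere (0 : Cov k) 1).exists_isMinOn hne hqc.continuousOn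
    obtain ⟨z1, hz1, hmax⟩ := (isCompact_sphere (0 : Cov k) 1).exists_isMaxOn hne hqc.continuousOn
    have hm0 : 0 < q z0 := hpos z0 (by rintro rfl; simp at hz0)
    have hle : q z0 ≤ q z1 := hmin hz1
    have hunit : ∀ z : Cov k, z ≠ 0 → ‖z‖⁻¹ • z ∈ Metric.sphere (0 : Cov k) 1 := by
      intro z hz
      rw [mem_sphere_zero_iff_norm, norm_smul, norm_inv, norm_norm,
        inv_mul_cancel₀ (norm_ne_zero_iff.2 hz)]
    have hscale : ∀ z : Cov k, z ≠ 0 → q z = ‖z‖ ^ 2 * q (‖z‖⁻¹ • z) := by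
      intro z hz
      rw [hhom, ← mul_assoc, ← mul_pow, mul_inv_cancel₀ (norm_ne_zero_iff.2 hz), one_pow, one_mul]
    have hq0 : q 0 = 0 := by rw [hq]; simp
    have hlow : ∀ z : Cov k, ‖z‖ ^ 2 * q z0 ≤ q z := by
      intro z
      rcases eq_or_ne z 0 with rfl | hz
      · simp [hq0]
      · rw [hscale z hz]
        exact mul_le_mul_of_nonneg_left (hmin (hunit z hz)) (by positivity)
    have hupp : ∀ z : Cov k, q z ≤ ‖z‖ ^ 2 * q z1 := by
      intro z
      rcases eq_or_ne z 0 with rfl | hz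
      · simp [hq0]
      · rw [hscale z hz]
        exact mul_le_mul_of_nonneg_left (hmax (hunit z hz)) (by positivity)
    refine ⟨√(q z1 / q z0), Real.one_le_sqrt.2 ((one_le_div hm0).2 hle), fun a b a' b' h => ?_⟩
    have hq' : q (a - b) ≤ q (a' - b') := by
      have h0 : 0 ≤ q (a' - b') := le_trans (by positivity) (hlow (a' - b'))
      exact (Real.sqrt_le_sqrt_iff h0).1 h
    rw [dist_eq_norm, dist_eq_norm]
    refine le_of_sq_le_sq ?_ (by positivity)
    rw [mul_pow, Real.sq_sqrt (div_nonneg (hm0.le.trans hle) hm0.le)]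
    have h2 := ((hlow (a - b)).trans hq').trans (hupp (a' - b'))
    rw [div_mul_eq_mul_div, le_div_iff₀ hm0]
    linarith
  · refine ⟨1, le_rfl, fun a b a' b' _ => ?_⟩
    have hz : ∀ z : Cov k, z = 0 := by
      intro z
      by_contra hz
      exact hne ⟨‖z‖⁻¹ • z, by
        rw [mem_sphere_zero_iff_norm, norm_smul, norm_inv, norm_norm,
          inv_mul_cancel₀ (norm_ne_zero_iff.2 hz)]⟩
    rw [hz a, hz b, hz a', hz b']
    simp

section Neighbors

variable {k m : ℕ} (V : Matrix (Fin k) (Fin k) ℝ) (x₀ : Fin m → Cov k) (x : Cov k)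

/-- The controls that precede the control `j` when ordered by the distance from `x`. -/
noncomputable def closer (j : Fin m) : Finset (Fin m) :=
  {l : Fin m | matchDist V (x₀ l) x < matchDist V (x₀ j) x ∨
      (matchDist V (x₀ l) x = matchDist V (x₀ j) x ∧ l < j)}

lemma mem_closer {l j : Fin m} : l ∈ closer V x₀ x j ↔ matchDist V (x₀ l) x < matchDist V (x₀ j) x ∨
      (matchDist V (x₀ l) x = matchDist V (x₀ j) x ∧ l < j) := by
  simp [closer]

lemma mem_neighbors {M : ℕ} {j : Fin m} :
    j ∈ neighbors V M x₀ x ↔ (closer V x₀ x j).card < M := by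
  simp only [neighbors, Finset.mem_filter, Finset.mem_univ, true_and]
  rfl

lemma card_closer_lt_of_mem {l j : Fin m} (h : l ∈ closer V x₀ x j) :
    (closer V x₀ x l).card < (closer V x₀ x j).card := by
  refine Finset.card_lt_card ⟨fun i hi => ?_, fun hsub => ?_⟩
  · rw [mem_closer] at *
    rcases h with h | ⟨h, h'⟩ <;> rcases hi with hi | ⟨hi, hi'⟩
    · exact Or.inl (hi.trans h)
    · exact Or.inl (hi.trans_lt h)
    · exact Or.inl (hi.trans_le h.le)
    · exact Or.inr ⟨hi.trans h, hi'.trans h'⟩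
  · have := hsub h
    rw [mem_closer] at this
    simp at this

/-- Breaking ties by the index orders the controls strictly, so their ranks are distinct. -/
lemma card_closer_injective : Function.Injective fun j => (closer V x₀ x j).card := by
  intro i j hij
  by_contra hne
  have : i ∈ closer V x₀ x j ∨ j ∈ closer V x₀ x i := by
    rw [mem_closer, mem_closer]
    rcases lt_trichotomy (matchDist V (x₀ i) x) (matchDist V (x₀ j) x) with h | h | h
    · exact Or.inl (Or.inl h)
    · rcases lt_or_gt_of_ne hne with h' | h'
      · exact Or.inl (Or.inr ⟨h, h'⟩)
      · exact Or.inr (Or.inr ⟨h.symm, h'⟩)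
    · exact Or.inr (Or.inl h)
  rcases this with h | h
  · exact absurd hij (card_closer_lt_of_mem V x₀ x h).ne
  · exact absurd hij (card_closer_lt_of_mem V x₀ x h).ne'

lemma card_neighbors {M : ℕ} (hM : M ≤ m) : (neighbors V M x₀ x).card = M := by
  have hlt : ∀ j, (closer V x₀ x j).card < m := by
    intro j
    have : closer V x₀ x j ⊂ Finset.univ := by
      refine (Finset.ssubset_univ_iff).2 fun h => ?_
      have := h ▸ Finset.mem_univ j
      rw [mem_closer] at this
      simp at this
    simpa using Finset.card_lt_card this
  have himg : Finset.univ.image (fun j => (closer V x₀ x j).card) = Finset.range m := by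
    refine Finset.eq_of_subset_of_card_le (fun i hi => ?_) ?_
    · obtain ⟨j, _, rfl⟩ := Finset.mem_image.1 hi
      exact Finset.mem_range.2 (hlt j)
    · rw [Finset.card_image_of_injective _ (card_closer_injective V x₀ x)]; simp
  have h2 : (neighbors V M x₀ x).image (fun j => (closer V x₀ x j).card) = Finset.range M := by
    ext i
    rw [Finset.mem_image, Finset.mem_range]
    constructor
    · rintro ⟨j, hj, rfl⟩
      exact (mem_neighbors V x₀ x).1 hj
    · intro hi
      have : i ∈ Finset.range m := Finset.mem_range.2 (by omega)
      rw [← himg, Finset.mem_image] at this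
      obtain ⟨j, _, rfl⟩ := this
      exact ⟨j, (mem_neighbors V x₀ x).2 hi, rfl⟩
  rw [← Finset.card_image_of_injective _ (card_closer_injective V x₀ x), h2, Finset.card_range]

/-- If at least `M` controls lie within distance `ρ` of `x`, then so do the `M` nearest
neighbours, up to the factor by which the matching distance distorts Euclidean distances. -/
lemma dist_le_of_mem_neighbors {M : ℕ} {κ ρ : ℝ} (hκ0 : 0 ≤ κ) (hκ : ∀ a b a' b' : Cov k,
      matchDist V a b ≤ matchDist V a' b' → dist a b ≤ κ * dist a' b')
    (hM : M ≤ Finset.card {j | dist (x₀ j) x ≤ ρ}) {j : Fin m} (hj : j ∈ neighbors V M x₀ x) :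
    dist (x₀ j) x ≤ κ * ρ := by
  rw [mem_neighbors] at hj
  obtain ⟨l, hl, hl'⟩ : ∃ l ∈ (Finset.univ.filter fun j => dist (x₀ j) x ≤ ρ),
      l ∉ closer V x₀ x j := by
    by_contra! hcon
    exact absurd (Finset.card_le_card (show _ ⊆ closer V x₀ x j from hcon)) (by omega)
  have h1 : matchDist V (x₀ j) x ≤ matchDist V (x₀ l) x := by
    by_contra hc
    exact hl' ((mem_closer V x₀ x).2 (Or.inl (not_le.1 hc)))
  exact (hκ _ _ _ _ h1).trans (mul_le_mul_of_nonneg_left (Finset.mem_filter.1 hl).2 hκ0)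

end Neighbors

lemma measurable_effects {k n m : ℕ} (V : Matrix (Fin k) (Fin k) ℝ) (M : ℕ) (c : ℝ) :
    Measurable fun z : (Fin n → Cov k × ℝ) × (Fin m → Cov k × ℝ) => effects V M c z.1 z.2 := by
  have hd : ∀ (i : Fin n) (j : Fin m), Measurable
      fun z : (Fin n → Cov k × ℝ) × (Fin m → Cov k × ℝ) => matchDist V (z.2 j).1 (z.1 i).1 := by
    intro i j
    have hc : Continuous fun p : Cov k × Cov k => matchDist V p.1 p.2 := by
      have : Continuous fun z : Cov k => z.ofLp := PiLp.continuous_ofLp 2 _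
      unfold matchDist
      simp only [dotProduct, Matrix.mulVec]
      fun_prop
    have h1 : Measurable fun z : (Fin n → Cov k × ℝ) × (Fin m → Cov k × ℝ) => (z.2 j).1 :=
      measurable_fst.comp ((measurable_pi_apply j).comp measurable_snd)
    have h2 : Measurable fun z : (Fin n → Cov k × ℝ) × (Fin m → Cov k × ℝ) => (z.1 i).1 :=
      measurable_fst.comp ((measurable_pi_apply i).comp measurable_fst)
    have hm := hc.measurable
    have h3 := hm.comp (h1.prodMk h2)
    simpa only [Function.comp_def] using h3
  refine measurable_pi_lambda _ fun i => ?_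
  have hmem : ∀ j : Fin m, MeasurableSet {z : (Fin n → Cov k × ℝ) × (Fin m → Cov k × ℝ) |
      j ∈ neighbors V M (fun j => (z.2 j).1) (z.1 i).1} := by
    intro j
    have hcard : Measurable fun z : (Fin n → Cov k × ℝ) × (Fin m → Cov k × ℝ) =>
        (closer V (fun j => (z.2 j).1) (z.1 i).1 j).card := by
      unfold closer
      simp_rw [Finset.card_filter]
      refine Finset.measurable_fun_sum _ fun l _ => Measurable.ite ?_ measurable_const
        measurable_const
      refine (measurableSet_lt (hd i l) (hd i j)).union ?_
      exact (measurableSet_eq_fun (hd i l) (hd i j)).inter (MeasurableSet.const _)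
    simp_rw [mem_neighbors]
    exact measurableSet_lt hcard measurable_const
  have hsum : ∀ z : (Fin n → Cov k × ℝ) × (Fin m → Cov k × ℝ),
      ∑ j ∈ neighbors V M (fun j => (z.2 j).1) (z.1 i).1, (z.2 j).2
      = ∑ j, Set.indicator {z | j ∈ neighbors V M (fun j => (z.2 j).1) (z.1 i).1}
        (fun z : (Fin n → Cov k × ℝ) × (Fin m → Cov k × ℝ) => (z.2 j).2) z := by
    intro z
    refine (Finset.sum_congr rfl fun j hj => ?_).trans (Finset.sum_subset
      (Finset.subset_univ (neighbors V M (fun j => (z.2 j).1) (z.1 i).1)) fun j _ hj => ?_)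
    · rw [Set.indicator_of_mem (by exact hj)]
    · rw [Set.indicator_of_notMem (by exact hj)]
  unfold effects
  simp_rw [hsum]
  refine Measurable.sub_const (Measurable.sub (by fun_prop) (Measurable.const_mul ?_ _)) _
  exact Finset.measurable_fun_sum _ fun j _ => Measurable.indicator (by fun_prop) (hmem j)


/-! ### The matching estimator given the covariates -/

/-- The conditional moments of an outcome `g u`, with `u` uniform on the unit interval: mean `a`,
variance `s2` and fourth central moment at most `C`. -/
def HasMoments (g : unitInterval → ℝ) (a s2 C : ℝ) : Prop :=
  Integrable (fun u => (g u - a) ^ 4) ∧ ∫ u, (g u - a) = 0 ∧ ∫ u, (g u - a) ^ 2 = s2 ∧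
    ∫ u, (g u - a) ^ 4 ≤ C

/-- A population in which the covariates of arm `w` have law `μ w`, and the outcome at `x` is
`outcome w x u` with `u` uniform on the unit interval and independent of `x`. The versions `m` and
`v` of the conditional mean and variance are bounded and Lipschitz on the whole space. -/
structure MatchingModel (k : ℕ) where
  μ : Fin 2 → Measure (Cov k)
  prob : ∀ w, IsProbabilityMeasure (μ w)
  outcome : Fin 2 → Cov k → unitInterval → ℝ
  measurable_outcome : ∀ w, Measurable (Function.uncurry (outcome w))
  m : Fin 2 → Cov k → ℝ
  v : Fin 2 → Cov k → ℝ
  L : ℝ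
  D : ℝ
  C : ℝ
  lipschitz_m : ∀ w x y, |m w x - m w y| ≤ L * dist x y
  lipschitz_v : ∀ w x y, |v w x - v w y| ≤ L * dist x y
  abs_m_le : ∀ w x, |m w x| ≤ D
  v_nonneg : ∀ w x, 0 ≤ v w x
  v_le : ∀ w x, v w x ≤ D
  L_nonneg : 0 ≤ L
  C_nonneg : 0 ≤ C
  moments : ∀ w, ∀ᵐ x ∂(μ w), HasMoments (outcome w x) (m w x) (v w x) C

namespace MatchingModel

variable {k n m : ℕ} (𝓜 : MatchingModel k)

instance (w : Fin 2) : IsProbabilityMeasure (𝓜.μ w) := 𝓜.prob w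

lemma D_nonneg : 0 ≤ 𝓜.D := (abs_nonneg _).trans (𝓜.abs_m_le 0 0)

/-- The errors `Y_s - m (X_s)` of a sample with covariates `x`. -/
def error (x : Fin n ⊕ Fin m → Cov k) (s : Fin n ⊕ Fin m) (u : Fin n ⊕ Fin m → unitInterval) : ℝ :=
  𝓜.outcome (arm s) (x s) (u s) - 𝓜.m (arm s) (x s)

lemma measurable_outcome_apply (w : Fin 2) (x : Cov k) : Measurable (𝓜.outcome w x) :=
  (𝓜.measurable_outcome w).comp measurable_prodMk_left

lemma centeredErrors {x : Fin n ⊕ Fin m → Cov k}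
    (hx : ∀ s, HasMoments (𝓜.outcome (arm s) (x s)) (𝓜.m (arm s) (x s)) (𝓜.v (arm s) (x s)) 𝓜.C) :
    CenteredErrors (Measure.pi fun _ : Fin n ⊕ Fin m => (volume : Measure unitInterval))
      (𝓜.error x) (fun s => 𝓜.v (arm s) (x s)) 𝓜.C := by
  have hm : ∀ s, Measurable fun u => 𝓜.outcome (arm s) (x s) u - 𝓜.m (arm s) (x s) := fun s =>
    (𝓜.measurable_outcome_apply _ _).sub_const _
  have hev : ∀ s (f : unitInterval → ℝ), Measurable f →
      ∫ u, f (u s) ∂(Measure.pi fun _ : Fin n ⊕ Fin m => (volume : Measure unitInterval))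
        = ∫ u, f u := fun s f hf =>
    integral_comp_eval (μ := fun _ : Fin n ⊕ Fin m => (volume : Measure unitInterval))
      hf.aestronglyMeasurable
  refine ⟨iIndepFun_pi (X := fun s u => 𝓜.outcome (arm s) (x s) u - 𝓜.m (arm s) (x s))
    fun s => (hm s).aemeasurable, fun s => (hm s).comp (measurable_pi_apply s), fun s => ?_,
    fun s => ?_, fun s => ?_, fun s => ?_⟩
  · exact integrable_comp_eval (μ := fun _ : Fin n ⊕ Fin m => (volume : Measure unitInterval))
      (hx s).1
  · exact (hev s _ (hm s)).trans (hx s).2.1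
  · exact (hev s _ ((hm s).pow_const 2)).trans (hx s).2.2.1
  · exact (hev s _ ((hm s).pow_const 4)).le.trans (hx s).2.2.2

variable (V : Matrix (Fin k) (Fin k) ℝ) (M : ℕ) (c : ℝ)

/-- The matched differences `τ̂_i` of a sample with covariates `x` and uniform variables `u`. -/
noncomputable def sampleEffects (x : Fin n ⊕ Fin m → Cov k) (u : Fin n ⊕ Fin m → unitInterval) :
    Fin n → ℝ :=
  effects V M c (fun i => (x (Sum.inl i), 𝓜.outcome 1 (x (Sum.inl i)) (u (Sum.inl i))))
    (fun j => (x (Sum.inr j), 𝓜.outcome 0 (x (Sum.inr j)) (u (Sum.inr j))))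

/-- The matches of the treated unit `i`. -/
noncomputable def matchSet (x : Fin n ⊕ Fin m → Cov k) (i : Fin n) : Finset (Fin m) :=
  neighbors V M (fun j => x (Sum.inr j)) (x (Sum.inl i))

/-- The treated unit `i` together with its matches. -/
noncomputable def block (x : Fin n ⊕ Fin m → Cov k) (i : Fin n) : Finset (Fin n ⊕ Fin m) :=
  ({i} : Finset (Fin n)).disjSum (matchSet V M x i)

/-- The weight of a unit in the matched differences it enters. -/
noncomputable def weight : Fin n ⊕ Fin m → ℝ := Sum.elim (fun _ => 1) (fun _ => -(1 / (M : ℝ)))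

/-- The conditional mean of `τ̂_i` given the covariates. -/
noncomputable def center (x : Fin n ⊕ Fin m → Cov k) (i : Fin n) : ℝ :=
  𝓜.m 1 (x (Sum.inl i)) - 1 / (M : ℝ) * ∑ j ∈ matchSet V M x i, 𝓜.m 0 (x (Sum.inr j)) - c

/-- The conditional mean of `τ̂_i` if all matches were exact. -/
def gap (x : Cov k) : ℝ := 𝓜.m 1 x - 𝓜.m 0 x - c

/-- The conditional variance of `τ̂_i` if all matches were exact. -/
noncomputable def spread (x : Cov k) : ℝ := 𝓜.v 1 x + 𝓜.v 0 x / M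

lemma sum_block (x : Fin n ⊕ Fin m → Cov k) (i : Fin n) (f : Fin n ⊕ Fin m → ℝ) :
    ∑ s ∈ block V M x i, f s = f (Sum.inl i) + ∑ j ∈ matchSet V M x i, f (Sum.inr j) := by
  rw [block, Finset.sum_disjSum, Finset.sum_singleton]

/-- Matched differences as block sums of errors around their conditional means. -/
lemma sampleEffects_eq (x : Fin n ⊕ Fin m → Cov k) (u : Fin n ⊕ Fin m → unitInterval) (i : Fin n) :
    𝓜.sampleEffects V M c x u i
      = 𝓜.center V M c x i + ∑ s ∈ block V M x i, weight M s * 𝓜.error x s u := by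
  rw [sum_block, sampleEffects, effects, center, weight]
  simp only [Sum.elim_inl, Sum.elim_inr, error, arm, one_mul]
  rw [← Finset.mul_sum, Finset.sum_sub_distrib]
  simp only [matchSet]
  ring

lemma abs_weight_le (hM : 1 ≤ M) (s : Fin n ⊕ Fin m) : |weight M s| ≤ 1 := by
  have hM' : (1 : ℝ) ≤ M := by exact_mod_cast hM
  rcases s with i | j
  · simp [weight]
  · simp only [weight, Sum.elim_inr]
    rw [abs_neg, abs_of_nonneg (by positivity)]
    exact div_le_one_of_le₀ hM' (by positivity)

section Good

variable {V M} {κ ρ : ℝ} {x : Fin n ⊕ Fin m → Cov k}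

lemma card_matchSet (hx : GoodConfig M ρ (2 * (κ * ρ)) x) (i : Fin n) :
    (matchSet V M x i).card = M :=
  card_neighbors V _ _ ((hx.1 i).trans ((Finset.card_le_univ _).trans (by simp)))

lemma dist_le_of_mem_matchSet (hκ0 : 0 ≤ κ) (hκ : ∀ a b a' b' : Cov k,
      matchDist V a b ≤ matchDist V a' b' → dist a b ≤ κ * dist a' b')
    (hx : GoodConfig M ρ (2 * (κ * ρ)) x) {i : Fin n} {j : Fin m} (hj : j ∈ matchSet V M x i) :
    dist (x (Sum.inr j)) (x (Sum.inl i)) ≤ κ * ρ :=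
  dist_le_of_mem_neighbors V (fun j => x (Sum.inr j)) _ hκ0 hκ (hx.1 i) hj

lemma card_block (hx : GoodConfig M ρ (2 * (κ * ρ)) x) (i : Fin n) :
    (block V M x i).card = M + 1 := by
  rw [block, Finset.card_disjSum, Finset.card_singleton, card_matchSet hx, add_comm]

/-- No control is matched twice. -/
lemma pairwise_disjoint_block (hκ0 : 0 ≤ κ) (hκ : ∀ a b a' b' : Cov k,
      matchDist V a b ≤ matchDist V a' b' → dist a b ≤ κ * dist a' b')
    (hx : GoodConfig M ρ (2 * (κ * ρ)) x) :
    Pairwise fun i i' => Disjoint (block V M x i) (block V M x i') := by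
  intro i i' hii
  rw [Finset.disjoint_left]
  rintro (a | j) h1 h2
  · simp only [block, Finset.inl_mem_disjSum, Finset.mem_singleton] at h1 h2
    exact hii (h1.symm.trans h2)
  · simp only [block, Finset.inr_mem_disjSum] at h1 h2
    have d1 := dist_le_of_mem_matchSet hκ0 hκ hx h1
    have d2 := dist_le_of_mem_matchSet hκ0 hκ hx h2
    have d3 := dist_triangle_left (x (Sum.inl i)) (x (Sum.inl i')) (x (Sum.inr j))
    have := hx.2 i i' hii
    linarith

lemma abs_average_matchSet_sub_le (hM : 1 ≤ M) (hκ0 : 0 ≤ κ) (hκ : ∀ a b a' b' : Cov k,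
      matchDist V a b ≤ matchDist V a' b' → dist a b ≤ κ * dist a' b')
    (hx : GoodConfig M ρ (2 * (κ * ρ)) x) {f : Cov k → ℝ} {L : ℝ} (hL : 0 ≤ L)
    (hf : ∀ y z, |f y - f z| ≤ L * dist y z) (i : Fin n) :
    |1 / (M : ℝ) * ∑ j ∈ matchSet V M x i, f (x (Sum.inr j)) - f (x (Sum.inl i))|
      ≤ L * (κ * ρ) := by
  have hM' : (0 : ℝ) < M := by exact_mod_cast hM
  have e : 1 / (M : ℝ) * ∑ j ∈ matchSet V M x i, f (x (Sum.inr j)) - f (x (Sum.inl i))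
      = 1 / (M : ℝ) * ∑ j ∈ matchSet V M x i, (f (x (Sum.inr j)) - f (x (Sum.inl i))) := by
    rw [Finset.sum_sub_distrib, Finset.sum_const, card_matchSet hx, nsmul_eq_mul]
    field_simp
  rw [e, abs_mul, abs_of_pos (by positivity)]
  calc 1 / (M : ℝ) * |∑ j ∈ matchSet V M x i, (f (x (Sum.inr j)) - f (x (Sum.inl i)))|
      ≤ 1 / (M : ℝ) * ∑ _j ∈ matchSet V M x i, L * (κ * ρ) := by
        gcongr
        refine (Finset.abs_sum_le_sum_abs _ _).trans (Finset.sum_le_sum fun j hj => ?_)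
        exact (hf _ _).trans (mul_le_mul_of_nonneg_left (dist_le_of_mem_matchSet hκ0 hκ hx hj) hL)
    _ = L * (κ * ρ) := by
        rw [Finset.sum_const, card_matchSet hx, nsmul_eq_mul]
        field_simp

variable (hM : 1 ≤ M) (hκ0 : 0 ≤ κ) (hκ : ∀ a b a' b' : Cov k,
      matchDist V a b ≤ matchDist V a' b' → dist a b ≤ κ * dist a' b')
    (hx : GoodConfig M ρ (2 * (κ * ρ)) x)
include hM hκ0 hκ hx

/-- The matching bias is of the order of the matching radius. -/
lemma abs_center_sub_gap_le (i : Fin n) :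
    |𝓜.center V M c x i - 𝓜.gap c (x (Sum.inl i))| ≤ 𝓜.L * (κ * ρ) := by
  have h := abs_average_matchSet_sub_le hM hκ0 hκ hx 𝓜.L_nonneg (𝓜.lipschitz_m 0) i
  rw [abs_sub_comm] at h
  refine le_trans (le_of_eq ?_) h
  rw [center, gap]
  congr 1; ring

lemma abs_sum_block_sub_spread_le (i : Fin n) :
    |∑ s ∈ block V M x i, weight M s ^ 2 * 𝓜.v (arm s) (x s) - 𝓜.spread M (x (Sum.inl i))|
      ≤ 𝓜.L * (κ * ρ) := by
  have hM' : (1 : ℝ) ≤ M := by exact_mod_cast hM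
  have h := abs_average_matchSet_sub_le hM hκ0 hκ hx 𝓜.L_nonneg (𝓜.lipschitz_v 0) i
  have e : ∑ s ∈ block V M x i, weight M s ^ 2 * 𝓜.v (arm s) (x s) - 𝓜.spread M (x (Sum.inl i))
      = 1 / (M : ℝ) * (1 / (M : ℝ) * ∑ j ∈ matchSet V M x i, 𝓜.v 0 (x (Sum.inr j))
        - 𝓜.v 0 (x (Sum.inl i))) := by
    rw [sum_block, spread]
    simp only [weight, Sum.elim_inl, Sum.elim_inr, arm]
    rw [← Finset.mul_sum]
    field_simp
    ring
  rw [e, abs_mul, abs_of_nonneg (by positivity)]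
  exact (mul_le_of_le_one_left (abs_nonneg _)
    (div_le_one_of_le₀ hM' (by positivity))).trans h

omit hκ0 hκ in
lemma abs_center_le (i : Fin n) : |𝓜.center V M c x i| ≤ 2 * 𝓜.D + |c| := by
  have hM' : (0 : ℝ) < M := by exact_mod_cast hM
  have h1 : |1 / (M : ℝ) * ∑ j ∈ matchSet V M x i, 𝓜.m 0 (x (Sum.inr j))| ≤ 𝓜.D := by
    rw [abs_mul, abs_of_pos (by positivity)]
    calc _ ≤ 1 / (M : ℝ) * ∑ _j ∈ matchSet V M x i, 𝓜.D := by
          gcongr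
          exact (Finset.abs_sum_le_sum_abs _ _).trans (Finset.sum_le_sum fun j _ => 𝓜.abs_m_le _ _)
      _ = 𝓜.D := by
          rw [Finset.sum_const, card_matchSet hx, nsmul_eq_mul]; field_simp
  rw [center]
  have h2 := abs_sub (𝓜.m 1 (x (Sum.inl i)) - 1 / (M : ℝ) *
    ∑ j ∈ matchSet V M x i, 𝓜.m 0 (x (Sum.inr j))) c
  have h3 := abs_sub (𝓜.m 1 (x (Sum.inl i))) (1 / (M : ℝ) *
    ∑ j ∈ matchSet V M x i, 𝓜.m 0 (x (Sum.inr j)))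
  have := 𝓜.abs_m_le 1 (x (Sum.inl i))
  linarith

end Good

lemma abs_gap_le (x : Cov k) : |𝓜.gap c x| ≤ 2 * 𝓜.D + |c| := by
  rw [gap]
  have h2 := abs_sub (𝓜.m 1 x - 𝓜.m 0 x) c
  have h3 := abs_sub (𝓜.m 1 x) (𝓜.m 0 x)
  have := 𝓜.abs_m_le 1 x
  have := 𝓜.abs_m_le 0 x
  linarith

lemma spread_nonneg (x : Cov k) : 0 ≤ 𝓜.spread M x := by
  rw [spread]
  have := 𝓜.v_nonneg 1 x
  have := 𝓜.v_nonneg 0 x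
  positivity

lemma spread_le (hM : 1 ≤ M) (x : Cov k) : 𝓜.spread M x ≤ 2 * 𝓜.D := by
  have hM' : (1 : ℝ) ≤ M := by exact_mod_cast hM
  rw [spread]
  have h1 := 𝓜.v_le 1 x
  have h2 : 𝓜.v 0 x / M ≤ 𝓜.v 0 x := div_le_self (𝓜.v_nonneg 0 x) hM'
  have h3 := 𝓜.v_le 0 x
  linarith

end MatchingModel

lemma norm_exp_sub_exp_le {a b p q : ℝ} (hp : 0 ≤ p) (hq : 0 ≤ q) :
    ‖Complex.exp (a * Complex.I - p) - Complex.exp (b * Complex.I - q)‖ ≤ |a - b| + |p - q| := by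
  have hpq : ∀ {p q : ℝ}, 0 ≤ p → p ≤ q → |Real.exp (-p) - Real.exp (-q)| ≤ |p - q| := by
    intro p q hp hpq
    have h1 : Real.exp (-q) ≤ Real.exp (-p) := Real.exp_le_exp.2 (by linarith)
    rw [abs_of_nonneg (by linarith), abs_of_nonpos (by linarith)]
    have h2 := Real.add_one_le_exp (-(q - p))
    have h3 : Real.exp (-q) = Real.exp (-p) * Real.exp (-(q - p)) := by
      rw [← Real.exp_add]; congr 1; ring
    have h4 : Real.exp (-p) ≤ 1 := Real.exp_le_one_iff.2 (by linarith)
    have h5 := Real.exp_pos (-p)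
    rw [h3]
    nlinarith
  have e : Complex.exp (a * Complex.I - p) - Complex.exp (b * Complex.I - q)
      = (Real.exp (-p) : ℂ) * (Complex.exp (a * Complex.I) - Complex.exp (b * Complex.I))
        + Complex.exp (b * Complex.I) * ((Real.exp (-p) - Real.exp (-q) : ℝ) : ℂ) := by
    rw [sub_eq_add_neg (a * Complex.I), sub_eq_add_neg (b * Complex.I),
      Complex.exp_add, Complex.exp_add]
    push_cast
    ring
  rw [e]
  refine (norm_add_le _ _).trans (add_le_add ?_ ?_)
  · rw [norm_mul, Complex.norm_real, Real.norm_of_nonneg (Real.exp_pos _).le]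
    exact (mul_le_of_le_one_left (norm_nonneg _) (Real.exp_le_one_iff.2 (by linarith))).trans
      (norm_exp_mul_I_sub_le a b)
  · rw [norm_mul, Complex.norm_exp_ofReal_mul_I, one_mul, Complex.norm_real, Real.norm_eq_abs]
    rcases le_total p q with h | h
    · exact hpq hp h
    · rw [abs_sub_comm, abs_sub_comm p]; exact hpq hq h

namespace MatchingModel

section Conditional

variable {k n m : ℕ} (𝓜 : MatchingModel k) {V : Matrix (Fin k) (Fin k) ℝ} {M : ℕ} (c : ℝ)
  {κ ρ : ℝ} {x : Fin n ⊕ Fin m → Cov k}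

/-- The law of the uniform variables that drive the outcomes of a sample. -/
noncomputable abbrev noise (n m : ℕ) : Measure (Fin n ⊕ Fin m → unitInterval) :=
  Measure.pi fun _ => volume

/-- A bound for the fourth conditional moments of the matched differences. -/
noncomputable def fourthBound (M : ℕ) : ℝ :=
  8 * ((2 * 𝓜.D + |c|) ^ 4 + ((M + 1 : ℕ) : ℝ) ^ 4 * 𝓜.C)

lemma memLp_sampleEffects (hmom : ∀ s, HasMoments (𝓜.outcome (arm s) (x s)) (𝓜.m (arm s) (x s))
      (𝓜.v (arm s) (x s)) 𝓜.C) (i : Fin n) :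
    MemLp (fun u => 𝓜.sampleEffects V M c x u i) 4 (noise n m) := by
  simp_rw [sampleEffects_eq]
  exact (𝓜.centeredErrors hmom).memLp_four_block _ _

variable (hM : 1 ≤ M)
    (hx : GoodConfig M ρ (2 * (κ * ρ)) x)
    (hmom : ∀ s, HasMoments (𝓜.outcome (arm s) (x s)) (𝓜.m (arm s) (x s)) (𝓜.v (arm s) (x s)) 𝓜.C)
include hM hx hmom

lemma measureReal_four_le {η : ℝ} (hη : 0 < η) :
    (noise n m).real {u | η ≤ 1 / (n : ℝ) ^ 2 * ∑ i, 𝓜.sampleEffects V M c x u i ^ 4}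
      ≤ 1 / η * (𝓜.fourthBound c M / n) := by
  have hb : ∀ i, ∫ u, 𝓜.sampleEffects V M c x u i ^ 4 ∂(noise n m) ≤ 𝓜.fourthBound c M := by
    intro i
    simp_rw [sampleEffects_eq]
    exact (𝓜.centeredErrors hmom).integral_block_four_le _ (abs_weight_le M hM)
      (card_block hx i).le (𝓜.abs_center_le c hM hx i) 𝓜.C_nonneg
  have hi : ∀ i, Integrable (fun u => 𝓜.sampleEffects V M c x u i ^ 4) (noise n m) := by
    intro i
    have := (CenteredErrors.memLp_two_sq
      (𝓜.memLp_sampleEffects (V := V) (M := M) c hmom i)).integrable_sq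
    simpa only [← pow_mul] using this
  have hI : Integrable (fun u => 1 / (n : ℝ) ^ 2 * ∑ i, 𝓜.sampleEffects V M c x u i ^ 4)
      (noise n m) := (integrable_finsetSum _ fun i _ => hi i).const_mul _
  have h := mul_meas_ge_le_integral_of_nonneg (Eventually.of_forall fun u => by positivity) hI η
  rw [one_div_mul_eq_div, le_div_iff₀ hη, mul_comm]
  refine h.trans ?_
  rw [integral_const_mul, integral_finsetSum _ fun i _ => hi i]
  rcases Nat.eq_zero_or_pos n with rfl | hn
  · simp
  calc 1 / (n : ℝ) ^ 2 * ∑ i, ∫ u, 𝓜.sampleEffects V M c x u i ^ 4 ∂(noise n m)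
      ≤ 1 / (n : ℝ) ^ 2 * ∑ _i : Fin n, 𝓜.fourthBound c M := by
        gcongr with i; exact hb i
    _ = _ := by
        rw [Finset.sum_const, Finset.card_univ, Fintype.card_fin, nsmul_eq_mul]
        field_simp

variable (hκ0 : 0 ≤ κ) (hκ : ∀ a b a' b' : Cov k,
      matchDist V a b ≤ matchDist V a' b' → dist a b ≤ κ * dist a' b')
include hκ0 hκ

lemma integral_abs_average_sq_sub_le (hn : 0 < n) :
    ∫ u, |1 / (n : ℝ) * ∑ i, 𝓜.sampleEffects V M c x u i ^ 2
      - 1 / (n : ℝ) * ∑ i, (𝓜.gap c (x (Sum.inl i)) ^ 2 + 𝓜.spread M (x (Sum.inl i)))| ∂(noise n m)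
      ≤ √(𝓜.fourthBound c M / n) + (2 * (2 * 𝓜.D + |c|) + 1) * (𝓜.L * (κ * ρ)) := by
  have hn' : (0 : ℝ) < n := by exact_mod_cast hn
  set A := 2 * 𝓜.D + |c| with hA
  have h := (𝓜.centeredErrors hmom).integral_abs_average_block_sq_le (S := block V M x)
    (c := weight M) (a := 𝓜.center V M c x)
    (pairwise_disjoint_block hκ0 hκ hx) (abs_weight_le M hM)
    (fun i => (card_block hx i).le) (𝓜.abs_center_le c hM hx) 𝓜.C_nonneg
  simp_rw [← sampleEffects_eq] at h
  set Wt : Fin n → ℝ := fun i => ∑ s ∈ block V M x i, weight M s ^ 2 * 𝓜.v (arm s) (x s) with hWt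
  set F : (Fin n ⊕ Fin m → unitInterval) → ℝ := fun u => |1 / (n : ℝ) * ∑ i,
    (𝓜.sampleEffects V M c x u i ^ 2 - (𝓜.center V M c x i ^ 2 + Wt i))| with hF
  have hFi : Integrable F (noise n m) := by
    refine Integrable.abs (Integrable.const_mul (integrable_finsetSum _ fun i _ => ?_) _)
    exact ((CenteredErrors.memLp_two_sq
      (𝓜.memLp_sampleEffects c hmom i)).integrable (by norm_num)).sub (integrable_const _)
  have hdiff : |1 / (n : ℝ) * ∑ i, ((𝓜.center V M c x i ^ 2 + Wt i)
      - (𝓜.gap c (x (Sum.inl i)) ^ 2 + 𝓜.spread M (x (Sum.inl i))))|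
      ≤ (2 * A + 1) * (𝓜.L * (κ * ρ)) := by
    rw [abs_mul, abs_of_pos (by positivity)]
    calc _ ≤ 1 / (n : ℝ) * ∑ _i : Fin n, (2 * A + 1) * (𝓜.L * (κ * ρ)) := by
          gcongr
          refine (Finset.abs_sum_le_sum_abs _ _).trans (Finset.sum_le_sum fun i _ => ?_)
          have h1 := 𝓜.abs_center_sub_gap_le c hM hκ0 hκ hx i
          have h2 := 𝓜.abs_sum_block_sub_spread_le hM hκ0 hκ hx i
          have h3 := 𝓜.abs_center_le (V := V) c hM hx i
          have h4 := 𝓜.abs_gap_le c (x (Sum.inl i))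
          have e : (𝓜.center V M c x i ^ 2 + Wt i)
              - (𝓜.gap c (x (Sum.inl i)) ^ 2 + 𝓜.spread M (x (Sum.inl i)))
              = (𝓜.center V M c x i + 𝓜.gap c (x (Sum.inl i)))
                * (𝓜.center V M c x i - 𝓜.gap c (x (Sum.inl i)))
                + (Wt i - 𝓜.spread M (x (Sum.inl i))) := by ring
          rw [e]
          refine (abs_add_le _ _).trans ?_
          rw [abs_mul]
          have h5 := abs_add_le (𝓜.center V M c x i) (𝓜.gap c (x (Sum.inl i)))
          have h6 : |𝓜.center V M c x i + 𝓜.gap c (x (Sum.inl i))|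
              * |𝓜.center V M c x i - 𝓜.gap c (x (Sum.inl i))| ≤ (2 * A) * (𝓜.L * (κ * ρ)) :=
            mul_le_mul (by linarith) h1 (abs_nonneg _)
              (by have := (abs_nonneg _).trans h3; linarith)
          have h7 : |Wt i - 𝓜.spread M (x (Sum.inl i))| ≤ 𝓜.L * (κ * ρ) := h2
          linarith
      _ = _ := by
          rw [Finset.sum_const, Finset.card_univ, Fintype.card_fin, nsmul_eq_mul]
          field_simp
  calc _ ≤ ∫ u, (F u + (2 * A + 1) * (𝓜.L * (κ * ρ))) ∂(noise n m) := by
        refine integral_mono_of_nonneg (Eventually.of_forall fun u => abs_nonneg _)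
          (hFi.add (integrable_const _)) (Eventually.of_forall fun u => ?_)
        simp only
        have e : 1 / (n : ℝ) * ∑ i, 𝓜.sampleEffects V M c x u i ^ 2
            - 1 / (n : ℝ) * ∑ i, (𝓜.gap c (x (Sum.inl i)) ^ 2 + 𝓜.spread M (x (Sum.inl i)))
            = 1 / (n : ℝ) * ∑ i, (𝓜.sampleEffects V M c x u i ^ 2
                - (𝓜.center V M c x i ^ 2 + Wt i))
              + 1 / (n : ℝ) * ∑ i, ((𝓜.center V M c x i ^ 2 + Wt i)
                - (𝓜.gap c (x (Sum.inl i)) ^ 2 + 𝓜.spread M (x (Sum.inl i)))) := by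
          simp only [Finset.sum_sub_distrib]; ring
        rw [e]
        exact (abs_add_le _ _).trans (add_le_add le_rfl hdiff)
    _ = ∫ u, F u ∂(noise n m) + (2 * A + 1) * (𝓜.L * (κ * ρ)) := by
        rw [integral_add hFi (integrable_const _)]; simp
    _ ≤ _ := by gcongr; exact h

/-- Markov's inequality for the mean of squares, given the covariates. The last term of the bound
is a centered average over the treated covariates only. -/
lemma measureReal_average_sq_le (hn : 0 < n) (s2 : ℝ) {η : ℝ} (hη : 0 < η) :
    (noise n m).real {u | η ≤ |1 / (n : ℝ) * ∑ i, 𝓜.sampleEffects V M c x u i ^ 2 - s2|}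
      ≤ 1 / η * (√(𝓜.fourthBound c M / n) + (2 * (2 * 𝓜.D + |c|) + 1) * (𝓜.L * (κ * ρ))
        + |1 / (n : ℝ) *
          ∑ i, (𝓜.gap c (x (Sum.inl i)) ^ 2 + 𝓜.spread M (x (Sum.inl i)) - s2)|) := by
  have hn' : (0 : ℝ) < n := by exact_mod_cast hn
  have h1 := 𝓜.integral_abs_average_sq_sub_le c hM hx hmom hκ0 hκ hn
  set q := 1 / (n : ℝ) * ∑ i, (𝓜.gap c (x (Sum.inl i)) ^ 2 + 𝓜.spread M (x (Sum.inl i))) with hq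
  have hsi : Integrable (fun u => 1 / (n : ℝ) * ∑ i, 𝓜.sampleEffects V M c x u i ^ 2)
      (noise n m) :=
    (integrable_finsetSum _ fun i _ => (CenteredErrors.memLp_two_sq
      (𝓜.memLp_sampleEffects c hmom i)).integrable (by norm_num)).const_mul _
  have eq : 1 / (n : ℝ) * ∑ i, (𝓜.gap c (x (Sum.inl i)) ^ 2 + 𝓜.spread M (x (Sum.inl i)) - s2)
      = q - s2 := by
    rw [Finset.sum_sub_distrib, Finset.sum_const, Finset.card_univ, Fintype.card_fin, nsmul_eq_mul,
      hq]
    field_simp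
  have hI : Integrable (fun u => |1 / (n : ℝ) * ∑ i, 𝓜.sampleEffects V M c x u i ^ 2 - s2|)
      (noise n m) := (hsi.sub (integrable_const _)).abs
  have h := mul_meas_ge_le_integral_of_nonneg (Eventually.of_forall fun u => abs_nonneg _) hI η
  rw [eq, one_div_mul_eq_div, le_div_iff₀ hη, mul_comm]
  refine h.trans ?_
  calc _ ≤ ∫ u, (|1 / (n : ℝ) * ∑ i, 𝓜.sampleEffects V M c x u i ^ 2 - q| + |q - s2|)
          ∂(noise n m) :=
        integral_mono hI ((hsi.sub (integrable_const _)).abs.add (integrable_const _))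
          fun u => abs_sub_le _ _ _
    _ = ∫ u, |1 / (n : ℝ) * ∑ i, 𝓜.sampleEffects V M c x u i ^ 2 - q| ∂(noise n m) + |q - s2| := by
        rw [integral_add (f := fun u => |1 / (n : ℝ) * ∑ i, 𝓜.sampleEffects V M c x u i ^ 2 - q|)
          (hsi.sub (integrable_const _)).abs (integrable_const _)]
        simp
    _ ≤ _ := by gcongr

/-- Given the covariates, the characteristic function of the normalized sum is close to a product
of functions of the single treated covariates. The factor `√n` multiplies the matching bias, which
is why the radius `ρ` has to be `o(n ^ (-1/2))`. -/
lemma norm_charFun_sampleEffects_sub_le (hn : 0 < n) {t : ℝ} (ht : |t| ≤ √n) :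
    ‖∫ u, Complex.exp ((t * ((√n)⁻¹ * ∑ i, 𝓜.sampleEffects V M c x u i) : ℝ) * Complex.I)
        ∂(noise n m)
      - ∏ i, Complex.exp ((t * ((√n)⁻¹ * 𝓜.gap c (x (Sum.inl i))) : ℝ) * Complex.I
        - (t ^ 2 / (2 * n) * 𝓜.spread M (x (Sum.inl i)) : ℝ))‖
      ≤ 5 * (1 + 𝓜.C) ^ 2 * |t| ^ 3 * (M + 1 : ℕ) / √n
        + (|t| * √n + t ^ 2) * (𝓜.L * (κ * ρ)) := by
  have hn' : (0 : ℝ) < n := by exact_mod_cast hn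
  have hs : 0 < √(n : ℝ) := Real.sqrt_pos.2 hn'
  have h := (𝓜.centeredErrors hmom).norm_charFun_sum_block_sub_le (S := block V M x)
    (c := weight M) (a := 𝓜.center V M c x)
    (pairwise_disjoint_block hκ0 hκ hx) (abs_weight_le M hM)
    (fun i => (card_block hx i).le) hn ht
  simp_rw [← sampleEffects_eq] at h
  have hprod : ∏ i, Complex.exp ((t * ((√n)⁻¹ * 𝓜.gap c (x (Sum.inl i))) : ℝ) * Complex.I
        - (t ^ 2 / (2 * n) * 𝓜.spread M (x (Sum.inl i)) : ℝ))
      = Complex.exp ((t * ((√n)⁻¹ * ∑ i, 𝓜.gap c (x (Sum.inl i))) : ℝ) * Complex.I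
        - (t ^ 2 / (2 * n) * ∑ i, 𝓜.spread M (x (Sum.inl i)) : ℝ)) := by
    rw [← Complex.exp_sum, Finset.sum_sub_distrib, ← Finset.sum_mul, ← Complex.ofReal_sum,
      ← Complex.ofReal_sum, Finset.mul_sum, Finset.mul_sum, Finset.mul_sum]
  rw [hprod]
  have hLρ : ∀ f g : Fin n → ℝ, (∀ i, |f i - g i| ≤ 𝓜.L * (κ * ρ)) →
      |∑ i, f i - ∑ i, g i| ≤ n * (𝓜.L * (κ * ρ)) := by
    intro f g hfg
    rw [← Finset.sum_sub_distrib]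
    refine (Finset.abs_sum_le_sum_abs _ _).trans ((Finset.sum_le_sum fun i _ => hfg i).trans ?_)
    simp
  have h1 := hLρ _ _ (𝓜.abs_center_sub_gap_le c hM hκ0 hκ hx)
  have h2 := hLρ _ _ (𝓜.abs_sum_block_sub_spread_le hM hκ0 hκ hx)
  have hLp : 0 ≤ 𝓜.L * (κ * ρ) := (abs_nonneg _).trans
    (𝓜.abs_center_sub_gap_le c hM hκ0 hκ hx ⟨0, hn⟩)
  refine (norm_sub_le_norm_sub_add_norm_sub _ _ _).trans (add_le_add h ?_)
  refine (norm_exp_sub_exp_le ?_ ?_).trans ?_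
  · refine mul_nonneg (by positivity) (Finset.sum_nonneg fun i _ => Finset.sum_nonneg fun s _ => ?_)
    have := 𝓜.v_nonneg (arm s) (x s)
    positivity
  · exact mul_nonneg (by positivity) (Finset.sum_nonneg fun i _ => 𝓜.spread_nonneg M _)
  rw [← mul_sub, ← mul_sub, ← mul_sub, abs_mul, abs_mul, abs_mul, abs_inv, abs_of_pos hs,
    abs_of_nonneg (show 0 ≤ t ^ 2 / (2 * n) by positivity), add_mul]
  refine add_le_add ?_ ?_
  · calc _ ≤ |t| * ((√n)⁻¹ * (n * (𝓜.L * (κ * ρ)))) := by gcongr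
      _ = _ := by
        have : (n : ℝ) = √n * √n := (Real.mul_self_sqrt hn'.le).symm
        rw [mul_assoc |t|, ← mul_assoc (√n)⁻¹ (n : ℝ)]
        congr 2
        field_simp
        rw [Real.sq_sqrt hn'.le]
  · calc _ ≤ t ^ 2 / (2 * n) * (n * (𝓜.L * (κ * ρ))) := by gcongr
      _ = t ^ 2 * (𝓜.L * (κ * ρ)) / 2 := by field_simp
      _ ≤ _ := by
        have : 0 ≤ t ^ 2 * (𝓜.L * (κ * ρ)) := by positivity
        linarith

end Conditional
end MatchingModel

/-! ### Limits of the matching estimator -/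

section Product

variable {β γ : Type*} [MeasurableSpace β] [MeasurableSpace γ] {ν : Measure β} {π : Measure γ}
  [IsProbabilityMeasure ν] [IsProbabilityMeasure π]

/-- The exceptional set need not be measurable; it is replaced by its measurable hull. -/
lemma integral_le_of_ae_notMem {f g : β → ℝ} (hf0 : ∀ x, 0 ≤ f x) {K : ℝ} (hfK : ∀ x, f x ≤ K)
    {Bad : Set β} (hg : Integrable g ν) (hg0 : ∀ x, 0 ≤ g x)
    (h : ∀ᵐ x ∂ν, x ∉ Bad → f x ≤ g x) : ∫ x, f x ∂ν ≤ K * ν.real Bad + ∫ x, g x ∂ν := by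
  have hind : Integrable ((toMeasurable ν Bad).indicator fun _ => K) ν :=
    (integrable_const _).indicator (measurableSet_toMeasurable _ _)
  calc ∫ x, f x ∂ν ≤ ∫ x, ((toMeasurable ν Bad).indicator (fun _ => K) x + g x) ∂ν := by
        refine integral_mono_of_nonneg (Eventually.of_forall hf0) (hind.add hg) ?_
        filter_upwards [h] with x hx
        by_cases hxB : x ∈ toMeasurable ν Bad
        · rw [Set.indicator_of_mem hxB]
          have := hfK x
          have := hg0 x
          linarith
        · rw [Set.indicator_of_notMem hxB, zero_add]
          exact hx fun hc => hxB (subset_toMeasurable _ _ hc)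
    _ = _ := by
        rw [integral_add hind hg, integral_indicator_const _ (measurableSet_toMeasurable _ _),
          smul_eq_mul, mul_comm, measureReal_def, measure_toMeasurable, measureReal_def]

lemma measureReal_prod_le {T : Set (β × γ)} (hT : MeasurableSet T) {Bad : Set β} {g : β → ℝ}
    (hg : Integrable g ν) (hg0 : ∀ x, 0 ≤ g x)
    (h : ∀ᵐ x ∂ν, x ∉ Bad → π.real (Prod.mk x ⁻¹' T) ≤ g x) :
    (ν.prod π).real T ≤ ν.real Bad + ∫ x, g x ∂ν := by
  have h1 : (ν.prod π).real T = ∫ x, π.real (Prod.mk x ⁻¹' T) ∂ν := by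
    rw [measureReal_def, Measure.prod_apply hT, ← integral_toReal]
    · rfl
    · exact (measurable_measure_prodMk_left hT).aemeasurable
    · exact Eventually.of_forall fun x => measure_lt_top _ _
  rw [h1]
  have := integral_le_of_ae_notMem (K := 1) (fun x => measureReal_nonneg)
    (fun x => measureReal_le_one) hg hg0 h
  simpa using this

lemma norm_integral_prod_sub_le {F : β × γ → ℂ} (hF : Measurable F) (hF1 : ∀ z, ‖F z‖ ≤ 1)
    {G : β → ℂ} (hG : Measurable G) (hG1 : ∀ x, ‖G x‖ ≤ 1) {Bad : Set β} {ε : ℝ} (hε : 0 ≤ ε)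
    (h : ∀ᵐ x ∂ν, x ∉ Bad → ‖∫ y, F (x, y) ∂π - G x‖ ≤ ε) :
    ‖∫ z, F z ∂(ν.prod π) - ∫ x, G x ∂ν‖ ≤ 2 * ν.real Bad + ε := by
  have hFi : Integrable F (ν.prod π) :=
    Integrable.of_bound hF.aestronglyMeasurable 1 (Eventually.of_forall hF1)
  have hGi : Integrable G ν :=
    Integrable.of_bound hG.aestronglyMeasurable 1 (Eventually.of_forall hG1)
  rw [integral_prod _ hFi, ← integral_sub hFi.integral_prod_left hGi]
  refine (norm_integral_le_integral_norm _).trans ?_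
  have := integral_le_of_ae_notMem (f := fun x => ‖∫ y, F (x, y) ∂π - G x‖) (K := 2)
    (fun x => norm_nonneg _) (fun x => ?_) (integrable_const (μ := ν) ε) (fun _ => hε) h
  · simpa using this
  · refine (norm_sub_le _ _).trans ?_
    have h1 : ‖∫ y, F (x, y) ∂π‖ ≤ 1 := by
      refine (norm_integral_le_of_norm_le_const (Eventually.of_forall fun y => hF1 (x, y))).trans ?_
      simp
    have := hG1 x
    linarith

end Product

namespace MatchingModel

variable {k : ℕ} (𝓜 : MatchingModel k) (V : Matrix (Fin k) (Fin k) ℝ) (M : ℕ) (c : ℝ)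

lemma measurable_observations {n m : ℕ} :
    Measurable fun (z : (Fin n ⊕ Fin m → Cov k) × (Fin n ⊕ Fin m → unitInterval)) s =>
      (z.1 s, 𝓜.outcome (arm s) (z.1 s) (z.2 s)) := by
  refine measurable_pi_lambda _ fun s => ?_
  have h1 : Measurable fun z : (Fin n ⊕ Fin m → Cov k) × (Fin n ⊕ Fin m → unitInterval) =>
      (z.1 s, z.2 s) := by fun_prop
  exact (measurable_fst.comp h1).prodMk ((𝓜.measurable_outcome (arm s)).comp h1)

lemma measurable_sampleEffects {n m : ℕ} :
    Measurable fun z : (Fin n ⊕ Fin m → Cov k) × (Fin n ⊕ Fin m → unitInterval) =>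
      𝓜.sampleEffects V M c z.1 z.2 := by
  have hz := measurable_pi_iff.1 (𝓜.measurable_observations (n := n) (m := m))
  have h2 : Measurable fun z : (Fin n ⊕ Fin m → Cov k) × (Fin n ⊕ Fin m → unitInterval) =>
      ((fun i : Fin n => (z.1 (Sum.inl i), 𝓜.outcome 1 (z.1 (Sum.inl i)) (z.2 (Sum.inl i)))),
        (fun j : Fin m => (z.1 (Sum.inr j), 𝓜.outcome 0 (z.1 (Sum.inr j)) (z.2 (Sum.inr j))))) :=
    (measurable_pi_lambda _ fun i => hz (Sum.inl i)).prodMk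
      (measurable_pi_lambda _ fun j => hz (Sum.inr j))
  exact (measurable_effects V M c).comp h2

lemma measurable_m (w : Fin 2) : Measurable (𝓜.m w) := by
  have : LipschitzWith ⟨𝓜.L, 𝓜.L_nonneg⟩ (𝓜.m w) :=
    LipschitzWith.of_dist_le_mul fun x y => by rw [Real.dist_eq]; exact 𝓜.lipschitz_m w x y
  exact this.continuous.measurable

lemma measurable_v (w : Fin 2) : Measurable (𝓜.v w) := by
  have : LipschitzWith ⟨𝓜.L, 𝓜.L_nonneg⟩ (𝓜.v w) :=
    LipschitzWith.of_dist_le_mul fun x y => by rw [Real.dist_eq]; exact 𝓜.lipschitz_v w x y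
  exact this.continuous.measurable

lemma measurable_gap : Measurable (𝓜.gap c) := by
  have := 𝓜.measurable_m
  unfold gap
  fun_prop

lemma measurable_spread : Measurable (𝓜.spread M) := by
  have := 𝓜.measurable_v
  unfold spread
  fun_prop

/-- The joint law of the covariates and of the uniform variables that drive the outcomes. -/
noncomputable abbrev jointLaw (n m : ℕ) :
    Measure ((Fin n ⊕ Fin m → Cov k) × (Fin n ⊕ Fin m → unitInterval)) :=
  (sampleLaw 𝓜.μ n m).prod (noise n m)

/-- The limit variance of the normalized matching estimator. -/
noncomputable def limitVar : ℝ := ∫ x, (𝓜.gap c x ^ 2 + 𝓜.spread M x) ∂(𝓜.μ 1)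

/-- Balls centred in the support of the treated covariates have at least, respectively at most,
the order of their volume under the laws of the control and of the treated covariates. -/
structure BallBounds (ρ₀ b U : ℝ) : Prop where
  radius_pos : 0 < ρ₀
  lower_pos : 0 < b
  upper_nonneg : 0 ≤ U
  lower : ∀ᵐ x ∂(𝓜.μ 1), ∀ ρ : ℝ, 0 < ρ → ρ ≤ ρ₀ →
    b * ρ ^ k ≤ (𝓜.μ 0).real (Metric.closedBall x ρ)
  upper : ∀ᵐ x ∂(𝓜.μ 1), ∀ ρ : ℝ, 0 < ρ → (𝓜.μ 1).real (Metric.closedBall x ρ) ≤ U * ρ ^ k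

section Limits

variable {V M c} {N₁ N₀ : ℕ → ℕ} (hN₁ : Tendsto N₁ atTop atTop) {κ : ℝ} (hM : 1 ≤ M)
  (hκ0 : 0 ≤ κ) (hκ : ∀ a b a' b' : Cov k,
      matchDist V a b ≤ matchDist V a' b' → dist a b ≤ κ * dist a' b') {ρ : ℕ → ℝ}
  (hρ : Tendsto (fun l => √(N₁ l : ℝ) * ρ l) atTop (𝓝 0)) (hρ0 : ∀ l, 0 ≤ ρ l)
  (hbad : Tendsto (fun l => (sampleLaw 𝓜.μ (N₁ l) (N₀ l)).real
    {x | ¬ GoodConfig M (ρ l) (2 * (κ * ρ l)) x}) atTop (𝓝 0))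

include hN₁ in
lemma tendsto_const_div_natCast (K : ℝ) : Tendsto (fun l => K / (N₁ l : ℝ)) atTop (𝓝 0) :=
  tendsto_const_nhds.div_atTop (tendsto_natCast_atTop_atTop.comp hN₁)

include hN₁ in
lemma tendsto_sqrt_const_div_natCast (K : ℝ) :
    Tendsto (fun l => √(K / (N₁ l : ℝ))) atTop (𝓝 0) := by
  simpa using (tendsto_const_div_natCast hN₁ K).sqrt

include hN₁ hM hbad in
lemma tendsto_four {η : ℝ} (hη : 0 < η) :
    Tendsto (fun l => (𝓜.jointLaw (N₁ l) (N₀ l)).real {z | η ≤ 1 / (N₁ l : ℝ) ^ 2 *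
      ∑ i, 𝓜.sampleEffects V M c z.1 z.2 i ^ 4}) atTop (𝓝 0) := by
  have hlim := hbad.add ((tendsto_const_div_natCast hN₁ (𝓜.fourthBound c M)).const_mul (1 / η))
  rw [mul_zero, add_zero] at hlim
  refine squeeze_zero (fun _ => measureReal_nonneg) (fun l => ?_) hlim
  have hFB : 0 ≤ 𝓜.fourthBound c M := by
    have := 𝓜.C_nonneg
    have := 𝓜.D_nonneg
    unfold fourthBound; positivity
  have hT : MeasurableSet {z : (Fin (N₁ l) ⊕ Fin (N₀ l) → Cov k) ×
      (Fin (N₁ l) ⊕ Fin (N₀ l) → unitInterval) | η ≤ 1 / (N₁ l : ℝ) ^ 2 *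
      ∑ i, 𝓜.sampleEffects V M c z.1 z.2 i ^ 4} := by
    have := 𝓜.measurable_sampleEffects V M c (n := N₁ l) (m := N₀ l)
    exact measurableSet_le measurable_const (by fun_prop)
  have h := measureReal_prod_le (ν := sampleLaw 𝓜.μ (N₁ l) (N₀ l)) (π := noise (N₁ l) (N₀ l)) hT
    (Bad := {x | ¬ GoodConfig M (ρ l) (2 * (κ * ρ l)) x})
    (g := fun _ => 1 / η * (𝓜.fourthBound c M / N₁ l)) (integrable_const _)
    (fun _ => by positivity) ?_
  · simpa using h
  · filter_upwards [ae_sampleLaw 𝓜.μ (N₁ l) (N₀ l) 𝓜.moments] with x hx hxB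
    exact 𝓜.measureReal_four_le c hM (not_not.1 hxB) hx hη

include hN₁ hρ hρ0 in
lemma tendsto_radius : Tendsto ρ atTop (𝓝 0) := by
  refine squeeze_zero' (Eventually.of_forall hρ0) ?_ hρ
  filter_upwards [hN₁.eventually_ge_atTop 1] with l hl
  refine le_mul_of_one_le_left (hρ0 l) (Real.one_le_sqrt.2 ?_)
  exact_mod_cast hl

include hN₁ hM hκ0 hκ hρ hρ0 hbad in
lemma tendsto_average_sq {η : ℝ} (hη : 0 < η) :
    Tendsto (fun l => (𝓜.jointLaw (N₁ l) (N₀ l)).real {z | η ≤ |1 / (N₁ l : ℝ) *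
      ∑ i, 𝓜.sampleEffects V M c z.1 z.2 i ^ 2 - 𝓜.limitVar M c|}) atTop (𝓝 0) := by
  have hD := 𝓜.D_nonneg
  have hL := 𝓜.L_nonneg
  set A := 2 * 𝓜.D + |c| with hA
  have hA0 : 0 ≤ A := by positivity
  set q : Cov k → ℝ := fun x => 𝓜.gap c x ^ 2 + 𝓜.spread M x with hq
  have hqm : Measurable q := ((𝓜.measurable_gap c).pow_const 2).add (𝓜.measurable_spread M)
  have hqb : ∀ x, |q x| ≤ A ^ 2 + 2 * 𝓜.D := by
    intro x
    have h1 := 𝓜.abs_gap_le c x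
    have h2 := 𝓜.spread_nonneg M x
    rw [abs_of_nonneg (by positivity)]
    exact add_le_add (sq_le_sq' (abs_le.1 h1).1 (abs_le.1 h1).2) (𝓜.spread_le M hM x)
  have hrad := ((tendsto_radius hN₁ hρ hρ0).const_mul κ).const_mul 𝓜.L
  rw [mul_zero, mul_zero] at hrad
  have hlim := hbad.add ((((tendsto_sqrt_const_div_natCast hN₁ (𝓜.fourthBound c M)).add
    (hrad.const_mul (2 * A + 1))).add (tendsto_sqrt_const_div_natCast hN₁
      ((A ^ 2 + 2 * 𝓜.D) ^ 2))).const_mul (1 / η))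
  simp only [mul_zero, add_zero] at hlim
  refine squeeze_zero' (Eventually.of_forall fun _ => measureReal_nonneg) ?_ hlim
  filter_upwards [hN₁.eventually_ge_atTop 1] with l hl
  have hr := hρ0 l
  set E := √(𝓜.fourthBound c M / N₁ l) + (2 * A + 1) * (𝓜.L * (κ * ρ l)) with hE
  have hE0 : 0 ≤ E := by positivity
  have hgi : Integrable (fun x : Fin (N₁ l) ⊕ Fin (N₀ l) → Cov k =>
      |1 / (N₁ l : ℝ) * ∑ i, (q (x (Sum.inl i)) - 𝓜.limitVar M c)|)
      (sampleLaw 𝓜.μ (N₁ l) (N₀ l)) := by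
    refine Integrable.abs (Integrable.const_mul (integrable_finsetSum _ fun i _ => ?_) _)
    refine Integrable.sub ?_ (integrable_const _)
    have hqi : Measurable fun x : Fin (N₁ l) ⊕ Fin (N₀ l) → Cov k => q (x (Sum.inl i)) :=
      hqm.comp (measurable_pi_apply (Sum.inl i))
    exact Integrable.of_bound hqi.aestronglyMeasurable
      (A ^ 2 + 2 * 𝓜.D) (Eventually.of_forall fun x => hqb _)
  have hT : MeasurableSet {z : (Fin (N₁ l) ⊕ Fin (N₀ l) → Cov k) ×
      (Fin (N₁ l) ⊕ Fin (N₀ l) → unitInterval) | η ≤ |1 / (N₁ l : ℝ) *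
      ∑ i, 𝓜.sampleEffects V M c z.1 z.2 i ^ 2 - 𝓜.limitVar M c|} := by
    have := 𝓜.measurable_sampleEffects V M c (n := N₁ l) (m := N₀ l)
    exact measurableSet_le measurable_const (by fun_prop)
  have h := measureReal_prod_le (ν := sampleLaw 𝓜.μ (N₁ l) (N₀ l)) (π := noise (N₁ l) (N₀ l)) hT
    (Bad := {x | ¬ GoodConfig M (ρ l) (2 * (κ * ρ l)) x})
    (g := fun x => 1 / η * (E + |1 / (N₁ l : ℝ) * ∑ i, (q (x (Sum.inl i)) - 𝓜.limitVar M c)|))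
    (((integrable_const _).add hgi).const_mul _) (fun _ => by positivity) ?_
  · refine h.trans (add_le_add le_rfl ?_)
    rw [integral_const_mul, integral_add (integrable_const _) hgi]
    have h2 := integral_abs_average_treated_le 𝓜.μ (N₁ l) (N₀ l) hqm hqb
    simp only [integral_const, probReal_univ, one_smul]
    gcongr
    exact h2
  · filter_upwards [ae_sampleLaw 𝓜.μ (N₁ l) (N₀ l) 𝓜.moments] with x hx hxB
    exact 𝓜.measureReal_average_sq_le c hM (not_not.1 hxB) hx hκ0 hκ (by omega) _ hη

include hN₁ hM hκ0 hκ hρ hρ0 hbad in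
lemma tendsto_charFun (hnull : ∫ x, 𝓜.gap c x ∂(𝓜.μ 1) = 0) (t : ℝ) :
    Tendsto (fun l => ∫ z, Complex.exp ((t * ((√(N₁ l))⁻¹ *
        ∑ i, 𝓜.sampleEffects V M c z.1 z.2 i) : ℝ) * Complex.I) ∂(𝓜.jointLaw (N₁ l) (N₀ l))) atTop
      (𝓝 (Complex.exp (-((𝓜.limitVar M c : ℂ) * (t : ℂ) ^ 2) / 2))) := by
  have hL := 𝓜.L_nonneg
  have hC := 𝓜.C_nonneg
  have hcast : Tendsto (fun l => (N₁ l : ℝ)) atTop atTop := tendsto_natCast_atTop_atTop.comp hN₁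
  have hsq : Tendsto (fun l => √(N₁ l : ℝ)) atTop atTop := Real.tendsto_sqrt_atTop.comp hcast
  set h : ℕ → Cov k → ℂ := fun n y => Complex.exp ((t * ((√n)⁻¹ * 𝓜.gap c y) : ℝ) * Complex.I
        - (t ^ 2 / (2 * n) * 𝓜.spread M y : ℝ)) with hh
  have hgm := 𝓜.measurable_gap c
  have hsm := 𝓜.measurable_spread M
  have hhm : ∀ n, Measurable (h n) := fun n => by rw [hh]; fun_prop
  have hh1 : ∀ n y, ‖h n y‖ ≤ 1 := by
    intro n y
    rw [hh, Complex.norm_exp]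
    refine Real.exp_le_one_iff.2 ?_
    rw [Complex.sub_re, Complex.ofReal_re, Complex.re_ofReal_mul, Complex.I_re, mul_zero,
        zero_sub, neg_nonpos]
    have := 𝓜.spread_nonneg M y
    positivity
  have hlim := (tendsto_integral_exp_pow (μ := 𝓜.μ 1) hgm hsm (𝓜.abs_gap_le c)
    (𝓜.spread_nonneg M) (𝓜.spread_le M hM) hnull t).comp hN₁
  have hrad := ((tendsto_radius hN₁ hρ hρ0).const_mul κ).const_mul 𝓜.L
  rw [mul_zero, mul_zero] at hrad
  set E : ℕ → ℝ := fun l => 5 * (1 + 𝓜.C) ^ 2 * |t| ^ 3 * (M + 1 : ℕ) / √(N₁ l)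
        + (|t| * √(N₁ l) + t ^ 2) * (𝓜.L * (κ * ρ l)) with hE
  have hElim : Tendsto E atTop (𝓝 0) := by
    have h1 : Tendsto (fun l => 5 * (1 + 𝓜.C) ^ 2 * |t| ^ 3 * (M + 1 : ℕ) / √(N₁ l : ℝ)) atTop
        (𝓝 0) := tendsto_const_nhds.div_atTop hsq
    have h2 := (hρ.const_mul (|t| * 𝓜.L * κ)).add (hrad.const_mul (t ^ 2))
    rw [mul_zero, mul_zero, add_zero] at h2
    have h3 := h1.add h2
    rw [add_zero] at h3
    refine h3.congr fun l => ?_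
    rw [hE]
    ring
  have hdiff : Tendsto (fun l => ‖∫ z, Complex.exp ((t * ((√(N₁ l))⁻¹ *
        ∑ i, 𝓜.sampleEffects V M c z.1 z.2 i) : ℝ) * Complex.I) ∂(𝓜.jointLaw (N₁ l) (N₀ l))
      - (∫ y, h (N₁ l) y ∂(𝓜.μ 1)) ^ N₁ l‖) atTop (𝓝 0) := by
    have hb2 := (hbad.const_mul 2).add hElim
    rw [mul_zero, add_zero] at hb2
    refine squeeze_zero' (Eventually.of_forall fun _ => norm_nonneg _) ?_ hb2
    filter_upwards [hN₁.eventually_ge_atTop 1, hsq.eventually_ge_atTop |t|] with l hl hlt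
    have hr := hρ0 l
    rw [← integral_prod_treated 𝓜.μ (N₁ l) (N₀ l)]
    refine norm_integral_prod_sub_le ?_ ?_ ?_ ?_ ?_ ?_
    · have := 𝓜.measurable_sampleEffects V M c (n := N₁ l) (m := N₀ l)
      fun_prop
    · intro z
      rw [Complex.norm_exp_ofReal_mul_I]
    · exact Finset.measurable_fun_prod _ fun i _ => (hhm _).comp (measurable_pi_apply _)
    · intro x
      rw [norm_prod]
      exact Finset.prod_le_one (fun _ _ => norm_nonneg _) fun _ _ => hh1 _ _
    · rw [hE]; positivity
    · filter_upwards [ae_sampleLaw 𝓜.μ (N₁ l) (N₀ l) 𝓜.moments] with x hx hxB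
      exact 𝓜.norm_charFun_sampleEffects_sub_le c hM (not_not.1 hxB) hx hκ0 hκ (by omega) hlt
  have h5 := (tendsto_zero_iff_norm_tendsto_zero.2 hdiff).add hlim
  rw [zero_add] at h5
  refine h5.congr fun l => ?_
  simp only [Function.comp, hh]
  ring

end Limits

lemma tendsto_not_goodConfig {ρ₀ b U : ℝ} (hballs : 𝓜.BallBounds ρ₀ b U) {N₁ N₀ : ℕ → ℕ}
    (hN₁ : Tendsto N₁ atTop atTop) (hN₀ : Tendsto N₀ atTop atTop) {r θ : ℝ} (hθ : 0 < θ)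
    (hrate : Tendsto (fun l => (N₁ l : ℝ) ^ r / (N₀ l : ℝ)) atTop (𝓝 θ))
    {β : ℝ} (hβ0 : 0 < β) (hβ2 : 2 < β * k) (hβr : β * k < r) {κ : ℝ} (hκ : 0 < κ) :
    Tendsto (fun l => (sampleLaw 𝓜.μ (N₁ l) (N₀ l)).real
      {x | ¬ GoodConfig M ((N₁ l : ℝ) ^ (-β)) (2 * (κ * (N₁ l : ℝ) ^ (-β))) x}) atTop (𝓝 0) := by
  have hlim := tendsto_bad_bound hN₁ hN₀ hθ hrate hβ2 hβr (U := U) (κ := 2 * κ) hballs.lower_pos M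
  refine squeeze_zero' (Eventually.of_forall fun _ => measureReal_nonneg) ?_ hlim
  filter_upwards [hN₁.eventually_ge_atTop 1, (tendsto_natCast_rpow_neg hN₁ hβ0).eventually
    (eventually_le_nhds hballs.radius_pos)] with l hl hlρ
  have hn : (0 : ℝ) < N₁ l := by exact_mod_cast hl
  have hρ : 0 < (N₁ l : ℝ) ^ (-β) := Real.rpow_pos_of_pos hn _
  have hU := hballs.upper_nonneg
  rw [← mul_assoc 2 κ]
  refine measureReal_not_goodConfig_le 𝓜.μ (N₁ l) (N₀ l) M (by positivity) ?_ ?_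
  · filter_upwards [hballs.lower] with x hx
    exact hx _ hρ hlρ
  · filter_upwards [hballs.upper] with x hx
    exact hx _ (by positivity)

end MatchingModel

/-! ### Conditional laws of the outcomes -/

section Population

variable {S : Type*} [MeasurableSpace S] {k : ℕ}

/-- Conditional independence, integrated over `{X ∈ s, W = w}`. -/
lemma setIntegral_condDistrib_inter_of_condIndepFun [StandardBorelSpace S] {Q : Measure S}
    [IsProbabilityMeasure Q] {X : S → Cov k} {Z : S → ℝ} {W : S → Fin 2} (hX : Measurable X)
    (hZ : Measurable Z) (hW : Measurable W)
    (h : CondIndepFun (sigmaX X) hX.comap_le Z W Q) (w : Fin 2) {s : Set (Cov k)} {t : Set ℝ}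
    (hs : MeasurableSet s) (ht : MeasurableSet t) :
    ∫ a in X ⁻¹' s ∩ W ⁻¹' {w}, (condDistrib Z X Q (X a)).real t ∂Q
      = Q.real (X ⁻¹' s ∩ W ⁻¹' {w} ∩ Z ⁻¹' t) := by
  have hE : MeasurableSet (X ⁻¹' s) := hX hs
  have hE' : MeasurableSet[sigmaX X] (X ⁻¹' s) := ⟨s, hs, rfl⟩
  have hA : MeasurableSet (W ⁻¹' {w}) := hW (measurableSet_singleton w)
  have hB : MeasurableSet (Z ⁻¹' t) := hZ ht
  have hκ : Measurable fun x => (condDistrib Z X Q x).real t :=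
    (Kernel.measurable_coe _ ht).ennreal_toReal
  have hp : StronglyMeasurable[sigmaX X] fun a => (condDistrib Z X Q (X a)).real t :=
    (hκ.comp (comap_measurable X)).stronglyMeasurable
  have hpb : ∀ a, ‖(condDistrib Z X Q (X a)).real t‖ ≤ 1 := fun a => by
    rw [Real.norm_of_nonneg measureReal_nonneg]; exact measureReal_le_one
  have hAi : Integrable ((W ⁻¹' {w}).indicator fun _ => (1 : ℝ)) Q :=
    (integrable_const _).indicator hA
  have hApi : Integrable (((W ⁻¹' {w}).indicator fun _ => (1 : ℝ)) *
      fun a => (condDistrib Z X Q (X a)).real t) Q :=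
    hAi.mul_bdd (c := 1) (hκ.comp hX).aestronglyMeasurable (Eventually.of_forall hpb)
  have hBA : Integrable ((Z ⁻¹' t ∩ W ⁻¹' {w}).indicator fun _ => (1 : ℝ)) Q :=
    (integrable_const _).indicator (hB.inter hA)
  have h1 := condExp_mul_of_stronglyMeasurable_right (μ := Q) hp hApi hAi
  have h2 := (condIndepFun_iff_condExp_inter_preimage_eq_mul hZ hW).1 h t {w} ht
    (measurableSet_singleton w)
  have h3 := condDistrib_ae_eq_condExp (μ := Q) hX hZ ht
  calc ∫ a in X ⁻¹' s ∩ W ⁻¹' {w}, (condDistrib Z X Q (X a)).real t ∂Q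
      = ∫ a in X ⁻¹' s, (W ⁻¹' {w}).indicator (fun _ => (1 : ℝ)) a *
          (condDistrib Z X Q (X a)).real t ∂Q := by
        rw [← setIntegral_indicator hA]
        refine integral_congr_ae (Eventually.of_forall fun a => ?_)
        by_cases ha : a ∈ W ⁻¹' {w}
        · simp [Set.indicator_of_mem ha]
        · simp [Set.indicator_of_notMem ha]
    _ = ∫ a in X ⁻¹' s, (Q[((W ⁻¹' {w}).indicator fun _ => (1 : ℝ)) *
          fun a => (condDistrib Z X Q (X a)).real t | sigmaX X]) a ∂Q :=
        (setIntegral_condExp hX.comap_le hApi hE').symm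
    _ = ∫ a in X ⁻¹' s, (Q⟦Z ⁻¹' t ∩ W ⁻¹' {w} | sigmaX X⟧) a ∂Q := by
        refine integral_congr_ae (ae_restrict_of_ae ?_)
        filter_upwards [h1, h2, h3] with a h1 h2 h3
        rw [h1, h2, Pi.mul_apply, h3, mul_comm]
    _ = ∫ a in X ⁻¹' s, (Z ⁻¹' t ∩ W ⁻¹' {w}).indicator (fun _ => (1 : ℝ)) a ∂Q :=
        setIntegral_condExp hX.comap_le hBA hE'
    _ = _ := by
        rw [integral_indicator_const _ (hB.inter hA), smul_eq_mul, mul_one,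
          measureReal_restrict_apply (hB.inter hA)]
        congr 1
        ext a
        simp only [Set.mem_inter_iff]
        tauto

/-- Under conditional independence, `Z` given `X` has the same conditional law in both arms. -/
lemma map_givenW_eq_compProd_of_condIndepFun [StandardBorelSpace S] {Q : Measure S}
    [IsProbabilityMeasure Q] {X : S → Cov k} {Z : S → ℝ} {W : S → Fin 2} (hX : Measurable X)
    (hZ : Measurable Z) (hW : Measurable W)
    (h : CondIndepFun (sigmaX X) hX.comap_le Z W Q) (w : Fin 2) :
    (givenW Q W w).map (fun s => (X s, Z s))
      = ((givenW Q W w).map X) ⊗ₘ condDistrib Z X Q := by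
  have hA : MeasurableSet (W ⁻¹' {w}) := hW (measurableSet_singleton w)
  have : IsFiniteMeasure (givenW Q W w) := by unfold givenW; infer_instance
  have : IsFiniteMeasure ((givenW Q W w).map X ⊗ₘ condDistrib Z X Q) := by infer_instance
  refine Measure.ext_prod fun {s t} hs ht => ?_
  rw [Measure.compProd_apply_prod hs ht, Measure.map_apply (hX.prodMk hZ) (hs.prod ht),
    setLIntegral_map hs (Kernel.measurable_coe _ ht) hX, givenW, cond_apply hA,
    ProbabilityTheory.cond, Measure.restrict_smul, lintegral_smul_measure, smul_eq_mul,
    Measure.restrict_restrict (hX hs)]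
  congr 1
  have h1 := setIntegral_condDistrib_inter_of_condIndepFun hX hZ hW h w hs ht
  have h2 : ∫ a in X ⁻¹' s ∩ W ⁻¹' {w}, (condDistrib Z X Q (X a)).real t ∂Q
      = (∫⁻ a in X ⁻¹' s ∩ W ⁻¹' {w}, condDistrib Z X Q (X a) t ∂Q).toReal :=
    integral_toReal ((Kernel.measurable_coe _ ht).comp hX).aemeasurable
      (Eventually.of_forall fun _ => measure_lt_top _ _)
  have h3 : ∫⁻ a in X ⁻¹' s ∩ W ⁻¹' {w}, condDistrib Z X Q (X a) t ∂Q ≠ ⊤ := by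
    refine ((lintegral_mono fun a => prob_le_one).trans_lt ?_).ne
    rw [lintegral_const, one_mul]
    exact measure_lt_top _ _
  rw [← ENNReal.toReal_eq_toReal_iff' (measure_ne_top _ _) h3, ← h2, h1, measureReal_def]
  congr 2
  ext a
  simp only [Set.mem_inter_iff, Set.mem_preimage, Set.mem_prod]
  tauto

lemma ae_map_integral_condDistrib {ν : Measure S} [IsProbabilityMeasure ν] {X : S → Cov k}
    {Z : S → ℝ} (hX : Measurable X) (hZ : Measurable Z) {f : Cov k × ℝ → ℝ} (hf : Measurable f)
    (hi : Integrable (fun s => f (X s, Z s)) ν) {p : Cov k → ℝ → Prop}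
    (hp : MeasurableSet {z : Cov k × ℝ | p z.1 z.2})
    (h : ∀ᵐ s ∂ν, p (X s) ((ν[fun s => f (X s, Z s) | sigmaX X]) s)) :
    ∀ᵐ x ∂(ν.map X), p x (∫ y, f (x, y) ∂(condDistrib Z X ν x)) := by
  have hm : Measurable fun x => ∫ y, f (x, y) ∂(condDistrib Z X ν x) :=
    hf.stronglyMeasurable.integral_condDistrib.measurable
  refine (ae_map_iff hX.aemeasurable (measurable_id.prodMk hm hp)).2 ?_
  filter_upwards [h, condExp_prod_ae_eq_integral_condDistrib hX hZ.aemeasurable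
    hf.stronglyMeasurable hi] with s h1 h2
  rwa [h2] at h1

lemma pow_four_le_one_add_abs_rpow (y : ℝ) {p : ℝ} (hp : 4 ≤ p) : y ^ 4 ≤ 1 + |y| ^ p := by
  have e : y ^ 4 = |y| ^ (4 : ℝ) := by
    rw [show (4 : ℝ) = (4 : ℕ) by norm_num, Real.rpow_natCast, pow_abs,
      abs_of_nonneg (by positivity)]
  rw [e]
  rcases le_total |y| 1 with h | h
  · have h1 := Real.rpow_le_one (abs_nonneg y) h (by norm_num : (0 : ℝ) ≤ 4)
    have h2 := Real.rpow_nonneg (abs_nonneg y) p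
    linarith
  · have := Real.rpow_le_rpow_of_exponent_le h hp
    linarith

/-- The conditional moments of `Z` given `X`, read off from the conditional law. -/
lemma ae_condDistrib_moments {ν : Measure S} [IsProbabilityMeasure ν] {X : S → Cov k} {Z : S → ℝ}
    (hX : Measurable X) (hZ : Measurable Z) {m v : Cov k → ℝ} (hm : Measurable m)
    (hv : Measurable v) (hZi : Integrable Z ν)
    (hmean : ν[Z | sigmaX X] =ᵐ[ν] fun s => m (X s))
    (hvar : condVar (sigmaX X) Z ν =ᵐ[ν] fun s => v (X s)) {p C : ℝ} (hp : 4 ≤ p)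
    (hpi : Integrable (fun s => |Z s - m (X s)| ^ p) ν)
    (hC : ∀ᵐ s ∂ν, (ν[fun s => |Z s - m (X s)| ^ p | sigmaX X]) s ≤ C) :
    ∀ᵐ x ∂(ν.map X), Integrable (fun y => (y - m x) ^ 4) (condDistrib Z X ν x) ∧
      ∫ y, (y - m x) ∂(condDistrib Z X ν x) = 0 ∧
      ∫ y, (y - m x) ^ 2 ∂(condDistrib Z X ν x) = v x ∧
      ∫ y, (y - m x) ^ 4 ∂(condDistrib Z X ν x) ≤ 1 + C := by
  have hmi : Integrable (fun s => m (X s)) ν := integrable_condExp.congr hmean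
  have hmX : Measurable fun s => m (X s) := hm.comp hX
  have h4i : Integrable (fun s => (Z s - m (X s)) ^ 4) ν := by
    refine Integrable.mono' ((integrable_const 1).add hpi) (by fun_prop)
      (Eventually.of_forall fun s => ?_)
    rw [Real.norm_of_nonneg (by positivity)]
    exact pow_four_le_one_add_abs_rpow _ hp
  have h2i : Integrable (fun s => (Z s - m (X s)) ^ 2) ν := by
    refine Integrable.mono' ((integrable_const 1).add h4i) (by fun_prop)
      (Eventually.of_forall fun s => ?_)
    rw [Real.norm_of_nonneg (by positivity)]
    simp only [Pi.add_apply]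
    nlinarith [sq_nonneg ((Z s - m (X s)) ^ 2 - 1)]
  have f1 : Measurable fun z : Cov k × ℝ => z.2 - m z.1 := by fun_prop
  have c1 := ae_map_integral_condDistrib (p := fun _ r => r = 0) hX hZ f1 (hZi.sub hmi)
    (measurable_snd (measurableSet_singleton 0)) (by
      have hsm : StronglyMeasurable[sigmaX X] fun s => m (X s) :=
        (hm.comp (comap_measurable X)).stronglyMeasurable
      have e := condExp_sub (m := sigmaX X) hZi hmi
      rw [condExp_of_stronglyMeasurable hX.comap_le hsm hmi] at e
      filter_upwards [e, hmean] with s h1 h2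
      refine h1.trans ?_
      rw [Pi.sub_apply, h2, sub_self])
  have c2 := ae_map_integral_condDistrib (p := fun x r => r = v x) hX hZ (f1.pow_const 2) h2i
    (measurableSet_eq_fun measurable_snd (hv.comp measurable_fst)) (by
      have e : ν[fun s => (Z s - m (X s)) ^ 2 | sigmaX X] =ᵐ[ν] condVar (sigmaX X) Z ν := by
        refine condExp_congr_ae ?_
        filter_upwards [hmean] with s hs
        simp [hs]
      exact e.trans hvar)
  have c4 := ae_map_integral_condDistrib (p := fun _ r => r ≤ 1 + C) hX hZ (f1.pow_const 4) h4i
    (measurableSet_le measurable_snd measurable_const) (by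
      have e := condExp_mono (m := sigmaX X) h4i ((integrable_const 1).add hpi)
        (Eventually.of_forall fun s => pow_four_le_one_add_abs_rpow (Z s - m (X s)) hp)
      have e2 := condExp_add (m := sigmaX X) (integrable_const (μ := ν) (1 : ℝ)) hpi
      rw [condExp_const hX.comap_le] at e2
      filter_upwards [e, e2, hC] with s h1 h2 h3
      refine h1.trans ?_
      rw [h2, Pi.add_apply]
      linarith)
  have i4 : ∀ᵐ x ∂(ν.map X), Integrable (fun y => (y - m x) ^ 4) (condDistrib Z X ν x) := by
    refine Integrable.condDistrib_ae_map (f := fun z : Cov k × ℝ => (z.2 - m z.1) ^ 4)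
      hZ.aemeasurable ?_
    rwa [integrable_map_measure (f1.pow_const 4).aestronglyMeasurable (hX.prodMk hZ).aemeasurable]
  filter_upwards [c1, c2, c4, i4] with x h1 h2 h4 hi
  exact ⟨hi, h1, h2, h4⟩

end Population


/-! ### The matching model of a population -/

/-- McShane's extension, truncated at a bound for `f` on the compact set. -/
lemma exists_bounded_lipschitz_extension {k : ℕ} {s : Set (Cov k)} (hs : IsCompact s)
    {f : Cov k → ℝ} {K : NNReal} (hf : LipschitzOnWith K f s) :
    ∃ g : Cov k → ℝ, ∃ D : ℝ, LipschitzWith K g ∧ (∀ x, |g x| ≤ D) ∧ Set.EqOn f g s := by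
  obtain ⟨g, hg, hfg⟩ := hf.extend_real
  obtain ⟨D, hD⟩ := hs.exists_bound_of_continuousOn hf.continuousOn
  refine ⟨fun x => max (-|D|) (min |D| (g x)), |D|, (hg.const_min _).const_max _, fun x => ?_,
    fun x hx => ?_⟩
  · have := abs_nonneg D
    exact abs_le.2 ⟨le_max_left _ _, max_le (by linarith) (min_le_left _ _)⟩
  · have h1 := abs_le.1 ((hD x hx).trans (le_abs_self D))
    rw [hfg hx] at h1
    simp only [hfg hx]
    rw [min_eq_right h1.2, max_eq_right h1.1]

/-- A kernel represented by functions of an independent variable. -/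
lemma map_prod_eq_compProd {α β γ : Type*} [MeasurableSpace α] [MeasurableSpace β]
    [MeasurableSpace γ] {μ : Measure α} [SFinite μ] {π : Measure γ} [SFinite π] {κ : Kernel α β}
    [IsSFiniteKernel κ] {g : α → γ → β} (hg : Measurable (Function.uncurry g))
    (h : ∀ᵐ x ∂μ, π.map (g x) = κ x) :
    (μ.prod π).map (fun z => (z.1, g z.1 z.2)) = μ ⊗ₘ κ := by
  ext s hs
  have hm : Measurable fun z : α × γ => (z.1, g z.1 z.2) := measurable_fst.prodMk hg
  rw [Measure.map_apply hm hs, Measure.prod_apply (hm hs), Measure.compProd_apply hs]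
  refine lintegral_congr_ae ?_
  filter_upwards [h] with x hx
  have hgx : Measurable (g x) := hg.comp measurable_prodMk_left
  rw [← hx, Measure.map_apply hgx (measurable_prodMk_left hs)]
  rfl

section Population

variable {S : Type*} [MeasurableSpace S] {k : ℕ}

lemma measurable_observed {Y : Fin 2 → S → ℝ} {W : S → Fin 2} (hY : ∀ w, Measurable (Y w))
    (hW : Measurable W) : Measurable (observed Y W) := by
  have : observed Y W = fun s => if W s = 0 then Y 0 s else Y 1 s := by
    funext s
    rcases Fin.exists_fin_two.1 ⟨W s, rfl⟩ with h | h <;> simp [observed, h]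
  rw [this]
  exact Measurable.ite (hW (measurableSet_singleton 0)) (hY 0) (hY 1)

lemma isProbabilityMeasure_givenW {Q : Measure S} [IsProbabilityMeasure Q] {W : S → Fin 2}
    (hW_pos : ∀ w, Q (W ⁻¹' {w}) ≠ 0) (w : Fin 2) : IsProbabilityMeasure (givenW Q W w) :=
  cond_isProbabilityMeasure (hW_pos w)

lemma ae_givenW_eq {Q : Measure S} {W : S → Fin 2} (hW : Measurable W) (w : Fin 2) :
    ∀ᵐ s ∂(givenW Q W w), W s = w :=
  ae_cond_mem (hW (measurableSet_singleton w))

/-- The matching model `𝓜` describes the observations of the population: it has the same covariate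
laws, its outcomes have the conditional laws of the observed outcomes, and `𝓜.m` is a version of
their conditional means. -/
structure MatchingModel.Describes (𝓜 : MatchingModel k) (Q : Measure S) (Y : Fin 2 → S → ℝ)
    (X : S → Cov k) (W : S → Fin 2) [∀ w, IsFiniteMeasure (givenW Q W w)] : Prop where
  law : ∀ w, 𝓜.μ w = (givenW Q W w).map X
  outcome_law : ∀ w x,
    volume.map (𝓜.outcome w x) = condDistrib (observed Y W) X (givenW Q W w) x
  condMean : ∀ w,
    (givenW Q W w)[observed Y W | sigmaX X] =ᵐ[givenW Q W w] fun s => 𝓜.m w (X s)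

/-- The conditional laws of the observed outcomes, written as images of the uniform law, together
with bounded Lipschitz extensions of the conditional means and variances. -/
lemma exists_matchingModel {Q : Measure S} [∀ w, IsProbabilityMeasure (givenW Q W w)]
    {Y : Fin 2 → S → ℝ} {X : S → Cov k} (hY : ∀ w, Measurable (Y w)) (hX : Measurable X)
    (hW : Measurable W) (hcov : CovariateCondition Q X W) (hout : OutcomeCondition Q Y X W) :
    ∃ 𝓜 : MatchingModel k, 𝓜.Describes Q Y X W ∧
      ∃ b : ℝ, 0 < b ∧ ∀ᵐ x ∂(𝓜.μ 1), b ≤ 𝓜.v 1 x := by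
  obtain ⟨m₀, v₀, hmean, hvar, hlip, ⟨γ, hγ, C, hmom⟩, b, hb, hbv⟩ := hout
  have hZ := measurable_observed hY hW
  have hsub : ∀ w, suppX Q X W w ⊆ suppX Q X W 0 := by
    intro w
    rcases Fin.exists_fin_two.1 ⟨w, rfl⟩ with h | h <;> rw [h]
    exact hcov.support_subset
  have hsupp : ∀ w, ∀ᵐ x ∂((givenW Q W w).map X), x ∈ suppX Q X W w := fun w =>
    Measure.support_mem_ae
  have hsuppX : ∀ w, ∀ᵐ s ∂(givenW Q W w), X s ∈ suppX Q X W w := fun w =>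
    ae_of_ae_map hX.aemeasurable (hsupp w)
  have hcpt := hcov.support_compact 0
  have harm : ∀ w, ∃ (g : Cov k → unitInterval → ℝ) (m v : Cov k → ℝ) (K : NNReal) (D : ℝ),
      Measurable (Function.uncurry g) ∧ LipschitzWith K m ∧ LipschitzWith K v ∧
      (∀ x, |m x| ≤ D) ∧ (∀ x, 0 ≤ v x) ∧ (∀ x, v x ≤ D) ∧
      (∀ᵐ x ∂((givenW Q W w).map X), HasMoments (g x) (m x) (v x) (1 + |C|)) ∧
      (∀ x, volume.map (g x) = condDistrib (observed Y W) X (givenW Q W w) x) ∧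
      ((givenW Q W w)[observed Y W | sigmaX X] =ᵐ[givenW Q W w] fun s => m (X s)) ∧
      ∀ᵐ x ∂((givenW Q W w).map X), b ≤ v x := by
    intro w
    obtain ⟨⟨Km, hKm⟩, ⟨Kv, hKv⟩⟩ := hlip w
    obtain ⟨m, Dm, hm, hmD, hmeq⟩ := exists_bounded_lipschitz_extension hcpt hKm
    obtain ⟨v, Dv, hv, hvD, hveq⟩ := exists_bounded_lipschitz_extension hcpt hKv
    obtain ⟨g, hg, hgκ⟩ := Kernel.exists_measurable_map_eq_unitInterval
      (condDistrib (observed Y W) X (givenW Q W w))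
    -- The extension of the variance may be negative off the support of arm `w`.
    have hv' : LipschitzWith Kv fun x => max 0 (v x) := hv.const_max 0
    have hvb : ∀ x ∈ suppX Q X W w, v₀ w x = max 0 (v x) := fun x hx => by
      have h1 := hbv w x hx
      rw [hveq (hsub w hx)] at h1 ⊢
      exact (max_eq_right (hb.le.trans h1)).symm
    have hmean' : (givenW Q W w)[observed Y W | sigmaX X] =ᵐ[givenW Q W w] fun s => m (X s) := by
      filter_upwards [(hmean w).2, hsuppX w] with s h1 h2
      rw [h1, hmeq (hsub w h2)]
    have herr : (fun s => |errorTerm Y X W m₀ s| ^ (4 + γ)) =ᵐ[givenW Q W w]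
        fun s => |observed Y W s - m (X s)| ^ (4 + γ) := by
      filter_upwards [hsuppX w, ae_givenW_eq hW w] with s h1 h2
      rw [errorTerm, h2, hmeq (hsub w h1)]
    have hmoments := ae_condDistrib_moments (ν := givenW Q W w) hX hZ hm.continuous.measurable
      hv'.continuous.measurable (hmean w).1 hmean'
      (by
        filter_upwards [hvar w, hsuppX w] with s h1 h2
        rw [h1, hvb _ h2])
      (p := 4 + γ) (C := |C|) (by linarith) ((hmom w).1.congr herr)
      (by
        filter_upwards [(hmom w).2, condExp_congr_ae (m := sigmaX X) herr] with s h1 h2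
        rw [← h2]
        exact h1.trans (le_abs_self C))
    refine ⟨g, m, fun x => max 0 (v x), max Km Kv, max Dm (max 0 Dv), hg,
      hm.weaken (le_max_left _ _),
      hv'.weaken (le_max_right _ _), fun x => (hmD x).trans (le_max_left _ _),
      fun x => le_max_left _ _, fun x => (max_le_max le_rfl ((le_abs_self _).trans (hvD x))).trans
        (le_max_right _ _), ?_, hgκ, hmean', ?_⟩
    · filter_upwards [hmoments] with x hx
      have hgx : AEMeasurable (g x) volume := (hg.comp measurable_prodMk_left).aemeasurable
      rw [← hgκ x] at hx
      have hp : ∀ j : ℕ, AEStronglyMeasurable (fun y => (y - m x) ^ j) (volume.map (g x)) :=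
        fun j => by fun_prop
      have hp1 : AEStronglyMeasurable (fun y => y - m x) (volume.map (g x)) := by fun_prop
      rw [integrable_map_measure (hp 4) hgx, integral_map hgx hp1, integral_map hgx (hp 2),
        integral_map hgx (hp 4)] at hx
      exact hx
    · filter_upwards [hsupp w] with x hx
      rw [← hvb x hx]
      exact hbv w x hx
  choose g m v K D hg hm hv hmD hv0 hvD hmoments hlaw hmean' hvb using harm
  have hle : ∀ {f : Fin 2 → ℝ}, (∀ w, 0 ≤ f w) → ∀ w, f w ≤ f 0 + f 1 := by
    intro f hf w
    rcases Fin.exists_fin_two.1 ⟨w, rfl⟩ with h | h <;> rw [h]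
    · linarith [hf 1]
    · linarith [hf 0]
  have hD0 : ∀ w, 0 ≤ D w := fun w => (abs_nonneg _).trans (hmD w 0)
  have hK0 : ∀ w, 0 ≤ (K w : ℝ) := fun w => (K w).2
  have hlip' : ∀ {f : Cov k → ℝ} {w : Fin 2}, LipschitzWith (K w) f → ∀ x y,
      |f x - f y| ≤ ((K 0 : ℝ) + K 1) * dist x y := fun {f w} hf x y => by
    rw [← Real.dist_eq]
    exact (hf.dist_le_mul x y).trans
      (mul_le_mul_of_nonneg_right (hle hK0 w) dist_nonneg)
  exact ⟨{  μ := fun w => (givenW Q W w).map X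
            prob := fun w => Measure.isProbabilityMeasure_map hX.aemeasurable
            outcome := g
            measurable_outcome := hg
            m := m
            v := v
            L := K 0 + K 1
            D := D 0 + D 1
            C := 1 + |C|
            lipschitz_m := fun w => hlip' (hm w)
            lipschitz_v := fun w => hlip' (hv w)
            abs_m_le := fun w x => (hmD w x).trans (hle hD0 w)
            v_nonneg := hv0
            v_le := fun w x => (hvD w x).trans (hle hD0 w)
            L_nonneg := add_nonneg (hK0 0) (hK0 1)
            C_nonneg := by positivity
            moments := hmoments }, ⟨fun _ => rfl, hlaw, hmean'⟩, b, hb, hvb 1⟩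

end Population

/-! ### Ball probabilities, the null hypothesis and the limit variance -/

section Population

variable {S : Type*} [MeasurableSpace S] {k : ℕ} {Q : Measure S} {X : S → Cov k} {W : S → Fin 2}

lemma measurableSet_suppX (w : Fin 2) : MeasurableSet (suppX Q X W w) :=
  Measure.isClosed_support.measurableSet

lemma map_givenW_one_le_inter_suppX (s : Set (Cov k)) :
    (givenW Q W 1).map X s ≤ (givenW Q W 1).map X (s ∩ suppX Q X W 1) :=
  (measure_inter_conull' (measure_mono_null Set.inter_subset_right
    Measure.measure_compl_support)).ge

lemma mul_volume_le_map_givenW_zero {f : Fin 2 → Cov k → ℝ} (hf : IsDensity Q X W f) {b : ℝ}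
    (hb : ∀ x ∈ suppX Q X W 1, b ≤ f 0 x) {s : Set (Cov k)} (hs : MeasurableSet s) :
    ENNReal.ofReal b * volume (s ∩ suppX Q X W 1) ≤ (givenW Q W 0).map X s := by
  have hm := hs.inter (measurableSet_suppX (Q := Q) (X := X) (W := W) 1)
  calc ENNReal.ofReal b * volume (s ∩ suppX Q X W 1)
      = ∫⁻ _x in s ∩ suppX Q X W 1, ENNReal.ofReal b := (setLIntegral_const _ _).symm
    _ ≤ ∫⁻ x in s ∩ suppX Q X W 1, ENNReal.ofReal (f 0 x) :=
        setLIntegral_mono' hm fun x hx => ENNReal.ofReal_le_ofReal (hb x hx.2)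
    _ = (givenW Q W 0).map X (s ∩ suppX Q X W 1) := by rw [(hf 0).2.2, withDensity_apply _ hm]
    _ ≤ _ := measure_mono Set.inter_subset_left

/-- Overlap: the control density is positive on the support of the treated covariates. Hence facts
that hold for almost every control covariate hold for almost every treated one. -/
lemma map_givenW_one_absolutelyContinuous (hcov : CovariateCondition Q X W) :
    (givenW Q W 1).map X ≪ (givenW Q W 0).map X := by
  obtain ⟨f, hf, -, -, b, hb, hfb⟩ := hcov.density
  refine Measure.AbsolutelyContinuous.mk fun s hs h0 => ?_
  have h1 := mul_volume_le_map_givenW_zero hf hfb hs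
  rw [h0, nonpos_iff_eq_zero, mul_eq_zero, ENNReal.ofReal_eq_zero] at h1
  have h2 : volume (s ∩ suppX Q X W 1) = 0 := h1.resolve_left (not_le.2 hb)
  refine le_antisymm ((map_givenW_one_le_inter_suppX s).trans ?_) zero_le
  rw [(hf 1).2.2]
  exact (withDensity_absolutelyContinuous _ _ h2).le

lemma volume_closedBall_cov (x : Cov k) {ρ : ℝ} (hρ : 0 ≤ ρ) :
    volume (Metric.closedBall x ρ)
      = ENNReal.ofReal (ρ ^ k * volume.real (Metric.ball (0 : Cov k) 1)) := by
  rw [Measure.addHaar_closedBall _ _ hρ, ENNReal.ofReal_mul (by positivity),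
    finrank_euclideanSpace_fin, ofReal_measureReal measure_ball_lt_top.ne]

/-- The lower bound combines the lower bound of the control density with the fraction of the ball
that lies in the support of the treated covariates;
the upper bound needs only the treated density. -/
lemma MatchingModel.exists_ballBounds {𝓜 : MatchingModel k}
    (hμ : ∀ w, 𝓜.μ w = (givenW Q W w).map X) (hcov : CovariateCondition Q X W) :
    ∃ ρ₀ b U, 𝓜.BallBounds ρ₀ b U := by
  obtain ⟨f, hf, -, ⟨C, hC⟩, b, hb, hfb⟩ := hcov.density
  obtain ⟨φ, hφ, ρ₀, hρ₀, hball⟩ := hcov.ball_fraction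
  set c := volume.real (Metric.ball (0 : Cov k) 1) with hc
  have hc0 : 0 < c := ENNReal.toReal_pos (Metric.measure_ball_pos _ _ one_pos).ne'
    measure_ball_lt_top.ne
  have hsupp : ∀ᵐ x ∂(𝓜.μ 1), x ∈ suppX Q X W 1 := by
    rw [hμ 1]; exact Measure.support_mem_ae
  refine ⟨ρ₀, b * (φ * c), |C| * c, hρ₀, by positivity, by positivity, ?_, ?_⟩
  · filter_upwards [hsupp] with x hx ρ h0 h1
    have h2 := mul_volume_le_map_givenW_zero hf hfb
      (Metric.isClosed_closedBall (x := x) (ε := ρ)).measurableSet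
    have h3 := (mul_le_mul_right (hball x hx ρ h0 h1) (ENNReal.ofReal b)).trans h2
    rw [volume_closedBall_cov x h0.le, ← ENNReal.ofReal_mul hφ.le, ← ENNReal.ofReal_mul hb.le,
      ← hμ 0] at h3
    rw [measureReal_def]
    refine le_trans (le_of_eq ?_) ((ENNReal.ofReal_le_iff_le_toReal (measure_ne_top _ _)).1 h3)
    ring
  · refine Eventually.of_forall fun x ρ h0 => ?_
    rw [measureReal_def, hμ 1]
    refine ENNReal.toReal_le_of_le_ofReal (by positivity) ?_
    have hm := (Metric.isClosed_closedBall (x := x) (ε := ρ)).measurableSet.inter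
      (measurableSet_suppX (Q := Q) (X := X) (W := W) 1)
    calc (givenW Q W 1).map X (Metric.closedBall x ρ)
        ≤ (givenW Q W 1).map X (Metric.closedBall x ρ ∩ suppX Q X W 1) :=
          map_givenW_one_le_inter_suppX _
      _ = ∫⁻ y in Metric.closedBall x ρ ∩ suppX Q X W 1, ENNReal.ofReal (f 1 y) := by
          rw [(hf 1).2.2, withDensity_apply _ hm]
      _ ≤ ∫⁻ _y in Metric.closedBall x ρ ∩ suppX Q X W 1, ENNReal.ofReal |C| :=
          setLIntegral_mono' hm fun y hy =>
            ENNReal.ofReal_le_ofReal ((hC 1 y hy.2).trans (le_abs_self C))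
      _ = ENNReal.ofReal |C| * volume (Metric.closedBall x ρ ∩ suppX Q X W 1) :=
          setLIntegral_const _ _
      _ ≤ ENNReal.ofReal |C| * volume (Metric.closedBall x ρ) := by
          gcongr; exact Set.inter_subset_left
      _ = ENNReal.ofReal (|C| * c * ρ ^ k) := by
          rw [volume_closedBall_cov x h0.le, ← ENNReal.ofReal_mul (abs_nonneg C)]
          congr 1; ring

lemma HasMoments.integral_abs_le {g : unitInterval → ℝ} {a s2 C : ℝ} (hg : Measurable g)
    (h : HasMoments g a s2 C) : Integrable (fun u => g u - a) ∧ ∫ u, |g u - a| ≤ 1 + C := by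
  have hp : ∀ y : ℝ, |y| ≤ 1 + y ^ 4 := fun y => by
    have h1 : 0 ≤ |y| := abs_nonneg y
    have h2 : y ^ 4 = |y| ^ 4 := by rw [pow_abs, abs_of_nonneg (by positivity)]
    rw [h2]
    nlinarith [sq_nonneg (|y| ^ 2 - 1), sq_nonneg (|y| - 1)]
  have hi : Integrable (fun u => g u - a) :=
    Integrable.mono' ((integrable_const 1).add h.1) (hg.sub_const a).aestronglyMeasurable
      (Eventually.of_forall fun u => hp _)
  refine ⟨hi, (integral_mono hi.abs ((integrable_const 1).add h.1) fun u => hp _).trans ?_⟩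
  rw [integral_add' (integrable_const 1) h.1]
  simpa using h.2.2.2

/-- Under the null hypothesis the conditional means of the arms differ by `c` on average over the
treated covariates. Conditional independence enters here: it makes the mean of `Y(0)` of a treated
unit with covariate `x` equal to the mean outcome of a control unit with covariate `x`. -/
lemma MatchingModel.integral_gap_eq_zero [StandardBorelSpace S] [IsProbabilityMeasure Q]
    [∀ w, IsProbabilityMeasure (givenW Q W w)] {𝓜 : MatchingModel k} {Y : Fin 2 → S → ℝ}
    (hdesc : 𝓜.Describes Q Y X W)
    (hY : ∀ w, Measurable (Y w)) (hX : Measurable X) (hW : Measurable W)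
    (hCIA : CondIndepFun (sigmaX X) hX.comap_le (Y 0) W Q) (hcov : CovariateCondition Q X W)
    (hint : Integrable (observed Y W) (givenW Q W 1))
    {c : ℝ} (hnull : att Q Y W = c) : ∫ x, 𝓜.gap c x ∂(𝓜.μ 1) = 0 := by
  -- The conditional moments of `Y(0)` are known for almost every control covariate only.
  have hAC : 𝓜.μ 1 ≪ 𝓜.μ 0 := by
    rw [hdesc.law, hdesc.law]; exact map_givenW_one_absolutelyContinuous hcov
  have hg := 𝓜.measurable_outcome 0
  have hm := 𝓜.measurable_m
  have hmi : ∀ w, Integrable (𝓜.m w) (𝓜.μ 1) := fun w =>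
    Integrable.of_bound (hm w).aestronglyMeasurable 𝓜.D (Eventually.of_forall (𝓜.abs_m_le w))
  have hmap : ∀ w, ∫ s, 𝓜.m w (X s) ∂(givenW Q W 1) = ∫ x, 𝓜.m w x ∂(𝓜.μ 1) := fun w => by
    rw [hdesc.law, integral_map hX.aemeasurable (hm w).aestronglyMeasurable]
  have hmiX : ∀ w, Integrable (fun s => 𝓜.m w (X s)) (givenW Q W 1) := fun w => by
    have := hmi w
    rw [hdesc.law] at this
    exact this.comp_measurable hX
  have hκ : ∀ᵐ x ∂(𝓜.μ 0), volume.map (𝓜.outcome 0 x) = condDistrib (Y 0) X Q x := by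
    have e : (givenW Q W 0).map (fun s => (X s, observed Y W s))
        = ((givenW Q W 0).map X) ⊗ₘ condDistrib (Y 0) X Q := by
      rw [← map_givenW_eq_compProd_of_condIndepFun hX (hY 0) hW hCIA 0]
      refine Measure.map_congr ?_
      filter_upwards [ae_givenW_eq hW 0] with s hs
      rw [observed, hs]
    rw [hdesc.law]
    filter_upwards [condDistrib_ae_eq_of_measure_eq_compProd X
      (measurable_observed hY hW).aemeasurable e] with x hx
    rw [hdesc.outcome_law, hx]
  have hlaw : (givenW Q W 1).map (fun s => (X s, Y 0 s))
      = ((𝓜.μ 1).prod (volume : Measure unitInterval)).map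
          fun z => (z.1, 𝓜.outcome 0 z.1 z.2) := by
    rw [map_givenW_eq_compProd_of_condIndepFun hX (hY 0) hW hCIA 1, ← hdesc.law]
    exact (map_prod_eq_compProd hg (hAC hκ)).symm
  have hmom := hAC (𝓜.moments 0)
  have hf : Measurable fun z : Cov k × ℝ => z.2 - 𝓜.m 0 z.1 := by fun_prop
  have hpm : Measurable fun z : Cov k × unitInterval => (z.1, 𝓜.outcome 0 z.1 z.2) :=
    measurable_fst.prodMk hg
  have hprod : Integrable (fun z : Cov k × unitInterval => 𝓜.outcome 0 z.1 z.2 - 𝓜.m 0 z.1)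
      ((𝓜.μ 1).prod volume) := by
    have hsm : StronglyMeasurable
        (fun z : Cov k × unitInterval => 𝓜.outcome 0 z.1 z.2 - 𝓜.m 0 z.1) :=
      (hf.comp hpm).stronglyMeasurable
    rw [integrable_prod_iff hsm.aestronglyMeasurable]
    refine ⟨?_, Integrable.of_bound hsm.norm.integral_prod_right.aestronglyMeasurable
      (1 + 𝓜.C) ?_⟩
    · filter_upwards [hmom] with x hx
      exact (hx.integral_abs_le (𝓜.measurable_outcome_apply 0 x)).1
    · filter_upwards [hmom] with x hx
      rw [Real.norm_of_nonneg (integral_nonneg fun _ => norm_nonneg _)]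
      exact (hx.integral_abs_le (𝓜.measurable_outcome_apply 0 x)).2
  have hXY : Measurable fun s => (X s, Y 0 s) := hX.prodMk (hY 0)
  have hdi : Integrable (fun s => Y 0 s - 𝓜.m 0 (X s)) (givenW Q W 1) := by
    have h1 := (integrable_map_measure hf.aestronglyMeasurable hpm.aemeasurable).2 hprod
    rw [← hlaw] at h1
    exact h1.comp_measurable hXY
  have hd0 : ∫ s, (Y 0 s - 𝓜.m 0 (X s)) ∂(givenW Q W 1) = 0 := by
    have h1 := integral_map (μ := givenW Q W 1) hXY.aemeasurable hf.aestronglyMeasurable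
    rw [hlaw, integral_map hpm.aemeasurable hf.aestronglyMeasurable, integral_prod _ hprod] at h1
    rw [← h1]
    refine integral_eq_zero_of_ae ?_
    filter_upwards [hmom] with x hx
    exact hx.2.1
  have hY0 : Integrable (Y 0) (givenW Q W 1) := by
    refine (hdi.add (hmiX 0)).congr (Eventually.of_forall fun s => ?_)
    simp
  have hY0e : ∫ s, Y 0 s ∂(givenW Q W 1) = ∫ x, 𝓜.m 0 x ∂(𝓜.μ 1) := by
    rw [integral_sub hY0 (hmiX 0), hmap 0, sub_eq_zero] at hd0
    exact hd0
  have hobs : Y 1 =ᵐ[givenW Q W 1] observed Y W := by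
    filter_upwards [ae_givenW_eq hW 1] with s hs
    rw [observed, hs]
  have hY1 : Integrable (Y 1) (givenW Q W 1) := hint.congr hobs.symm
  have hY1e : ∫ s, Y 1 s ∂(givenW Q W 1) = ∫ x, 𝓜.m 1 x ∂(𝓜.μ 1) := by
    rw [integral_congr_ae hobs, ← integral_condExp hX.comap_le,
      integral_congr_ae (hdesc.condMean 1), hmap 1]
  rw [att, integral_sub hY1 hY0, hY0e, hY1e] at hnull
  unfold gap
  rw [integral_sub (f := fun x => 𝓜.m 1 x - 𝓜.m 0 x) ((hmi 1).sub (hmi 0)) (integrable_const c),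
    integral_sub (hmi 1) (hmi 0), hnull]
  simp

lemma MatchingModel.limitVar_pos {𝓜 : MatchingModel k} {b : ℝ} (hb : 0 < b)
    (h : ∀ᵐ x ∂(𝓜.μ 1), b ≤ 𝓜.v 1 x) {M : ℕ} (hM : 1 ≤ M) (c : ℝ) : 0 < 𝓜.limitVar M c := by
  have hgm := 𝓜.measurable_gap c
  have hsm := 𝓜.measurable_spread M
  have hi : Integrable (fun x => 𝓜.gap c x ^ 2 + 𝓜.spread M x) (𝓜.μ 1) := by
    refine Integrable.of_bound (by fun_prop) ((2 * 𝓜.D + |c|) ^ 2 + 2 * 𝓜.D)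
      (Eventually.of_forall fun x => ?_)
    have h1 := abs_le.1 (𝓜.abs_gap_le c x)
    have h2 := 𝓜.spread_nonneg M x
    rw [Real.norm_of_nonneg (by positivity)]
    exact add_le_add (sq_le_sq' h1.1 h1.2) (𝓜.spread_le M hM x)
  have h3 : ∫ _x, b ∂(𝓜.μ 1) ≤ 𝓜.limitVar M c := by
    refine integral_mono_ae (integrable_const b) hi ?_
    filter_upwards [h] with x hx
    have h4 : 0 ≤ 𝓜.v 0 x / M := div_nonneg (𝓜.v_nonneg 0 x) (by positivity)
    rw [spread]
    nlinarith [sq_nonneg (𝓜.gap c x)]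
  rw [integral_const, probReal_univ, one_smul] at h3
  exact hb.trans_le h3

end Population


/-! ### The law of the sample of matched differences -/

namespace MatchingModel

variable {S : Type*} [MeasurableSpace S] {k : ℕ} {𝓜 : MatchingModel k}

lemma map_jointLaw_eq_pi {D : Fin 2 → Measure (Cov k × ℝ)}
    (hD : ∀ w, ((𝓜.μ w).prod (volume : Measure unitInterval)).map
      (fun z => (z.1, 𝓜.outcome w z.1 z.2)) = D w) (n m : ℕ) :
    (𝓜.jointLaw n m).map (fun z s => (z.1 s, 𝓜.outcome (arm s) (z.1 s) (z.2 s)))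
      = Measure.pi fun s : Fin n ⊕ Fin m => D (arm s) := by
  have hh : ∀ w, Measurable fun z : Cov k × unitInterval => (z.1, 𝓜.outcome w z.1 z.2) :=
    fun w => measurable_fst.prodMk (𝓜.measurable_outcome w)
  have hm : ∀ w, IsProbabilityMeasure (((𝓜.μ w).prod (volume : Measure unitInterval)).map
      fun z => (z.1, 𝓜.outcome w z.1 z.2)) := fun w =>
    Measure.isProbabilityMeasure_map (hh w).aemeasurable
  have e := measurePreserving_arrowProdEquivProdArrow (Cov k) unitInterval (Fin n ⊕ Fin m)
    (fun s => 𝓜.μ (arm s)) fun _ => volume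
  have h1 := Measure.pi_map_pi (μ := fun s : Fin n ⊕ Fin m =>
      (𝓜.μ (arm s)).prod (volume : Measure unitInterval))
    (f := fun s z => (z.1, 𝓜.outcome (arm s) z.1 z.2)) fun s => (hh (arm s)).aemeasurable
  rw [show 𝓜.jointLaw n m = _ from e.map_eq.symm,
    Measure.map_map 𝓜.measurable_observations e.measurable]
  simp_rw [← hD]
  exact h1

lemma Describes.map_prod_outcome {Q : Measure S} {Y : Fin 2 → S → ℝ} {X : S → Cov k}
    {W : S → Fin 2} [∀ w, IsProbabilityMeasure (givenW Q W w)] (hdesc : 𝓜.Describes Q Y X W)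
    (hZ : Measurable (observed Y W)) (w : Fin 2) :
    ((𝓜.μ w).prod (volume : Measure unitInterval)).map (fun z => (z.1, 𝓜.outcome w z.1 z.2))
      = (givenW Q W w).map fun s => (X s, observed Y W s) := by
  rw [map_prod_eq_compProd (𝓜.measurable_outcome w)
    (Eventually.of_forall (hdesc.outcome_law w)), hdesc.law w,
    compProd_map_condDistrib hZ.aemeasurable]

/-- The matched differences of the sample have the law of those of the matching model. -/
lemma Describes.map_effects {Q : Measure S} {Y : Fin 2 → S → ℝ} {X : S → Cov k}
    {W : S → Fin 2} [∀ w, IsProbabilityMeasure (givenW Q W w)] (hdesc : 𝓜.Describes Q Y X W)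
    (hZ : Measurable (observed Y W)) {Ω : Type*} [MeasurableSpace Ω] {P : Measure Ω}
    [IsProbabilityMeasure P] {n m : ℕ} {Z₁ : Fin n → Ω → Cov k × ℝ} {Z₀ : Fin m → Ω → Cov k × ℝ}
    (hs : IsTwoSample P Q Y X W Z₁ Z₀) (V : Matrix (Fin k) (Fin k) ℝ) (M : ℕ) (c : ℝ) :
    AEMeasurable (fun ω => effects V M c (fun i => Z₁ i ω) (fun j => Z₀ j ω)) P ∧
    P.map (fun ω => effects V M c (fun i => Z₁ i ω) (fun j => Z₀ j ω))
      = (𝓜.jointLaw n m).map (fun z => 𝓜.sampleEffects V M c z.1 z.2) := by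
  have hD := hdesc.map_prod_outcome hZ
  have hae : ∀ s, AEMeasurable (Sum.elim Z₁ Z₀ s) P := by
    rintro (i | j)
    · exact (hs.treated i).aemeasurable_fst
    · exact (hs.control j).aemeasurable_fst
  have hae' : AEMeasurable (fun ω s => Sum.elim Z₁ Z₀ s ω) P := aemeasurable_pi_lambda _ hae
  have hlaw : P.map (fun ω s => Sum.elim Z₁ Z₀ s ω)
      = (𝓜.jointLaw n m).map fun z s => (z.1 s, 𝓜.outcome (arm s) (z.1 s) (z.2 s)) := by
    rw [map_jointLaw_eq_pi hD, iIndepFun.map_fun_eq_pi_map hae hs.indep]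
    congr 1
    funext s
    rcases s with i | j
    · exact (hs.treated i).map_eq
    · exact (hs.control j).map_eq
  have hE : Measurable fun y : Fin n ⊕ Fin m → Cov k × ℝ =>
      effects V M c (fun i => y (Sum.inl i)) (fun j => y (Sum.inr j)) := by
    have h2 : Measurable fun y : Fin n ⊕ Fin m → Cov k × ℝ =>
        ((fun i => y (Sum.inl i)), (fun j => y (Sum.inr j))) :=
      (measurable_pi_lambda _ fun i => measurable_pi_apply _).prodMk
        (measurable_pi_lambda _ fun j => measurable_pi_apply _)
    exact (measurable_effects V M c).comp h2
  refine ⟨hE.comp_aemeasurable hae', ?_⟩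
  have h1 := AEMeasurable.map_map_of_aemeasurable (μ := P) hE.aemeasurable hae'
  rw [hlaw, Measure.map_map hE 𝓜.measurable_observations] at h1
  exact h1.symm

end MatchingModel

/-- An exponent for the matching radius `N₁ ^ (-β)`: the bias is negligible for `1 / 2 < β`, treated
units are separated for `2 < β k`, and controls are plentiful for `β k < r`. -/
lemma exists_radius_exponent {k : ℕ} (hk : 1 ≤ k) {r : ℝ} (hr : max ((k : ℝ) / 2) 2 < r) :
    ∃ β : ℝ, 1 / 2 < β ∧ 2 < β * k ∧ β * k < r := by
  have hk' : (0 : ℝ) < k := by exact_mod_cast hk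
  obtain ⟨q, hq1, hq2⟩ := exists_between hr
  have h1 := (le_max_left _ _).trans_lt hq1
  have h2 := (le_max_right _ _).trans_lt hq1
  have h3 : q / k * k = q := by field_simp
  refine ⟨q / k, ?_, by rwa [h3], by rwa [h3]⟩
  rw [lt_div_iff₀ hk']
  linarith

end NNMatching

theorem proposition4p2
    -- the population
    {S : Type*} [MeasurableSpace S] [StandardBorelSpace S]
    (Q : Measure S) [IsProbabilityMeasure Q]
    {k : ℕ} (hk : 1 ≤ k)
    (Y : Fin 2 → S → ℝ) (X : S → NNMatching.Cov k) (W : S → Fin 2)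
    (hY : ∀ w, Measurable (Y w)) (hX : Measurable X) (hW : Measurable W)
    (hW_pos : ∀ w, Q (W ⁻¹' {w}) ≠ 0)
    -- conditional independence, covariates, outcomes
    (hCIA : CondIndepFun (NNMatching.sigmaX X) hX.comap_le (Y 0) W Q)
    (hcov : NNMatching.CovariateCondition Q X W)
    (hout : NNMatching.OutcomeCondition Q Y X W)
    -- sampling rates
    (N₁ N₀ : ℕ → ℕ) (hN₁ : Tendsto N₁ atTop atTop) (hN₀ : Tendsto N₀ atTop atTop)
    (r θ : ℝ) (hr : max ((k : ℝ) / 2) 2 < r) (hθ : 0 < θ)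
    (hrate : Tendsto (fun n => (N₁ n : ℝ) ^ r / (N₀ n : ℝ)) atTop (𝓝 θ))
    -- the samples
    {Ω : ℕ → Type*} [∀ n, MeasurableSpace (Ω n)]
    (P : ∀ n, Measure (Ω n)) [∀ n, IsProbabilityMeasure (P n)]
    (Z₁ : ∀ n, Fin (N₁ n) → Ω n → NNMatching.Cov k × ℝ)
    (Z₀ : ∀ n, Fin (N₀ n) → Ω n → NNMatching.Cov k × ℝ)
    (hsample : ∀ n, NNMatching.IsTwoSample (P n) Q Y X W (Z₁ n) (Z₀ n))
    -- the matching estimator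
    (V : Matrix (Fin k) (Fin k) ℝ) (hV : V.PosDef) (M : ℕ) (hM : 1 ≤ M)
    -- the null hypothesis
    (c : ℝ) (hnull : NNMatching.att Q Y W = c)
    (est : ∀ n, Ω n → Fin (N₁ n) → ℝ)
    (hest : ∀ n ω, est n ω =
      NNMatching.effects V M c (fun i => Z₁ n i ω) (fun j => Z₀ n j ω)) :
    -- asymptotic validity at every level
    (∀ α : ℝ, 0 < α → α < 1 →
      limsup (fun n => ∫ ω, NNMatching.signTest α (est n ω) ∂(P n)) atTop ≤ α) ∧
    -- the randomization distribution approximates the sampling distribution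
    (∀ δ : ℝ, 0 < δ → Tendsto (fun n => P n {ω | δ ≤ ⨆ t : ℝ,
        |NNMatching.randomizationCDF (est n ω) t - NNMatching.samplingCDF (P n) (est n) t|})
      atTop (𝓝 0)) ∧
    -- uniform convergence of both to the standard normal
    (∀ δ : ℝ, 0 < δ → Tendsto (fun n => P n {ω | δ ≤ ⨆ t : ℝ,
        |NNMatching.randomizationCDF (est n ω) t - NNMatching.stdNormalCDF t|})
      atTop (𝓝 0)) ∧
    Tendsto (fun n => ⨆ t : ℝ,
        |NNMatching.samplingCDF (P n) (est n) t - NNMatching.stdNormalCDF t|)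
      atTop (𝓝 0) := by
  have hprob := NNMatching.isProbabilityMeasure_givenW (W := W) hW_pos
  obtain ⟨𝓜, hdesc, b, hb, hbv⟩ := NNMatching.exists_matchingModel hY hX hW hcov hout
  have hint : Integrable (NNMatching.observed Y W) (NNMatching.givenW Q W 1) := by
    obtain ⟨μ, v, hμ, -⟩ := hout
    exact (hμ 1).1
  have hgap := 𝓜.integral_gap_eq_zero hdesc hY hX hW hCIA hcov hint hnull
  obtain ⟨ρ₀, b', U, hballs⟩ := NNMatching.MatchingModel.exists_ballBounds hdesc.law hcov
  have hs2 := NNMatching.MatchingModel.limitVar_pos hb hbv hM c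
  obtain ⟨κ, hκ1, hκ⟩ := NNMatching.exists_norm_le_of_matchDist_le hV
  have hκ0 : 0 < κ := one_pos.trans_le hκ1
  obtain ⟨β, hβ, hβ2, hβr⟩ := NNMatching.exists_radius_exponent hk hr
  have hρ := NNMatching.tendsto_sqrt_mul_rpow_neg hN₁ hβ
  have hρ0 : ∀ n, 0 ≤ (N₁ n : ℝ) ^ (-β) := fun n => by positivity
  have hbad := 𝓜.tendsto_not_goodConfig (M := M) hballs hN₁ hN₀ hθ hrate (by linarith) hβ2 hβr hκ0
  have hZ := NNMatching.measurable_observed hY hW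
  have hest' : ∀ n, est n = fun ω =>
      NNMatching.effects V M c (fun i => Z₁ n i ω) (fun j => Z₀ n j ω) := fun n =>
    funext (hest n)
  have hae : ∀ n, AEMeasurable (est n) (P n) := fun n => by
    rw [hest' n]; exact (hdesc.map_effects hZ (hsample n) V M c).1
  have hlaw : ∀ n, (P n).map (est n) = (𝓜.jointLaw (N₁ n) (N₀ n)).map
      fun z => 𝓜.sampleEffects V M c z.1 z.2 := fun n => by
    rw [hest' n]; exact (hdesc.map_effects hZ (hsample n) V M c).2
  have hτ := fun n => 𝓜.measurable_sampleEffects V M c (n := N₁ n) (m := N₀ n)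
  have hreal : ∀ n (s : Set (Fin (N₁ n) → ℝ)), MeasurableSet s →
      (P n).real {ω | est n ω ∈ s} = (𝓜.jointLaw (N₁ n) (N₀ n)).real
        {z | 𝓜.sampleEffects V M c z.1 z.2 ∈ s} := fun n s hs => by
    have h1 := map_measureReal_apply_of_aemeasurable (hae n) hs
    rw [hlaw n, map_measureReal_apply (hτ n) hs] at h1
    exact h1.symm
  have hsq : ∀ η : ℝ, 0 < η → Tendsto (fun n => (P n).real
      {ω | η ≤ |1 / (N₁ n : ℝ) * ∑ i, est n ω i ^ 2 - 𝓜.limitVar M c|}) atTop (𝓝 0) := by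
    intro η hη
    refine (𝓜.tendsto_average_sq (c := c) hN₁ hM hκ0.le hκ hρ hρ0 hbad hη).congr fun n => ?_
    exact (hreal n {v | η ≤ |1 / (N₁ n : ℝ) * ∑ i, v i ^ 2 - 𝓜.limitVar M c|}
      (measurableSet_le measurable_const (by fun_prop))).symm
  have hfour : ∀ η : ℝ, 0 < η → Tendsto (fun n => (P n).real
      {ω | η ≤ 1 / (N₁ n : ℝ) ^ 2 * ∑ i, est n ω i ^ 4}) atTop (𝓝 0) := by
    intro η hη
    refine (𝓜.tendsto_four (V := V) (c := c) hN₁ hM hbad hη).congr fun n => ?_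
    exact (hreal n {v | η ≤ 1 / (N₁ n : ℝ) ^ 2 * ∑ i, v i ^ 4}
      (measurableSet_le measurable_const (by fun_prop))).symm
  have hchar : ∀ t : ℝ, Tendsto (fun n => ∫ ω, Complex.exp
      (t * ((√(N₁ n))⁻¹ * ∑ i, est n ω i : ℝ) * Complex.I) ∂(P n)) atTop
      (𝓝 (Complex.exp (-((𝓜.limitVar M c : ℂ) * (t : ℂ) ^ 2) / 2))) := by
    intro t
    refine (𝓜.tendsto_charFun (V := V) hN₁ hM hκ0.le hκ hρ hρ0 hbad hgap t).congr fun n => ?_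
    have hF : Measurable fun v : Fin (N₁ n) → ℝ =>
        Complex.exp (t * ((√(N₁ n))⁻¹ * ∑ i, v i : ℝ) * Complex.I) := by fun_prop
    have h1 := integral_map (hae n) hF.aestronglyMeasurable
    rw [hlaw n, integral_map (hτ n).aemeasurable hF.aestronglyMeasurable] at h1
    rw [← h1]
    push_cast
    rfl
  have hrand : ∀ δ : ℝ, 0 < δ → Tendsto (fun n => (P n).real {ω | δ ≤ ⨆ t : ℝ,
      |NNMatching.randomizationCDF (est n ω) t - NNMatching.stdNormalCDF t|}) atTop (𝓝 0) :=
    fun δ hδ => NNMatching.tendsto_iSup_randomizationCDF hN₁ hs2 hsq hfour hδ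
  have hsamp := NNMatching.tendsto_iSup_samplingCDF hN₁ hae hs2 hchar hsq
  refine ⟨fun α h0 h1 => NNMatching.limsup_signTest_le hN₁ hae hrand hsamp h0 h1,
    fun δ hδ => ?_, fun δ hδ => ?_, hsamp⟩
  · exact NNMatching.tendsto_measure_of_tendsto_measureReal
      (NNMatching.tendsto_iSup_randomizationCDF_sub_samplingCDF hrand hsamp hδ)
  · exact NNMatching.tendsto_measure_of_tendsto_measureReal (hrand δ hδ)
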